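/- Let $p,q,r$ be pairwise coprime integers and let $K=P(p,q,r)\subset S^3$ be the pretzel knot with three columns of $p$, $q$ and $r$ half twists (left-handed for positive, right-handed for negative numbers; pairwise coprimeness implies that $K$ is a knot). Let $G(K)=\pi_1(S^3\setminus K,y_0)$ for any base point $y_0$, and let $m\in G(K)$ be any meridian of $K$. Let $\mathbf{i}=\begin{pmatrix} i&0\\0&-i\end{pmatrix}\in SU(2)$ and let $$R(K;\mathbf{i})=\{\rho\in\mathrm{Hom}(G(K),SU(2)) : \rho(m)\text{ is conjugate to }\mathbf{i}\}.$$ Let $$G(K)_{m,\mathbf{i}}=(G(K)\times\{\pm1\})/\langle (m^2,-1)\rangle ,$$ where $\langle\cdot\rangle$ denotes the normal subgroup generated by an element. Every $\rho\in R(K;\mathbf{i})$ factors uniquely through the epimorphism $G(K)\to G(K)_{m,\mathbf{i}}$, $g\mapsto[(g,1)]$, the factorization being $[(g,\varepsilon)]\mapsto\varepsilon\rho(g)$. Let $\mathfrak{su}(2)_\rho$ denote $\mathfrak{su}(2)$ with the action of $G(K)_{m,\mathbf{i}}$ obtained by composing this factorization with the adjoint representation of $SU(2)$. Then for every $\rho\in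 R(K;\mathbf{i})$ one has $$H^1(G(K)_{m,\mathbf{i}};\mathfrak{su}(2)_\rho)=0 .$$ In other words, every $\rho\in R(K;\mathbf{i})$, seen as a representation of $G(K)_{m,\mathbf{i}}$, is non-degenerate. -/

import Mathlib

noncomputable section

namespace Pretzel

/-! ## The pretzel knot as a subset of the 3-sphere -/

/-- The `3`-sphere, as the one-point compactification of `ℝ³`.  In the coordinates `(x, y, z)` of
`ℝ³` the diagrams below are seen by an observer far away in the direction of negative `y`, with `x`
pointing to the right and `z` pointing upwards. -/
abbrev S3 : Type := OnePoint (ℝ × ℝ × ℝ)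

/-- The two strands, over `0 ≤ z ≤ 1`, of the elementary `p`-tangle centred at `x = c`: a vertical
pair of antipodal helices of radius `1` making `|p|` half twists (so that the tangle has `|p|`
crossings), left-handed for `p > 0` and right-handed for `p < 0`.
The four end points are `(c ± 1, 0, 0)` and `(c ± 1, 0, 1)`. -/
def twistedStrands (c : ℝ) (p : ℤ) : Set (ℝ × ℝ × ℝ) :=
  {v | 0 ≤ v.2.2 ∧ v.2.2 ≤ 1 ∧ ∃ ε : ℝ, (ε = 1 ∨ ε = -1) ∧
    v.1 = c + ε * Real.cos (Real.pi * p * v.2.2) ∧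
    v.2.1 = -(ε * Real.sin (Real.pi * p * v.2.2))}

/-- The semicircle above `z = 1`, in the plane `y = 0`, joining `(c - r, 0, 1)` to
`(c + r, 0, 1)`. -/
def topArc (c r : ℝ) : Set (ℝ × ℝ × ℝ) :=
  {v | v.2.1 = 0 ∧ 1 ≤ v.2.2 ∧ (v.1 - c) ^ 2 + (v.2.2 - 1) ^ 2 = r ^ 2}

/-- The semicircle below `z = 0`, in the plane `y = 0`, joining `(c - r, 0, 0)` to
`(c + r, 0, 0)`. -/
def bottomArc (c r : ℝ) : Set (ℝ × ℝ × ℝ) :=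
  {v | v.2.1 = 0 ∧ v.2.2 ≤ 0 ∧ (v.1 - c) ^ 2 + v.2.2 ^ 2 = r ^ 2}

/-- The pretzel knot (or link) `P(p, q, r)` in `ℝ³`.  The elementary tangles with `p`, `q`, `r`
crossings are centred at `x = 0, 4, 8`; at the top and at the bottom the right end of each of them
is joined to the left end of the next one, and the right end of the last one to the left end of the
first one. -/
def curve (p q r : ℤ) : Set (ℝ × ℝ × ℝ) :=
  (twistedStrands 0 p ∪ twistedStrands 4 q ∪ twistedStrands 8 r) ∪
    (topArc 2 1 ∪ topArc 6 1 ∪ topArc 4 5) ∪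
    (bottomArc 2 1 ∪ bottomArc 6 1 ∪ bottomArc 4 5)

/-- The pretzel knot (or link) `P(p, q, r)` in the `3`-sphere. -/
def knot (p q r : ℤ) : Set S3 :=
  (fun v : ℝ × ℝ × ℝ => (v : S3)) '' curve p q r

/-- The complement of `P(p, q, r)` in the `3`-sphere. -/
abbrev Complement (p q r : ℤ) : Type := ↥((knot p q r)ᶜ)

/-- The knot group `G(K) = π₁(S³ ∖ K, y₀)` of `K = P(p, q, r)`. -/
abbrev KnotGroup (p q r : ℤ) (y₀ : Complement p q r) : Type :=
  FundamentalGroup (Complement p q r) y₀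

/-! ## Meridians -/

/-- The circle of radius `1` in the plane `x = 4` with centre `(4, 0, 6)`.  Its centre is the highest
point of the knot and it bounds a disc which meets the knot in this point only, transversally. -/
def meridianCircle (t : ℝ) : ℝ × ℝ × ℝ :=
  (4, Real.cos (2 * Real.pi * t), 6 + Real.sin (2 * Real.pi * t))

theorem meridianCircle_notMem (p q r : ℤ) (t : ℝ) :
    ((meridianCircle t : ℝ × ℝ × ℝ) : S3) ∈ (knot p q r)ᶜ := by
  rintro ⟨v, hv, h⟩
  have h' : v = meridianCircle t := OnePoint.coe_injective h
  subst h'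
  have h1 := Real.sin_sq_add_cos_sq (2 * Real.pi * t)
  have h2 := Real.neg_one_le_sin (2 * Real.pi * t)
  simp only [curve, twistedStrands, topArc, bottomArc, meridianCircle, Set.mem_union,
    Set.mem_ofPred_eq] at hv
  rcases hv with (((⟨_, h3, _⟩ | ⟨_, h3, _⟩) | ⟨_, h3, _⟩) |
    ((⟨h3, h4, h5⟩ | ⟨h3, h4, h5⟩) | ⟨h3, h4, h5⟩)) |
    ((⟨_, h3, _⟩ | ⟨_, h3, _⟩) | ⟨_, h3, _⟩)
  any_goals linarith
  all_goals rw [h3] at h1; nlinarith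

/-- The loop in the complement of the knot that runs once around the meridian circle. -/
def meridianLoop (p q r : ℤ) :
    Path (⟨meridianCircle 0, meridianCircle_notMem p q r 0⟩ : Complement p q r)
      ⟨meridianCircle 0, meridianCircle_notMem p q r 0⟩ where
  toFun t := ⟨meridianCircle (t : ℝ), meridianCircle_notMem p q r (t : ℝ)⟩
  continuous_toFun := by
    refine Continuous.subtype_mk (OnePoint.continuous_coe.comp ?_) _
    unfold meridianCircle
    fun_prop
  source' := by simp
  target' := by simp [meridianCircle]

/-- An element of the knot group is a meridian if it is represented by the meridian loop, run through
in one of the two directions and joined to the base point by some path. -/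
def IsMeridian (p q r : ℤ) {y₀ : Complement p q r} (m : KnotGroup p q r y₀) : Prop :=
  ∃ γ : Path (⟨meridianCircle 0, meridianCircle_notMem p q r 0⟩ : Complement p q r) y₀,
    m = FundamentalGroup.fromPath ⟦γ.symm.trans ((meridianLoop p q r).trans γ)⟧ ∨
    m = FundamentalGroup.fromPath ⟦γ.symm.trans ((meridianLoop p q r).symm.trans γ)⟧

/-! ## The group `SU(2)` and its adjoint representation -/

/-- The group `SU(2)`. -/
abbrev SU2 : Type := ↥(Matrix.specialUnitaryGroup (Fin 2) ℂ)

/-- The Lie algebra `𝔰𝔲(2)` of traceless skew-Hermitian matrices, as a real vector space. -/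
def su2 : Submodule ℝ (Matrix (Fin 2) (Fin 2) ℂ) where
  carrier := {X | X.conjTranspose = -X ∧ X.trace = 0}
  add_mem' := by
    rintro X Y ⟨hX, hX'⟩ ⟨hY, hY'⟩
    refine ⟨?_, ?_⟩
    · rw [Matrix.conjTranspose_add, hX, hY, neg_add]
    · rw [Matrix.trace_add, hX', hY', add_zero]
  zero_mem' := by simp
  smul_mem' := by
    rintro a X ⟨hX, hX'⟩
    refine ⟨?_, ?_⟩
    · rw [Matrix.conjTranspose_smul, hX, star_trivial, smul_neg]
    · rw [Matrix.trace_smul, hX', smul_zero]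

theorem SU2.coe_mul_coe_inv (g : SU2) :
    (g : Matrix (Fin 2) (Fin 2) ℂ) * ((g⁻¹ : SU2) : Matrix (Fin 2) (Fin 2) ℂ) = 1 := by
  rw [← Submonoid.coe_mul, mul_inv_cancel, Submonoid.coe_one]

theorem SU2.coe_inv_mul_coe (g : SU2) :
    ((g⁻¹ : SU2) : Matrix (Fin 2) (Fin 2) ℂ) * (g : Matrix (Fin 2) (Fin 2) ℂ) = 1 := by
  rw [← Submonoid.coe_mul, inv_mul_cancel, Submonoid.coe_one]

theorem SU2.conj_mem_su2 (g : SU2) {X : Matrix (Fin 2) (Fin 2) ℂ} (hX : X ∈ su2) :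
    (g : Matrix (Fin 2) (Fin 2) ℂ) * X * ((g⁻¹ : SU2) : Matrix (Fin 2) (Fin 2) ℂ) ∈ su2 := by
  have hs : ((g⁻¹ : SU2) : Matrix (Fin 2) (Fin 2) ℂ) =
      (g : Matrix (Fin 2) (Fin 2) ℂ).conjTranspose := rfl
  refine ⟨?_, ?_⟩
  · rw [hs, Matrix.conjTranspose_mul, Matrix.conjTranspose_mul, Matrix.conjTranspose_conjTranspose,
      hX.1]
    simp [Matrix.mul_assoc]
  · rw [Matrix.trace_mul_comm, ← Matrix.mul_assoc, SU2.coe_inv_mul_coe, Matrix.one_mul]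
    exact hX.2

/-- The adjoint representation `Ad_g X = g X g⁻¹` of `SU(2)` on `𝔰𝔲(2)`. -/
def Ad : Representation ℝ SU2 su2 where
  toFun g :=
    { toFun := fun X =>
        ⟨(g : Matrix (Fin 2) (Fin 2) ℂ) * (X : Matrix (Fin 2) (Fin 2) ℂ) *
          ((g⁻¹ : SU2) : Matrix (Fin 2) (Fin 2) ℂ), SU2.conj_mem_su2 g X.2⟩
      map_add' := fun X Y => by
        apply Subtype.ext
        simp [Matrix.mul_add, Matrix.add_mul]
      map_smul' := fun a X => by
        apply Subtype.ext
        simp }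
  map_one' := by
    ext X : 2
    simp
  map_mul' g h := by
    ext X : 2
    simp [Matrix.mul_assoc]

/-- The element `𝐢` of `SU(2)`, the diagonal matrix with entries `i` and `-i`. -/
def iSU2 : SU2 :=
  ⟨!![Complex.I, 0; 0, -Complex.I], by
    rw [Matrix.mem_specialUnitaryGroup_iff, Matrix.mem_unitaryGroup_iff]
    refine ⟨?_, ?_⟩
    · ext a b
      fin_cases a <;> fin_cases b <;> simp [Matrix.mul_apply, Matrix.star_apply]
    · simp [Matrix.det_fin_two]⟩

/-- The homomorphism `ℤ/2 = {1, -1} → SU(2)` that maps `-1` to minus the identity matrix. -/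
def centralHom : ℤˣ →* SU2 where
  toFun u :=
    ⟨((u : ℤ) : Matrix (Fin 2) (Fin 2) ℂ), by
      rcases Int.units_eq_one_or u with rfl | rfl
      · simp
      · rw [Matrix.mem_specialUnitaryGroup_iff, Matrix.mem_unitaryGroup_iff]
        refine ⟨?_, ?_⟩
        · simp
        · simp [Matrix.det_neg]⟩
  map_one' := by
    apply Subtype.ext
    simp
  map_mul' u v := by
    apply Subtype.ext
    simp

theorem centralHom_commute (A : SU2) (u : ℤˣ) : Commute A (centralHom u) := by
  apply Subtype.ext
  exact (Int.cast_commute (u : ℤ) (A : Matrix (Fin 2) (Fin 2) ℂ)).eq.symm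

theorem sq_of_isConj {A : SU2} (hA : IsConj A iSU2) : A ^ 2 = centralHom (-1) := by
  have h1 : iSU2 ^ 2 = centralHom (-1) := by
    apply Subtype.ext
    ext a b
    fin_cases a <;> fin_cases b <;> simp [iSU2, centralHom, pow_two]
  obtain ⟨c, hc⟩ := isConj_iff.1 hA
  have h2 : c * A ^ 2 * c⁻¹ = centralHom (-1) := by
    rw [← h1, ← hc, conj_pow]
  have h3 : A ^ 2 = c⁻¹ * (centralHom (-1) * c) := by
    rw [← h2]
    group
  rw [h3, ← (centralHom_commute c (-1)).eq, inv_mul_cancel_left]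

/-! ## The representation space and the group `G_{m,𝐢}` -/

section

variable {G : Type} [Group G]

/-- The space `R(K; 𝐢)` of all homomorphisms `ρ` from `G` to `SU(2)` such that `ρ(m)` is conjugate
to `𝐢`. -/
def RepSpace (m : G) : Set (G →* SU2) :=
  {ρ | IsConj (ρ m) iSU2}

/-- The group `G_{m,𝐢} = (G × ℤ/2) / ⟨m² (-1)⟩`, where `ℤ/2 = {1, -1}` and where the angle brackets
denote the normal subgroup generated by an element. -/
abbrev TracelessGroup (m : G) : Type :=
  (G × ℤˣ) ⧸ Subgroup.normalClosure {((m ^ 2, -1) : G × ℤˣ)}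

/-- The factorization of `ρ ∈ R(K; 𝐢)` through the epimorphism `G → G_{m,𝐢}`, `g ↦ [(g, 1)]`; it is
given by `[(g, ε)] ↦ ε ρ(g)`. -/
def factorization {m : G} (ρ : G →* SU2) (hρ : ρ ∈ RepSpace m) : TracelessGroup m →* SU2 :=
  QuotientGroup.lift _
    (ρ.noncommCoprod centralHom fun g u => centralHom_commute (ρ g) u) <| by
    refine Subgroup.normalClosure_le_normal ?_
    rintro _ rfl
    change ρ (m ^ 2) * centralHom (-1) = 1
    rw [map_pow, sq_of_isConj hρ, ← map_mul]
    simp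

/-- The first cohomology group `H¹(G_{m,𝐢}; 𝔰𝔲(2)_ρ)` of `G_{m,𝐢}` with coefficients in `𝔰𝔲(2)`,
twisted by the adjoint action determined by `ρ ∈ R(K; 𝐢)`. -/
abbrev TwistedH1 {m : G} (ρ : G →* SU2) (hρ : ρ ∈ RepSpace m) : Type :=
  groupCohomology.H1 (Rep.of (Ad.comp (factorization ρ hρ)))

end

end Pretzel

end

/-! Write s for the class of (1, -1) in G_{m,𝐢}. It is central with s² = 1, and every conjugate of m
or m⁻¹ has square s. The proof finds generators u, x, y, s of G_{m,𝐢} with u² = s, such that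
conjugation by u inverts x and y, and x^p = y^r = z^q for z = s(xy)⁻¹
(`exists_tracelessGroup_generators`). The cohomology computation uses only these relations; no
complete presentation of the knot group is needed.

Topology: each region of the diagram has a Dehn generator, the holonomy of a line through this
region perpendicular to the diagram (`lineHol`). It is trivial for the outer region. A half twist
with regions l and r beside it turns the region m between the strands into r m⁻¹ l
(`lineHol_halfTwist`). The knot group is generated by the elements u, d, e of the region below the
top arc and of the two gaps between the columns (`closure_lineHol_eq_top`), and a meridian is
conjugate to u or u⁻¹ (`isConj_of_isMeridian`).

Algebra: in G_{m,𝐢} one has u² = s. As at most one exponent is even, the same relation spreads to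
the strands at all ends of the columns (`parity_chain`). A half twist then becomes left
multiplication by s r l⁻¹ (`halfTwist_eq_mul`). With v for the region above the bottom arc, the
three columns say that u = (s d)^p v = (s e d⁻¹)^q v = (s e⁻¹)^r v. So x = s d and y = s e⁻¹ satisfy
the relations above.

Cohomology: let f be a crossed homomorphism and h = x^p, which commutes with x and y. Since s acts
trivially and has order two, f(s) = 0. There are three cases. If ρ(h) ≠ ±1, then f can be normalized
so that f(h), and with it f(x) and f(y), lies on the axis of ρ(h). There f is additive, and the
relations become a linear system that has only the zero solution, as pq + qr + rp ≠ 0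
(`eq_zero_of_smul_eq`). The value f(u) lies on the same axis, which u reverses, so it is a
coboundary. If ρ(h) = ±1 and ρ(x), ρ(y) do not commute, then f(h) = 0, so f is a coboundary on each
of x, y and xy separately. As for triangle groups, these three fit together
(`SU2.exists_eq_smul_axis_add`), and f(u) is fixed by two rotations with different axes. If ρ(h) =
±1 and ρ(x), ρ(y) commute, then coprimality forces both to be ±1. The linear system gives f(x) =
f(y) = 0, and u² = s makes f(u) a coboundary. -/

open Topology

/-! ### Holonomies and their potentials -/

/-- A multiplicative, homotopy invariant assignment of group elements to the paths of a space. -/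
structure Holonomy (X G : Type*) [TopologicalSpace X] [Group G] where
  val : ∀ {a b : X}, Path a b → G
  val_trans : ∀ {a b c : X} (γ : Path a b) (δ : Path b c), val (γ.trans δ) = val γ * val δ
  val_homotopic : ∀ {a b : X} {γ δ : Path a b}, γ.Homotopic δ → val γ = val δ

namespace Holonomy

variable {X Y Z G : Type*} [TopologicalSpace X] [TopologicalSpace Y] [TopologicalSpace Z] [Group G]
  (φ : Holonomy X G)

theorem val_refl (a : X) : φ.val (Path.refl a) = 1 := by
  have h := φ.val_trans (Path.refl a) (Path.refl a)
  rw [Path.refl_trans_refl] at h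
  exact left_eq_mul.1 h

theorem val_symm {a b : X} (γ : Path a b) : φ.val γ.symm = (φ.val γ)⁻¹ := by
  rw [eq_inv_iff_mul_eq_one, ← φ.val_trans, ← φ.val_refl b]
  exact φ.val_homotopic ⟨(Path.Homotopy.reflSymmTrans γ).symm⟩

theorem val_congr {a b a' b' : X} (γ : Path a b) (δ : Path a' b') (h : ∀ t, γ t = δ t) :
    φ.val γ = φ.val δ := by
  have ha : a = a' := by simpa using h 0
  have hb : b = b' := by simpa using h 1
  subst ha hb
  congr 1
  ext t
  exact h t

/-- A function `k` on the source of a map `f` is a potential of a holonomy if the holonomy of each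
path in the image of `f` that lifts to the source is the quotient of the values of `k` at its
end points. -/
def IsPotential (f : C(Y, X)) (k : Y → G) : Prop :=
  ∀ (a b : Y) (γ : Path a b), φ.val (γ.map f.continuous) = k a * (k b)⁻¹

variable {φ}

theorem IsPotential.comp {f : C(Y, X)} {k : Y → G} (h : φ.IsPotential f k) (g : C(Z, Y)) :
    φ.IsPotential (f.comp g) (k ∘ g) := by
  intro a b γ
  exact h _ _ (γ.map g.continuous)

theorem IsPotential.congr {f f' : C(Y, X)} {k : Y → G} (h : φ.IsPotential f k)
    (hf : ∀ y, f y = f' y) : φ.IsPotential f' k := by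
  obtain rfl : f = f' := ContinuousMap.ext hf
  exact h

/-- Both potentials compute the same holonomy, so on a path component they differ by right
multiplication with a constant. The identities between Dehn generators arise from such comparisons.
-/
theorem IsPotential.inv_mul_eq {f : C(Y, X)} {k k' : Y → G} (h : φ.IsPotential f k)
    (h' : φ.IsPotential f k') {a b : Y} (hab : Joined a b) :
    (k a)⁻¹ * k' a = (k b)⁻¹ * k' b := by
  have h1 := (h a b hab.somePath).symm.trans (h' a b hab.somePath)
  rw [inv_mul_eq_iff_eq_mul, ← mul_assoc, h1, inv_mul_cancel_right]

theorem IsPotential.eq_of_const {f : C(Y, X)} {k : Y → G} (h : φ.IsPotential f k) {a b : Y}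
    (hf : ∀ y y', f y = f y') (hab : Joined a b) : k a = k b := by
  have h1 := h a b hab.somePath
  rw [φ.val_congr _ (Path.refl (f a)) (fun t => hf _ _), φ.val_refl] at h1
  exact mul_inv_eq_one.1 h1.symm

/-- The value at a point is the holonomy of any path to a fixed base point; simple connectivity
makes the choice of the path irrelevant. -/
theorem exists_isPotential [SimplyConnectedSpace Y] (φ : Holonomy X G) (f : C(Y, X)) :
    ∃ k, φ.IsPotential f k := by
  obtain ⟨o⟩ : Nonempty Y := inferInstance
  refine ⟨fun y => φ.val ((PathConnectedSpace.somePath y o).map f.continuous), fun a b γ => ?_⟩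
  rw [eq_mul_inv_iff_mul_eq, ← φ.val_trans, ← Path.map_trans]
  exact φ.val_homotopic ((SimplyConnectedSpace.paths_homotopic _ _).map f)

/-- The track of a point under a homotopy. -/
def track (H : C(Y × unitInterval, X)) (y : Y) : Path (H (y, 0)) (H (y, 1)) where
  toFun t := H (y, t)
  continuous_toFun := by fun_prop
  source' := rfl
  target' := rfl

/-- The tracks of a contraction define a potential. -/
theorem isPotential_of_contraction (φ : Holonomy X G) (H : C(Y × unitInterval, X))
    (hH : ∀ y y', H (y, 1) = H (y', 1)) (f : C(Y, X)) (hf : ∀ y, H (y, 0) = f y) :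
    φ.IsPotential f (fun y => φ.val (track H y)) := by
  intro a b γ
  have hs : SimplyConnectedSpace (unitInterval × unitInterval) := by
    have : ContractibleSpace unitInterval :=
      (convex_Icc (0 : ℝ) 1).contractibleSpace ⟨0, by simp⟩
    infer_instance
  -- A potential on the square swept out by γ expresses all four edges at once. The edge at the end
  -- of the contraction is constant, so the other three edges give the claim.
  obtain ⟨k, hk⟩ := φ.exists_isPotential
    (⟨fun s => H (γ s.1, s.2), by fun_prop⟩ : C(unitInterval × unitInterval, X))
  let I1 : Path (0 : unitInterval) 1 := ⟨⟨id, continuous_id⟩, rfl, rfl⟩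
  have hh : ∀ t : unitInterval, φ.val ((I1.prod (Path.refl t)).map
      (ContinuousMap.continuous ⟨fun s => H (γ s.1, s.2), by fun_prop⟩)) =
      k (0, t) * (k (1, t))⁻¹ := fun t => hk _ _ (I1.prod (Path.refl t))
  have hv : ∀ t : unitInterval, φ.val (((Path.refl t).prod I1).map
      (ContinuousMap.continuous ⟨fun s => H (γ s.1, s.2), by fun_prop⟩)) =
      k (t, 0) * (k (t, 1))⁻¹ := fun t => hk _ _ ((Path.refl t).prod I1)
  have h0 : φ.val (γ.map f.continuous) = k (0, 0) * (k (1, 0))⁻¹ := by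
    rw [← hh 0]
    exact φ.val_congr _ _ fun t => (hf _).symm
  have h1 : 1 = k (0, 1) * (k (1, 1))⁻¹ := by
    rw [← hh 1, ← φ.val_refl (H (a, 1))]
    exact φ.val_congr _ _ fun t => hH _ _
  have ha : φ.val (track H a) = k (0, 0) * (k (0, 1))⁻¹ := by
    rw [← hv 0]
    refine φ.val_congr _ _ fun t => ?_
    change H (a, t) = H (γ 0, t)
    rw [γ.source]
  have hb : φ.val (track H b) = k (1, 0) * (k (1, 1))⁻¹ := by
    rw [← hv 1]
    refine φ.val_congr _ _ fun t => ?_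
    change H (b, t) = H (γ 1, t)
    rw [γ.target]
  beta_reduce
  rw [h0, ha, hb, mul_inv_eq_one.1 h1.symm]
  group

/-- Potentials that are only locally defined, and only up to a subgroup, still compute the holonomy of a
path up to this subgroup. -/
theorem inv_mul_val_mul_mem (φ : Holonomy X G) (S : Subgroup G) (P : X → G → Prop)
    (hP : ∀ x g g', P x g → P x g' → g⁻¹ * g' ∈ S) {a b : X} (γ : Path a b)
    (hγ : ∀ t, ∃ U : Set X, IsOpen U ∧ γ t ∈ U ∧ ∀ (x y : X) (δ : Path x y), (∀ s, δ s ∈ U) →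
      ∃ g g', P x g ∧ P y g' ∧ g⁻¹ * φ.val δ * g' ∈ S)
    {g g' : G} (hg : P a g) (hg' : P b g') : g⁻¹ * φ.val γ * g' ∈ S := by
  have hI : ContractibleSpace unitInterval :=
      (convex_Icc (0 : ℝ) 1).contractibleSpace ⟨0, by simp⟩
  obtain ⟨k, hk⟩ := φ.exists_isPotential (⟨γ, by fun_prop⟩ : C(unitInterval, X))
  have hex : ∀ t, ∃ g, P (γ t) g := by
    intro t
    obtain ⟨U, -, hU, h⟩ := hγ t
    obtain ⟨g, g', h1, -⟩ := h _ _ (Path.refl (γ t)) (fun s => hU)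
    exact ⟨g, h1⟩
  choose p hp using hex
  have hloc : ∀ t, ∃ U : Set X, IsOpen U ∧ γ t ∈ U ∧ ∀ (x y : X) (δ : Path x y), (∀ s, δ s ∈ U) →
      ∀ g g', P x g → P y g' → g⁻¹ * φ.val δ * g' ∈ S := by
    intro t
    obtain ⟨U, h1, h2, h3⟩ := hγ t
    refine ⟨U, h1, h2, fun x y δ hδ g g' hg hg' => ?_⟩
    obtain ⟨e, e', he, he', h4⟩ := h3 x y δ hδ
    have h5 := S.mul_mem (S.mul_mem (hP _ _ _ hg he) h4) (hP _ _ _ he' hg')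
    convert h5 using 1
    group
  -- The local values p and the potential k along γ differ by an element whose class modulo S is
  -- locally constant, hence constant on the interval. No subdivision of the path is needed.
  have key : ∀ s t : unitInterval, (p s)⁻¹ * k s * ((p t)⁻¹ * k t)⁻¹ ∈ S := by
    let r : Setoid unitInterval :=
      { r := fun s t => (p s)⁻¹ * k s * ((p t)⁻¹ * k t)⁻¹ ∈ S
        iseqv := by
          refine ⟨fun s => by simp, fun {s t} h => ?_, fun {s t u} h h' => ?_⟩
          · have := S.inv_mem h
            convert this using 1
            group
          · have := S.mul_mem h h'
            convert this using 1
            group }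
    have hc : IsLocallyConstant (fun s => (Quotient.mk r s)) := by
      rw [IsLocallyConstant.iff_eventually_eq]
      intro t
      obtain ⟨U, h1, h2, h3⟩ := hloc t
      have hU : γ ⁻¹' U ∈ 𝓝 t := (h1.preimage γ.continuous).mem_nhds h2
      obtain ⟨V, hV, hVc, hVU⟩ : ∃ V ∈ 𝓝 t, IsPathConnected V ∧ V ⊆ γ ⁻¹' U := by
        have : LocallyPathConnectedSpace unitInterval :=
          (convex_Icc (0 : ℝ) 1).locallyPathConnectedSpace
        obtain ⟨V, ⟨hV, hVc⟩, hVU⟩ := (path_connected_basis t).mem_iff.1 hU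
        exact ⟨V, hV, hVc, hVU⟩
      filter_upwards [hV] with s hs
      refine Quotient.sound (s := r) ?_
      change (p s)⁻¹ * k s * ((p t)⁻¹ * k t)⁻¹ ∈ S
      have hj := hVc.joinedIn s hs t (mem_of_mem_nhds hV)
      have h4 := h3 _ _ (hj.somePath.map γ.continuous) (fun u => hVU (hj.somePath_mem u)) _ _
        (hp s) (hp t)
      have h5 : φ.val (hj.somePath.map γ.continuous) = k s * (k t)⁻¹ := hk _ _ _
      rw [h5] at h4
      convert h4 using 1
      group
    intro s t
    exact Quotient.exact (s := r) (hc.apply_eq_of_preconnectedSpace s t)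
  have h0 := hP _ _ _ hg (by simpa using hp 0)
  have h1 := hP _ _ _ (by simpa using hp 1) hg'
  have h2 := S.mul_mem (S.mul_mem h0 (key 0 1)) h1
  have h3 : φ.val γ = k 0 * (k 1)⁻¹ := by
    rw [← hk 0 1 ⟨⟨id, continuous_id⟩, rfl, rfl⟩]
    exact φ.val_congr _ _ fun t => rfl
  rw [h3]
  convert h2 using 1
  group

end Holonomy

/-! ### The tautological holonomy in the fundamental group -/

open Classical in
/-- A class of paths from `a` to `y`, which is trivial for `a = y`. -/
noncomputable def tailClass {X : Type*} [TopologicalSpace X] {y a : X} (h : Joined a y) :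
    Path.Homotopic.Quotient a y :=
  if ha : a = y then (Path.Homotopic.Quotient.refl y).cast ha rfl
  else Path.Homotopic.Quotient.mk h.somePath

open Classical in
/-- The holonomy of a space with values in the fundamental group at `y`: it sends a loop at `y` to
the inverse of its class, since the product of the fundamental group composes loops from right to
left. -/
noncomputable def loopHolonomy {X : Type*} [TopologicalSpace X] (y : X) :
    Holonomy X (FundamentalGroup X y) where
  val {a b} γ :=
    -- Paths outside the path component of y get the value 1. This is compatible with products
    -- because composable paths lie in one component.
    if h : Joined b y then
      (FundamentalGroup.fromPath ((tailClass (Joined.trans ⟨γ⟩ h)).symm.trans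
        ((Path.Homotopic.Quotient.mk γ).trans (tailClass h))))⁻¹
    else 1
  val_trans {a b c} γ δ := by
    by_cases h : Joined c y
    · have hb : Joined b y := Joined.trans ⟨δ⟩ h
      simp only [h, hb, dif_pos]
      rw [← mul_inv_rev, FundamentalGroup.mul_def]
      congr 1
      simp [Path.Homotopic.Quotient.mk_trans, FundamentalGroup.fromPath,
        FundamentalGroup.fromArrow]
      rw [← Path.Homotopic.Quotient.trans_assoc (tailClass hb), Path.Homotopic.Quotient.trans_symm,
        Path.Homotopic.Quotient.refl_trans]
    · have hb : ¬ Joined b y := fun hb => h (Joined.trans (Joined.symm ⟨δ⟩) hb)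
      simp [h, hb]
  val_homotopic {a b} γ δ h := by
    rw [Path.Homotopic.Quotient.eq.2 h]

theorem loopHolonomy_val_loop {X : Type*} [TopologicalSpace X] {y : X} (γ : Path y y) :
    (loopHolonomy y).val γ = (FundamentalGroup.fromPath (Path.Homotopic.Quotient.mk γ))⁻¹ := by
  have h : Joined y y := Joined.refl y
  simp only [loopHolonomy, h, tailClass, dif_pos, Path.Homotopic.Quotient.cast_rfl_rfl,
    Path.Homotopic.Quotient.trans_refl]
  congr 1
  exact Path.Homotopic.Quotient.refl_trans (Path.Homotopic.Quotient.mk γ)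

theorem exists_loopHolonomy_eq {X : Type*} [TopologicalSpace X] {y : X}
    (g : FundamentalGroup X y) : ∃ γ : Path y y, (loopHolonomy y).val γ = g := by
  obtain ⟨γ, hγ⟩ := Path.Homotopic.Quotient.mk_surjective (g⁻¹).toPath
  refine ⟨γ, ?_⟩
  rw [loopHolonomy_val_loop, hγ]
  exact inv_inv g

section Compl

variable {E : Type*} [TopologicalSpace E]

/-- The point of the complement of `C` that is given by a vector. -/
def complPoint {C : Set E} (v : E) (h : v ∉ C) : ↥((fun v : E => (v : OnePoint E)) '' C)ᶜ :=
  ⟨v, by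
    rintro ⟨u, hu, hu'⟩
    exact h (OnePoint.coe_injective hu' ▸ hu)⟩

theorem continuous_complPoint {Z : Type*} [TopologicalSpace Z] {C : Set E} {f : Z → E}
    (hf : Continuous f) (h : ∀ z, f z ∉ C) : Continuous fun z => complPoint (f z) (h z) :=
  (OnePoint.continuous_coe.comp hf).subtype_mk _

end Compl

/-! ### Rays to infinity -/

section Ray

variable {E : Type*} [NormedAddCommGroup E] [NormedSpace ℝ E]

/-- The pairs of a point and a direction such that the ray that starts at the point in this direction
avoids the set `C`. -/
def raySet (C : Set E) : Set (E × E) :=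
  {w | w.2 ≠ 0 ∧ ∀ s : ℝ, 0 ≤ s → w.1 + s • w.2 ∉ C}

open Classical in
/-- The parametrization of the ray from `v` to infinity with direction `e` by the unit interval. -/
noncomputable def rayPoint (v e : E) (t : ℝ) : OnePoint E :=
  if t < 1 then ((v + (t / (1 - t)) • e : E) : OnePoint E) else OnePoint.infty

/-- Only t = 1 needs an argument: nearby rays with nearby parameters leave every bounded set,
because t / (1 - t) times a direction of norm at least ‖e‖ / 2 outweighs the starting point. -/
theorem continuousAt_rayPoint {v e : E} (he : e ≠ 0) {t : ℝ} (ht : t ≤ 1) :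
    ContinuousAt (fun w : (E × E) × ℝ => rayPoint w.1.1 w.1.2 w.2) ((v, e), t) := by
  rcases ht.lt_or_eq with ht | rfl
  · have h1 : ContinuousAt (fun w : (E × E) × ℝ =>
        ((w.1.1 + (w.2 / (1 - w.2)) • w.1.2 : E) : OnePoint E)) ((v, e), t) := by
      refine OnePoint.continuous_coe.continuousAt.comp ?_
      have : (1 : ℝ) - t ≠ 0 := by linarith
      fun_prop (disch := assumption)
    refine h1.congr ?_
    have h2 : ∀ᶠ w : (E × E) × ℝ in 𝓝 ((v, e), t), w.2 < 1 :=
      continuousAt_snd.eventually (gt_mem_nhds ht)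
    filter_upwards [h2] with w hw
    simp [rayPoint, hw]
  · rw [ContinuousAt]
    have h0 : rayPoint v e 1 = OnePoint.infty := by simp [rayPoint]
    rw [h0, (OnePoint.hasBasis_nhds_infty (X := E)).tendsto_right_iff]
    rintro K ⟨-, hK⟩
    obtain ⟨R, hR⟩ := hK.isBounded.exists_norm_le
    have he' : 0 < ‖e‖ := norm_pos_iff.2 he
    have h1 : ∀ᶠ w : (E × E) × ℝ in 𝓝 ((v, e), 1), ‖w.1.1‖ < ‖v‖ + 1 :=
      (by fun_prop : ContinuousAt (fun w : (E × E) × ℝ => ‖w.1.1‖) ((v, e), 1)).eventually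
        (gt_mem_nhds (by simp))
    have h2 : ∀ᶠ w : (E × E) × ℝ in 𝓝 ((v, e), 1), ‖e‖ / 2 < ‖w.1.2‖ :=
      (by fun_prop : ContinuousAt (fun w : (E × E) × ℝ => ‖w.1.2‖) ((v, e), 1)).eventually
        (lt_mem_nhds (by simpa using he'))
    -- This is the required lower bound for t / (1 - t) with the denominator cleared, so that both
    -- sides are continuous at t = 1.
    have h3 : ∀ᶠ w : (E × E) × ℝ in 𝓝 ((v, e), 1),
        (|R| + ‖v‖ + 1) * (1 - w.2) < w.2 * (‖e‖ / 2) := by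
      refine (by fun_prop : ContinuousAt (fun w : (E × E) × ℝ => (|R| + ‖v‖ + 1) * (1 - w.2))
        ((v, e), 1)).eventually_lt
        (by fun_prop : ContinuousAt (fun w : (E × E) × ℝ => w.2 * (‖e‖ / 2)) ((v, e), 1)) ?_
      simpa using he'
    have h4 : ∀ᶠ w : (E × E) × ℝ in 𝓝 ((v, e), 1), 0 < w.2 :=
      continuousAt_snd.eventually (lt_mem_nhds (by simp))
    filter_upwards [h1, h2, h3, h4] with w h1 h2 h3 h4
    by_cases hw : w.2 < 1
    · left
      simp only [rayPoint, hw, if_true]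
      refine ⟨_, fun hmem => ?_, rfl⟩
      have h5 := hR _ hmem
      have hw' : 0 < 1 - w.2 := by linarith
      have h6 : ‖(w.2 / (1 - w.2)) • w.1.2‖ = (w.2 / (1 - w.2)) * ‖w.1.2‖ := by
        rw [norm_smul, Real.norm_of_nonneg (by positivity)]
      have h7 := norm_sub_le (w.1.1 + (w.2 / (1 - w.2)) • w.1.2) w.1.1
      rw [add_sub_cancel_left, h6] at h7
      have h8 : (w.2 / (1 - w.2)) * (‖e‖ / 2) ≤ (w.2 / (1 - w.2)) * ‖w.1.2‖ := by
        gcongr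
      have h9 : |R| + ‖v‖ + 1 < (w.2 / (1 - w.2)) * (‖e‖ / 2) := by
        rw [div_mul_eq_mul_div, lt_div_iff₀ hw']
        exact h3
      have := le_abs_self R
      linarith
    · right
      simp [rayPoint, hw]

theorem rayPoint_notMem {C : Set E} {v e : E} (h : (v, e) ∈ raySet C) {t : ℝ} (ht : 0 ≤ t) :
    rayPoint v e t ∈ ((fun v : E => (v : OnePoint E)) '' C)ᶜ := by
  rintro ⟨u, hu, hu'⟩
  unfold rayPoint at hu'
  split_ifs at hu' with h1
  · exact h.2 _ (div_nonneg ht (by linarith)) (OnePoint.coe_injective hu' ▸ hu)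
  · exact OnePoint.coe_ne_infty _ hu'

theorem notMem_of_mem_raySet {C : Set E} {w : E × E} (h : w ∈ raySet C) : w.1 ∉ C := by
  simpa using h.2 0 le_rfl

/-- The contraction of the space of rays to infinity. -/
noncomputable def rayContraction (C : Set E) :
    C(raySet C × unitInterval, ↥((fun v : E => (v : OnePoint E)) '' C)ᶜ) where
  toFun z := ⟨rayPoint z.1.1.1 z.1.1.2 z.2, rayPoint_notMem z.1.2 z.2.2.1⟩
  continuous_toFun := by
    refine Continuous.subtype_mk (continuous_iff_continuousAt.2 fun z => ?_) _
    exact (continuousAt_rayPoint z.1.2.1 z.2.2.2).comp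
      (f := fun z : raySet C × unitInterval => (z.1.1, (z.2 : ℝ))) (by fun_prop)

variable {C : Set E} {G : Type*} [Group G] (φ : Holonomy ↥((fun v : E => (v : OnePoint E)) '' C)ᶜ G)

open Classical in
/-- The holonomy of the ray from `v` to infinity with direction `e`. -/
noncomputable def rayHol (v e : E) : G :=
  if h : (v, e) ∈ raySet C then φ.val (Holonomy.track (rayContraction C) ⟨(v, e), h⟩) else 1

/-- The contraction of the space of rays is pulled back along a family of rays, in which the
direction may vary with the point. -/
theorem isPotential_rayHol {Z : Type*} [TopologicalSpace Z]
    (f : C(Z, ↥((fun v : E => (v : OnePoint E)) '' C)ᶜ)) {v e : Z → E} (hv : Continuous v)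
    (he : Continuous e) (h : ∀ z, (v z, e z) ∈ raySet C) (hf : ∀ z, (f z : OnePoint E) = v z) :
    φ.IsPotential f (fun z => rayHol φ (v z) (e z)) := by
  have h1 := φ.isPotential_of_contraction (rayContraction C)
    (by
      intro y y'
      apply Subtype.ext
      simp [rayContraction, rayPoint])
    ⟨fun z => complPoint z.1.1 (notMem_of_mem_raySet z.2),
      continuous_complPoint (by fun_prop) _⟩
    (by
      intro y
      apply Subtype.ext
      simp [rayContraction, rayPoint, complPoint])
  have h2 := (h1.comp ⟨fun z : Z => (⟨(v z, e z), h z⟩ : raySet C), by fun_prop⟩).congr (f' := f)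
    (fun z => Subtype.ext (hf z).symm)
  convert h2 using 2 with z
  simp [rayHol, h]

end Ray

namespace Pretzel

/-! ### The curve, level by level -/

/-- The elementary tangle centred at `x = c` is one of the three columns, and it has `n` half twists. -/
def IsColumn (p q r : ℤ) (c : ℝ) (n : ℤ) : Prop :=
  (c = 0 ∧ n = p) ∨ (c = 4 ∧ n = q) ∨ (c = 8 ∧ n = r)

/-- The points `(x, y)` on the two strands of the tangle centred at `c`, at a level with angle `θ`. -/
def OnStrand (c θ x y : ℝ) : Prop :=
  ∃ ε : ℝ, (ε = 1 ∨ ε = -1) ∧ x = c + ε * Real.cos θ ∧ y = -(ε * Real.sin θ)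

/-- The square of the distance from `(a, [0, 1])` in the plane of the diagram. -/
noncomputable def stadium (a x z : ℝ) : ℝ :=
  (x - a) ^ 2 + (max (|z - 1 / 2| - 1 / 2) 0) ^ 2

variable {p q r : ℤ} {c : ℝ} {n : ℤ}

theorem OnStrand.sq_add_sq {c θ x y : ℝ} (h : OnStrand c θ x y) : (x - c) ^ 2 + y ^ 2 = 1 := by
  obtain ⟨ε, hε, rfl, rfl⟩ := h
  have := Real.sin_sq_add_cos_sq θ
  rcases hε with rfl | rfl <;> linarith

theorem OnStrand.sq_eq {c θ x y : ℝ} (h : OnStrand c θ x y) : (x - c) ^ 2 = Real.cos θ ^ 2 := by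
  obtain ⟨ε, hε, rfl, rfl⟩ := h
  rcases hε with rfl | rfl <;> ring

theorem exists_onStrand_iff {c θ x : ℝ} :
    (∃ y, OnStrand c θ x y) ↔ (x - c) ^ 2 = Real.cos θ ^ 2 := by
  refine ⟨fun ⟨y, h⟩ => h.sq_eq, fun h => ?_⟩
  rcases sq_eq_sq_iff_eq_or_eq_neg.1 h with h | h
  · exact ⟨-(1 * Real.sin θ), 1, Or.inl rfl, by linarith, rfl⟩
  · exact ⟨-(-1 * Real.sin θ), -1, Or.inr rfl, by linarith, rfl⟩

theorem onStrand_iff_of_sin_eq_zero {c θ x y : ℝ} (hθ : Real.sin θ = 0) :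
    OnStrand c θ x y ↔ y = 0 ∧ (x = c + 1 ∨ x = c - 1) := by
  have h1 := Real.sin_sq_add_cos_sq θ
  have h2 : Real.cos θ = 1 ∨ Real.cos θ = -1 := by
    rw [hθ] at h1
    have h3 : Real.cos θ ^ 2 = 1 ^ 2 := by linarith
    exact sq_eq_sq_iff_eq_or_eq_neg.1 h3
  constructor
  · rintro ⟨ε, hε, rfl, rfl⟩
    rw [hθ]
    refine ⟨by simp, ?_⟩
    rcases hε with rfl | rfl <;> rcases h2 with h2 | h2 <;> rw [h2] <;> norm_num [sub_eq_add_neg]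
  · rintro ⟨rfl, h⟩
    rcases h with rfl | rfl <;> rcases h2 with h2 | h2
    · exact ⟨1, by simp, by rw [h2]; ring, by simp [hθ]⟩
    · exact ⟨-1, by simp, by rw [h2]; ring, by simp [hθ]⟩
    · exact ⟨-1, by simp, by rw [h2]; ring, by simp [hθ]⟩
    · exact ⟨1, by simp, by rw [h2]; ring, by simp [hθ]⟩

theorem mem_twistedStrands {x y z : ℝ} :
    (x, y, z) ∈ twistedStrands c n ↔ 0 ≤ z ∧ z ≤ 1 ∧ OnStrand c (Real.pi * n * z) x y :=
  Iff.rfl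

theorem mem_topArc {a b x y z : ℝ} :
    (x, y, z) ∈ topArc a b ↔ y = 0 ∧ 1 ≤ z ∧ (x - a) ^ 2 + (z - 1) ^ 2 = b ^ 2 :=
  Iff.rfl

theorem mem_bottomArc {a b x y z : ℝ} :
    (x, y, z) ∈ bottomArc a b ↔ y = 0 ∧ z ≤ 0 ∧ (x - a) ^ 2 + z ^ 2 = b ^ 2 :=
  Iff.rfl

theorem mem_curve_iff {x y z : ℝ} :
    (x, y, z) ∈ curve p q r ↔
      (0 ≤ z ∧ z ≤ 1 ∧ ∃ c n, IsColumn p q r c n ∧ OnStrand c (Real.pi * n * z) x y) ∨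
      (y = 0 ∧ 1 ≤ z ∧ ((x - 2) ^ 2 + (z - 1) ^ 2 = 1 ∨ (x - 6) ^ 2 + (z - 1) ^ 2 = 1 ∨
        (x - 4) ^ 2 + (z - 1) ^ 2 = 25)) ∨
      (y = 0 ∧ z ≤ 0 ∧ ((x - 2) ^ 2 + z ^ 2 = 1 ∨ (x - 6) ^ 2 + z ^ 2 = 1 ∨
        (x - 4) ^ 2 + z ^ 2 = 25)) := by
  simp only [curve, Set.mem_union, mem_twistedStrands, mem_topArc, mem_bottomArc, IsColumn]
  have e1 : (5 : ℝ) ^ 2 = 25 := by norm_num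
  rw [e1, one_pow]
  constructor
  · rintro ((((⟨h1, h2, h3⟩ | ⟨h1, h2, h3⟩) | ⟨h1, h2, h3⟩) | h) | h)
    · exact Or.inl ⟨h1, h2, 0, p, by simp, h3⟩
    · exact Or.inl ⟨h1, h2, 4, q, by simp, h3⟩
    · exact Or.inl ⟨h1, h2, 8, r, by simp, h3⟩
    · rcases h with (⟨hy, hz, h⟩ | ⟨hy, hz, h⟩) | ⟨hy, hz, h⟩
      · exact Or.inr (Or.inl ⟨hy, hz, Or.inl h⟩)
      · exact Or.inr (Or.inl ⟨hy, hz, Or.inr (Or.inl h)⟩)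
      · exact Or.inr (Or.inl ⟨hy, hz, Or.inr (Or.inr h)⟩)
    · rcases h with (⟨hy, hz, h⟩ | ⟨hy, hz, h⟩) | ⟨hy, hz, h⟩
      · exact Or.inr (Or.inr ⟨hy, hz, Or.inl h⟩)
      · exact Or.inr (Or.inr ⟨hy, hz, Or.inr (Or.inl h)⟩)
      · exact Or.inr (Or.inr ⟨hy, hz, Or.inr (Or.inr h)⟩)
  · rintro (⟨h1, h2, c, n, ⟨rfl, rfl⟩ | ⟨rfl, rfl⟩ | ⟨rfl, rfl⟩, h3⟩ | ⟨hy, hz, h⟩ | ⟨hy, hz, h⟩)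
    · exact Or.inl (Or.inl (Or.inl (Or.inl ⟨h1, h2, h3⟩)))
    · exact Or.inl (Or.inl (Or.inl (Or.inr ⟨h1, h2, h3⟩)))
    · exact Or.inl (Or.inl (Or.inr ⟨h1, h2, h3⟩))
    · rcases h with h | h | h
      · exact Or.inl (Or.inr (Or.inl (Or.inl ⟨hy, hz, h⟩)))
      · exact Or.inl (Or.inr (Or.inl (Or.inr ⟨hy, hz, h⟩)))
      · exact Or.inl (Or.inr (Or.inr ⟨hy, hz, h⟩))
    · rcases h with h | h | h
      · exact Or.inr (Or.inl (Or.inl ⟨hy, hz, h⟩))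
      · exact Or.inr (Or.inl (Or.inr ⟨hy, hz, h⟩))
      · exact Or.inr (Or.inr ⟨hy, hz, h⟩)

/-- At the levels 0 and 1 the arcs meet the slab only in end points of strands, so they contribute
nothing new. -/
theorem mem_curve_mid {x y z : ℝ} (h0 : 0 ≤ z) (h1 : z ≤ 1) :
    (x, y, z) ∈ curve p q r ↔ ∃ c n, IsColumn p q r c n ∧ OnStrand c (Real.pi * n * z) x y := by
  rw [mem_curve_iff]
  refine ⟨?_, fun h => Or.inl ⟨h0, h1, h⟩⟩
  have key : ∀ c n, IsColumn p q r c n → (z = 0 ∨ z = 1) → y = 0 → (x = c + 1 ∨ x = c - 1) →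
      ∃ c n, IsColumn p q r c n ∧ OnStrand c (Real.pi * n * z) x y := by
    intro c n hc hz hy hx
    refine ⟨c, n, hc, ?_⟩
    rw [onStrand_iff_of_sin_eq_zero]
    · exact ⟨hy, hx⟩
    · rcases hz with rfl | rfl
      · simp
      · rw [mul_one, mul_comm, Real.sin_int_mul_pi]
  have fin : y = 0 → (z = 0 ∨ z = 1) →
      ((x - 2) ^ 2 = 1 ∨ (x - 6) ^ 2 = 1 ∨ (x - 4) ^ 2 = 25) →
      ∃ c n, IsColumn p q r c n ∧ OnStrand c (Real.pi * n * z) x y := by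
    intro hy hz hx
    have e1 : (25 : ℝ) = 5 ^ 2 := by norm_num
    have e2 : (1 : ℝ) = 1 ^ 2 := by norm_num
    rw [e1, e2, sq_eq_sq_iff_eq_or_eq_neg, sq_eq_sq_iff_eq_or_eq_neg, sq_eq_sq_iff_eq_or_eq_neg]
      at hx
    rcases hx with (hx | hx) | (hx | hx) | (hx | hx)
    · exact key 4 q (by simp [IsColumn]) hz hy (Or.inr (by linarith))
    · exact key 0 p (by simp [IsColumn]) hz hy (Or.inl (by linarith))
    · exact key 8 r (by simp [IsColumn]) hz hy (Or.inr (by linarith))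
    · exact key 4 q (by simp [IsColumn]) hz hy (Or.inl (by linarith))
    · exact key 8 r (by simp [IsColumn]) hz hy (Or.inl (by linarith))
    · exact key 0 p (by simp [IsColumn]) hz hy (Or.inr (by linarith))
  rintro (⟨-, -, h⟩ | ⟨hy, hz, h⟩ | ⟨hy, hz, h⟩)
  · exact h
  · obtain rfl : z = 1 := le_antisymm h1 hz
    exact fin hy (Or.inr rfl) (by simpa using h)
  · obtain rfl : z = 0 := le_antisymm hz h0
    exact fin hy (Or.inl rfl) (by simpa using h)

theorem IsColumn.cases_of_onStrand {θ x y : ℝ} (hc : IsColumn p q r c n) (h : OnStrand c θ x y) :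
    (c = 0 ∧ -1 ≤ x ∧ x ≤ 1) ∨ (c = 4 ∧ 3 ≤ x ∧ x ≤ 5) ∨ (c = 8 ∧ 7 ≤ x ∧ x ≤ 9) := by
  have h1 := h.sq_add_sq
  have h2 : |x - c| ≤ 1 := by
    rw [← sq_le_one_iff_abs_le_one]
    nlinarith [sq_nonneg y]
  rw [abs_le] at h2
  rcases hc with ⟨rfl, -⟩ | ⟨rfl, -⟩ | ⟨rfl, -⟩
  · exact Or.inl ⟨rfl, by linarith, by linarith⟩
  · exact Or.inr (Or.inl ⟨rfl, by linarith, by linarith⟩)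
  · exact Or.inr (Or.inr ⟨rfl, by linarith, by linarith⟩)

theorem IsColumn.eq_of_onStrand {c' θ x y : ℝ} {n' : ℤ} (hc : IsColumn p q r c n)
    (hc' : IsColumn p q r c' n') (h : OnStrand c' θ x y) (hx : |x - c| < 3) :
    c' = c ∧ n' = n := by
  have h1 := hc'.cases_of_onStrand h
  rw [abs_lt] at hx
  rcases hc with ⟨rfl, rfl⟩ | ⟨rfl, rfl⟩ | ⟨rfl, rfl⟩ <;>
  rcases hc' with ⟨rfl, rfl⟩ | ⟨rfl, rfl⟩ | ⟨rfl, rfl⟩ <;> first | exact ⟨rfl, rfl⟩ | skip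
  all_goals
    exfalso
    rcases h1 with ⟨h1, h2, h3⟩ | ⟨h1, h2, h3⟩ | ⟨h1, h2, h3⟩ <;> first | (norm_num at h1; done) | linarith

/-- Near a column, the curve consists of the strands of this column only. -/
theorem mem_curve_column {x y z : ℝ} (hc : IsColumn p q r c n) (h0 : 0 ≤ z) (h1 : z ≤ 1)
    (hx : |x - c| < 3) :
    (x, y, z) ∈ curve p q r ↔ OnStrand c (Real.pi * n * z) x y := by
  rw [mem_curve_mid h0 h1]
  constructor
  · rintro ⟨c', n', hc', h⟩
    obtain ⟨rfl, rfl⟩ := hc.eq_of_onStrand hc' h hx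
    exact h
  · exact fun h => ⟨c, n, hc, h⟩

theorem mem_curve_top {x y z : ℝ} (hz : 1 ≤ z) :
    (x, y, z) ∈ curve p q r ↔ y = 0 ∧ ((x - 2) ^ 2 + (z - 1) ^ 2 = 1 ∨
      (x - 6) ^ 2 + (z - 1) ^ 2 = 1 ∨ (x - 4) ^ 2 + (z - 1) ^ 2 = 25) := by
  rw [mem_curve_iff]
  constructor
  · rintro (⟨-, h1, c, n, hc, h⟩ | ⟨hy, -, h⟩ | ⟨-, h, -⟩)
    · obtain rfl : z = 1 := le_antisymm h1 hz
      rw [onStrand_iff_of_sin_eq_zero (by rw [mul_one, mul_comm, Real.sin_int_mul_pi])] at h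
      refine ⟨h.1, ?_⟩
      rcases hc with ⟨rfl, -⟩ | ⟨rfl, -⟩ | ⟨rfl, -⟩ <;> rcases h.2 with rfl | rfl <;> norm_num
    · exact ⟨hy, h⟩
    · linarith
  · rintro ⟨hy, h⟩
    exact Or.inr (Or.inl ⟨hy, hz, h⟩)

theorem mem_curve_bottom {x y z : ℝ} (hz : z ≤ 0) :
    (x, y, z) ∈ curve p q r ↔ y = 0 ∧ ((x - 2) ^ 2 + z ^ 2 = 1 ∨
      (x - 6) ^ 2 + z ^ 2 = 1 ∨ (x - 4) ^ 2 + z ^ 2 = 25) := by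
  rw [mem_curve_iff]
  constructor
  · rintro (⟨h1, -, c, n, hc, h⟩ | ⟨-, h, -⟩ | ⟨hy, -, h⟩)
    · obtain rfl : z = 0 := le_antisymm hz h1
      rw [onStrand_iff_of_sin_eq_zero (by simp)] at h
      refine ⟨h.1, ?_⟩
      rcases hc with ⟨rfl, -⟩ | ⟨rfl, -⟩ | ⟨rfl, -⟩ <;> rcases h.2 with rfl | rfl <;> norm_num
    · linarith
    · exact ⟨hy, h⟩
  · rintro ⟨hy, h⟩
    exact Or.inr (Or.inr ⟨hy, hz, h⟩)

/-! ### Stadiums -/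

theorem stadium_top {a x z : ℝ} (hz : 1 ≤ z) : stadium a x z = (x - a) ^ 2 + (z - 1) ^ 2 := by
  have h1 : max (|z - 1 / 2| - 1 / 2) 0 = z - 1 := by
    rw [abs_of_nonneg (by linarith), max_eq_left (by linarith)]
    ring
  rw [stadium, h1]

theorem stadium_bottom {a x z : ℝ} (hz : z ≤ 0) : stadium a x z = (x - a) ^ 2 + z ^ 2 := by
  have h1 : max (|z - 1 / 2| - 1 / 2) 0 = -z := by
    rw [abs_of_nonpos (by linarith), max_eq_left (by linarith)]
    ring
  rw [stadium, h1, neg_sq]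

theorem stadium_mid {a x z : ℝ} (h0 : 0 ≤ z) (h1 : z ≤ 1) : stadium a x z = (x - a) ^ 2 := by
  have h1 : max (|z - 1 / 2| - 1 / 2) 0 = 0 := by
    refine max_eq_right ?_
    have : |z - 1 / 2| ≤ 1 / 2 := abs_le.2 ⟨by linarith, by linarith⟩
    linarith
  rw [stadium, h1]
  ring

theorem stadium_le_stadium {a x z x' z' : ℝ} (hx : |x - a| ≤ |x' - a|)
    (hz : |z - 1 / 2| ≤ |z' - 1 / 2|) : stadium a x z ≤ stadium a x' z' := by
  have h1 := sq_le_sq.2 hx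
  unfold stadium
  gcongr

/-- Scaling away from the centre of a stadium. -/
theorem stadium_le_scale {a x z t : ℝ} (ht : 1 ≤ t) :
    stadium a x z ≤ stadium a (a + t * (x - a)) (1 / 2 + t * (z - 1 / 2)) := by
  apply stadium_le_stadium
  · rw [add_sub_cancel_left, abs_mul, abs_of_nonneg (by linarith : 0 ≤ t)]
    exact le_mul_of_one_le_left (abs_nonneg _) ht
  · rw [add_sub_cancel_left, abs_mul, abs_of_nonneg (by linarith : 0 ≤ t)]
    exact le_mul_of_one_le_left (abs_nonneg _) ht

theorem scale_le_stadium {a x z t : ℝ} (h0 : 0 ≤ t) (ht : t ≤ 1) :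
    stadium a (a + t * (x - a)) (1 / 2 + t * (z - 1 / 2)) ≤ stadium a x z := by
  apply stadium_le_stadium
  · rw [add_sub_cancel_left, abs_mul, abs_of_nonneg h0]
    exact mul_le_of_le_one_left (abs_nonneg _) ht
  · rw [add_sub_cancel_left, abs_mul, abs_of_nonneg h0]
    exact mul_le_of_le_one_left (abs_nonneg _) ht

/-- This bounds the knot in depth and by the outer stadium. Outside these bounds rays can be turned
freely. -/
theorem curve_subset {x y z : ℝ} (h : (x, y, z) ∈ curve p q r) :
    |y| ≤ 1 ∧ stadium 4 x z ≤ 25 := by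
  rcases le_total z 0 with hz | hz
  · obtain ⟨hy, h'⟩ := (mem_curve_bottom hz).1 h
    rw [stadium_bottom hz]
    refine ⟨by simp [hy], ?_⟩
    rcases h' with h' | h' | h' <;> nlinarith
  rcases le_total z 1 with hz' | hz'
  · obtain ⟨c, n, hc, h⟩ := (mem_curve_mid hz hz').1 h
    rw [stadium_mid hz hz']
    have h1 := h.sq_add_sq
    have h2 := hc.cases_of_onStrand h
    refine ⟨?_, ?_⟩
    · rw [← sq_le_one_iff_abs_le_one]
      nlinarith
    · rcases h2 with ⟨-, h2, h3⟩ | ⟨-, h2, h3⟩ | ⟨-, h2, h3⟩ <;> nlinarith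
  · obtain ⟨hy, h'⟩ := (mem_curve_top hz').1 h
    rw [stadium_top hz']
    refine ⟨by simp [hy], ?_⟩
    rcases h' with h' | h' | h' <;> nlinarith

/-! ### The regions of the diagram -/

/-- The complement of the diagram of the pretzel knot in the plane. -/
def freePlane (p q r : ℤ) : Set (ℝ × ℝ) :=
  {w | ∀ y, (w.1, y, w.2) ∉ curve p q r}

theorem mem_freePlane_top {x z : ℝ} (hz : 1 ≤ z) :
    (x, z) ∈ freePlane p q r ↔ stadium 2 x z ≠ 1 ∧ stadium 6 x z ≠ 1 ∧ stadium 4 x z ≠ 25 := by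
  simp only [freePlane, Set.mem_ofPred_eq, mem_curve_top hz, stadium_top hz]
  constructor
  · intro h
    have := h 0
    tauto
  · rintro h y ⟨-, h'⟩
    tauto

theorem mem_freePlane_bottom {x z : ℝ} (hz : z ≤ 0) :
    (x, z) ∈ freePlane p q r ↔ stadium 2 x z ≠ 1 ∧ stadium 6 x z ≠ 1 ∧ stadium 4 x z ≠ 25 := by
  simp only [freePlane, Set.mem_ofPred_eq, mem_curve_bottom hz, stadium_bottom hz]
  constructor
  · intro h
    have := h 0
    tauto
  · rintro h y ⟨-, h'⟩
    tauto

theorem mem_freePlane_mid {x z : ℝ} (h0 : 0 ≤ z) (h1 : z ≤ 1) :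
    (x, z) ∈ freePlane p q r ↔
      ∀ c n, IsColumn p q r c n → (x - c) ^ 2 ≠ Real.cos (Real.pi * n * z) ^ 2 := by
  simp only [freePlane, Set.mem_ofPred_eq, mem_curve_mid h0 h1]
  constructor
  · intro h c n hc h'
    obtain ⟨y, hy⟩ := exists_onStrand_iff.2 h'
    exact h y ⟨c, n, hc, hy⟩
  · rintro h y ⟨c, n, hc, h'⟩
    exact h c n hc h'.sq_eq

theorem mem_freePlane_of_lt_stadium {x z : ℝ} (h : 25 < stadium 4 x z) :
    (x, z) ∈ freePlane p q r :=
  fun _ hy => not_le.2 h (curve_subset hy).2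

/-- The strands stay within distance 1 of the axes 0, 4, 8, and the small arcs bound the stadiums of
radius 1 around 2 and 6, so nothing enters the gaps. -/
theorem mem_freePlane_of_stadium_lt {a x z : ℝ} (ha : a = 2 ∨ a = 6) (h : stadium a x z < 1) :
    (x, z) ∈ freePlane p q r := by
  rcases le_total z 0 with hz | hz
  · rw [mem_freePlane_bottom hz]
    rw [stadium_bottom hz] at h
    simp only [stadium_bottom hz]
    rcases ha with rfl | rfl <;> refine ⟨?_, ?_, ?_⟩ <;> nlinarith
  rcases le_total z 1 with hz' | hz'
  · rw [mem_freePlane_mid hz hz']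
    rw [stadium_mid hz hz'] at h
    intro c n hc h'
    have h2 := Real.cos_sq_le_one (Real.pi * n * z)
    rcases ha with rfl | rfl <;> rcases hc with ⟨rfl, -⟩ | ⟨rfl, -⟩ | ⟨rfl, -⟩ <;> nlinarith
  · rw [mem_freePlane_top hz']
    rw [stadium_top hz'] at h
    simp only [stadium_top hz']
    rcases ha with rfl | rfl <;> refine ⟨?_, ?_, ?_⟩ <;> nlinarith

theorem joinedIn_gap {a x z : ℝ} (ha : a = 2 ∨ a = 6) (h : stadium a x z < 1) :
    JoinedIn (freePlane p q r) (x, z) (a, 1 / 2) := by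
  refine JoinedIn.ofLine
    (f := fun t : ℝ => (a + (1 - t) * (x - a), 1 / 2 + (1 - t) * (z - 1 / 2))) ?_ ?_ ?_ ?_
  · fun_prop
  · simp
  · simp
  · rintro _ ⟨t, ht, rfl⟩
    exact mem_freePlane_of_stadium_lt ha
      ((scale_le_stadium (by linarith [ht.2]) (by linarith [ht.1])).trans_lt h)

end Pretzel

/-! ### Comparison of rays in different directions -/

section Ray

variable {E : Type*} [NormedAddCommGroup E] [NormedSpace ℝ E]
  {C : Set E} {G : Type*} [Group G] (φ : Holonomy ↥((fun v : E => (v : OnePoint E)) '' C)ᶜ G)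

theorem rayHol_eq_of_isPathConnected {v : E} {S : Set E} (hS : IsPathConnected S)
    (h : ∀ e ∈ S, (v, e) ∈ raySet C) {e e' : E} (he : e ∈ S) (he' : e' ∈ S) :
    rayHol φ v e = rayHol φ v e' := by
  have hv : v ∉ C := notMem_of_mem_raySet (h e he)
  have h1 := isPotential_rayHol φ (ContinuousMap.const S (complPoint v hv)) (v := fun _ => v)
    (e := Subtype.val) continuous_const continuous_subtype_val (fun e => h e.1 e.2) (fun _ => rfl)
  exact h1.eq_of_const (fun _ _ => rfl) (hS.joinedIn e he e' he').joined_subtype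

theorem inv_rayHol_mul_eq_of_joined {Z : Type*} [TopologicalSpace Z] {v : Z → E}
    (hv : Continuous v) {e e' : E} (h : ∀ z, (v z, e) ∈ raySet C)
    (h' : ∀ z, (v z, e') ∈ raySet C) {a b : Z} (hab : Joined a b) :
    (rayHol φ (v a) e)⁻¹ * rayHol φ (v a) e' = (rayHol φ (v b) e)⁻¹ * rayHol φ (v b) e' := by
  let f : C(Z, ↥((fun v : E => (v : OnePoint E)) '' C)ᶜ) :=
    ⟨fun z => complPoint (v z) (notMem_of_mem_raySet (h z)), continuous_complPoint hv _⟩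
  exact (isPotential_rayHol φ f hv continuous_const h (fun _ => rfl)).inv_mul_eq
    (isPotential_rayHol φ f hv continuous_const h' (fun _ => rfl)) hab

end Ray

/-! ### Paths inside the regions of the diagram -/

namespace Pretzel

variable {p q r : ℤ} {c : ℝ} {n : ℤ}

/-- The region between the upper arcs is connected. -/
theorem joinedIn_top {x z : ℝ} (hz : 1 ≤ z) (h2 : 1 < stadium 2 x z) (h6 : 1 < stadium 6 x z)
    (h4 : stadium 4 x z < 25) : JoinedIn (freePlane p q r) (x, z) (4, 5) := by
  rw [stadium_top hz] at h2 h4 h6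
  -- Both x and the squared distance from (4, 1) move linearly, the latter to 16. The squared
  -- distances from (2, 1) and (6, 1) are then affine in t as well, so the inequalities follow from
  -- those at the ends.
  refine JoinedIn.ofLine (f := fun t : ℝ => (x + t * (4 - x),
    1 + √((1 - t) * ((x - 4) ^ 2 + (z - 1) ^ 2) + t * 16 - (x + t * (4 - x) - 4) ^ 2))) ?_ ?_ ?_ ?_
  · fun_prop
  · simp [Real.sqrt_sq (show 0 ≤ z - 1 by linarith)]
  · have : √16 = 4 := by rw [show (16 : ℝ) = 4 ^ 2 by norm_num]; simp
    simp [this]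
    norm_num
  · rintro _ ⟨t, ⟨ht0, ht1⟩, rfl⟩
    have h0 : 0 ≤ (1 - t) * ((x - 4) ^ 2 + (z - 1) ^ 2) + t * 16 - (x + t * (4 - x) - 4) ^ 2 := by
      have : (1 - t) * ((x - 4) ^ 2 + (z - 1) ^ 2) + t * 16 - (x + t * (4 - x) - 4) ^ 2 =
        (1 - t) * t * (x - 4) ^ 2 + (1 - t) * (z - 1) ^ 2 + 16 * t := by ring
      rw [this]
      have := sub_nonneg.2 ht1
      positivity
    have hz1 : 1 ≤
      1 + √((1 - t) * ((x - 4) ^ 2 + (z - 1) ^ 2) + t * 16 - (x + t * (4 - x) - 4) ^ 2) := by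
      simp
    rw [mem_freePlane_top hz1, stadium_top hz1, stadium_top hz1, stadium_top hz1,
      add_sub_cancel_left, Real.sq_sqrt h0]
    refine ⟨?_, ?_, ?_⟩ <;> nlinarith

/-- The region between the lower arcs is connected. -/
theorem joinedIn_bottom {x z : ℝ} (hz : z ≤ 0) (h2 : 1 < stadium 2 x z) (h6 : 1 < stadium 6 x z)
    (h4 : stadium 4 x z < 25) : JoinedIn (freePlane p q r) (x, z) (4, -4) := by
  rw [stadium_bottom hz] at h2 h4 h6
  refine JoinedIn.ofLine (f := fun t : ℝ => (x + t * (4 - x),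
    -√((1 - t) * ((x - 4) ^ 2 + z ^ 2) + t * 16 - (x + t * (4 - x) - 4) ^ 2))) ?_ ?_ ?_ ?_
  · fun_prop
  · simp [Real.sqrt_sq_eq_abs, abs_of_nonpos hz]
  · have : √16 = 4 := by rw [show (16 : ℝ) = 4 ^ 2 by norm_num]; simp
    simp [this]
  · rintro _ ⟨t, ⟨ht0, ht1⟩, rfl⟩
    have h0 : 0 ≤ (1 - t) * ((x - 4) ^ 2 + z ^ 2) + t * 16 - (x + t * (4 - x) - 4) ^ 2 := by
      have : (1 - t) * ((x - 4) ^ 2 + z ^ 2) + t * 16 - (x + t * (4 - x) - 4) ^ 2 =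
        (1 - t) * t * (x - 4) ^ 2 + (1 - t) * z ^ 2 + 16 * t := by ring
      rw [this]
      have := sub_nonneg.2 ht1
      positivity
    have hz1 : -√((1 - t) * ((x - 4) ^ 2 + z ^ 2) + t * 16 - (x + t * (4 - x) - 4) ^ 2) ≤ 0 := by
      simp
    rw [mem_freePlane_bottom hz1, stadium_bottom hz1, stadium_bottom hz1, stadium_bottom hz1,
      neg_sq, Real.sq_sqrt h0]
    refine ⟨?_, ?_, ?_⟩ <;> nlinarith

theorem mem_freePlane_column {x z : ℝ} (hc : IsColumn p q r c n) (h0 : 0 ≤ z) (h1 : z ≤ 1)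
    (h : (x - c) ^ 2 < Real.cos (Real.pi * n * z) ^ 2) : (x, z) ∈ freePlane p q r := by
  intro y hy
  have h2 := Real.cos_sq_le_one (Real.pi * n * z)
  have h3 : |x - c| < 3 := by
    have := abs_lt_of_sq_lt_sq (show (x - c) ^ 2 < 1 ^ 2 by linarith) zero_le_one
    linarith
  exact h.ne ((mem_curve_column hc h0 h1 h3).1 hy).sq_eq

theorem joinedIn_column {x z : ℝ} (hc : IsColumn p q r c n) (h0 : 0 ≤ z) (h1 : z ≤ 1)
    (h : (x - c) ^ 2 < Real.cos (Real.pi * n * z) ^ 2) :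
    JoinedIn (freePlane p q r) (x, z) (c, z) := by
  refine JoinedIn.ofLine (f := fun t : ℝ => (x + t * (c - x), z)) ?_ ?_ ?_ ?_
  · fun_prop
  · simp
  · simp
  · rintro _ ⟨t, ⟨ht0, ht1⟩, rfl⟩
    refine mem_freePlane_column hc h0 h1 (lt_of_le_of_lt ?_ h)
    rw [show x + t * (c - x) - c = (1 - t) * (x - c) by ring, mul_pow]
    refine mul_le_of_le_one_left (sq_nonneg _) ?_
    nlinarith

theorem joinedIn_vertical {z z' : ℝ} (hc : IsColumn p q r c n) (h0 : 0 ≤ z) (h1 : z ≤ 1)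
    (h0' : 0 ≤ z') (h1' : z' ≤ 1)
    (h : ∀ t ∈ Set.Icc (0 : ℝ) 1, Real.cos (Real.pi * n * (z + t * (z' - z))) ≠ 0) :
    JoinedIn (freePlane p q r) (c, z) (c, z') := by
  refine JoinedIn.ofLine (f := fun t : ℝ => (c, z + t * (z' - z))) ?_ ?_ ?_ ?_
  · fun_prop
  · simp
  · simp
  · rintro _ ⟨t, ht, rfl⟩
    refine mem_freePlane_column hc ?_ ?_ ?_
    · nlinarith [ht.1, ht.2]
    · nlinarith [ht.1, ht.2]
    · rw [sub_self, zero_pow two_ne_zero]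
      exact sq_pos_of_ne_zero (h t ht)

/-- Each point beside the columns is connected to a gap between the columns, or to the outer region. -/
theorem joinedIn_beside {x z : ℝ} (h0 : 0 ≤ z) (h1 : z ≤ 1)
    (h : ∀ c n, IsColumn p q r c n → Real.cos (Real.pi * n * z) ^ 2 < (x - c) ^ 2) :
    ∃ a, (a = -2 ∨ a = 2 ∨ a = 6 ∨ a = 10) ∧ JoinedIn (freePlane p q r) (x, z) (a, z) := by
  have key : ∀ a, (∀ t ∈ Set.Icc (0 : ℝ) 1, ∀ c n, IsColumn p q r c n →
      (x - c) ^ 2 ≤ (x + t * (a - x) - c) ^ 2 ∨ 1 < (x + t * (a - x) - c) ^ 2) →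
      JoinedIn (freePlane p q r) (x, z) (a, z) := by
    intro a ha
    refine JoinedIn.ofLine (f := fun t : ℝ => (x + t * (a - x), z)) ?_ ?_ ?_ ?_
    · fun_prop
    · simp
    · simp
    · rintro _ ⟨t, ht, rfl⟩
      rw [mem_freePlane_mid h0 h1]
      intro c n hc
      rcases ha t ht c n hc with h2 | h2
      · exact ((h c n hc).trans_le h2).ne'
      · exact ((Real.cos_sq_le_one _).trans_lt h2).ne'
  have e0 : x ≠ 0 := by
    rintro rfl
    exact (sq_nonneg _).not_gt (by simpa using h 0 p (by simp [IsColumn]))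
  have e4 : x ≠ 4 := by
    rintro rfl
    exact (sq_nonneg _).not_gt (by simpa using h 4 q (by simp [IsColumn]))
  have e8 : x ≠ 8 := by
    rintro rfl
    exact (sq_nonneg _).not_gt (by simpa using h 8 r (by simp [IsColumn]))
  -- A point within distance 2 of the axis moves away from it, and a point farther off stays at
  -- distance at least 2, beyond the reach of the strands.
  have hpos : ∀ (t a c : ℝ), t ∈ Set.Icc (0 : ℝ) 1 → (c < x ∧ c + 2 ≤ a ∨ x < c ∧ a ≤ c - 2) →
      (x - c) ^ 2 ≤ (x + t * (a - x) - c) ^ 2 ∨ 1 < (x + t * (a - x) - c) ^ 2 := by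
    rintro t a c ⟨ht0, ht1⟩ (⟨h1, h2⟩ | ⟨h1, h2⟩)
    · rcases le_total (x - c) 2 with h3 | h3
      · left
        have : x - c ≤ x + t * (a - x) - c := by nlinarith
        exact pow_le_pow_left₀ (by linarith) this 2
      · right
        have : 2 ≤ x + t * (a - x) - c := by nlinarith
        nlinarith
    · rcases le_total (c - x) 2 with h3 | h3
      · left
        have : c - x ≤ c - (x + t * (a - x)) := by nlinarith
        have := pow_le_pow_left₀ (by linarith) this 2
        nlinarith
      · right
        have : 2 ≤ c - (x + t * (a - x)) := by nlinarith
        nlinarith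
  rcases e0.lt_or_gt with h2 | h2
  · refine ⟨-2, by simp, key _ fun t ht c n hc => hpos t _ c ht ?_⟩
    rcases hc with ⟨rfl, -⟩ | ⟨rfl, -⟩ | ⟨rfl, -⟩ <;> right <;> constructor <;> linarith
  rcases e4.lt_or_gt with h3 | h3
  · refine ⟨2, by simp, key _ fun t ht c n hc => hpos t _ c ht ?_⟩
    rcases hc with ⟨rfl, -⟩ | ⟨rfl, -⟩ | ⟨rfl, -⟩
    · left; constructor <;> linarith
    · right; constructor <;> linarith
    · right; constructor <;> linarith
  rcases e8.lt_or_gt with h4 | h4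
  · refine ⟨6, by simp, key _ fun t ht c n hc => hpos t _ c ht ?_⟩
    rcases hc with ⟨rfl, -⟩ | ⟨rfl, -⟩ | ⟨rfl, -⟩
    · left; constructor <;> linarith
    · left; constructor <;> linarith
    · right; constructor <;> linarith
  · refine ⟨10, by simp, key _ fun t ht c n hc => hpos t _ c ht ?_⟩
    rcases hc with ⟨rfl, -⟩ | ⟨rfl, -⟩ | ⟨rfl, -⟩ <;> left <;> constructor <;> linarith

/-! ### The holonomy of the lines that are perpendicular to the plane of the diagram -/

variable {G : Type*} [Group G]
  (φ : Holonomy ↥((fun v : ℝ × ℝ × ℝ => (v : S3)) '' curve p q r)ᶜ G)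

/-- The holonomy of the ray from a point towards the observer. -/
noncomputable def frontHol (v : ℝ × ℝ × ℝ) : G := rayHol φ v (0, -1, 0)

/-- The holonomy of the ray from a point away from the observer. -/
noncomputable def backHol (v : ℝ × ℝ × ℝ) : G := rayHol φ v (0, 1, 0)

/-- The holonomy of the line through the point `(x, z)` of the plane of the diagram, run through from the
observer's side to the other side. -/
noncomputable def lineHol (x z : ℝ) : G := (frontHol φ (x, 0, z))⁻¹ * backHol φ (x, 0, z)

theorem mem_raySet_front {v : ℝ × ℝ × ℝ} (h : ∀ y ≤ v.2.1, (v.1, y, v.2.2) ∉ curve p q r) :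
    (v, ((0, -1, 0) : ℝ × ℝ × ℝ)) ∈ raySet (curve p q r) := by
  refine ⟨by simp, fun s hs => ?_⟩
  have e : v + s • ((0, -1, 0) : ℝ × ℝ × ℝ) = (v.1, v.2.1 + s * (-1), v.2.2) := by
    ext <;> simp
  rw [e]
  exact h _ (by linarith)

theorem mem_raySet_back {v : ℝ × ℝ × ℝ} (h : ∀ y, v.2.1 ≤ y → (v.1, y, v.2.2) ∉ curve p q r) :
    (v, ((0, 1, 0) : ℝ × ℝ × ℝ)) ∈ raySet (curve p q r) := by
  refine ⟨by simp, fun s hs => ?_⟩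
  have e : v + s • ((0, 1, 0) : ℝ × ℝ × ℝ) = (v.1, v.2.1 + s * 1, v.2.2) := by
    ext <;> simp
  rw [e]
  exact h _ (by linarith)

/-- The whole line avoids the knot, so the rays in both directions are potentials along it, and it
does not matter from which of its points they start. -/
theorem inv_frontHol_mul_backHol {x z : ℝ} (h : (x, z) ∈ freePlane p q r) (y : ℝ) :
    (frontHol φ (x, y, z))⁻¹ * backHol φ (x, y, z) = lineHol φ x z :=
  inv_rayHol_mul_eq_of_joined φ (Z := ℝ) (v := fun y => (x, y, z)) (by fun_prop)
    (fun _ => mem_raySet_front fun _ _ => h _) (fun _ => mem_raySet_back fun _ _ => h _)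
    (PathConnectedSpace.joined y 0)

/-- A path off the diagram moves the line without touching the knot; hence each region carries a
single element, its Dehn generator. -/
theorem lineHol_eq_of_joinedIn {x z x' z' : ℝ}
    (h : JoinedIn (freePlane p q r) (x, z) (x', z')) : lineHol φ x z = lineHol φ x' z' :=
  inv_rayHol_mul_eq_of_joined φ (Z := freePlane p q r) (v := fun w => (w.1.1, 0, w.1.2))
    (by fun_prop) (fun w => mem_raySet_front fun _ _ => w.2 _)
    (fun w => mem_raySet_back fun _ _ => w.2 _) h.joined_subtype

/-- Outside the diagram, the holonomy of a ray does not depend on its direction, as long as this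
direction points away from the diagram. -/
theorem rayHol_outer {x y z : ℝ} (h : 25 < stadium 4 x z) {a b a' b' : ℝ} (ha : 0 ≤ a)
    (ha' : 0 ≤ a') (hab : (a, b) ≠ 0) (hab' : (a', b') ≠ 0) :
    rayHol φ (x, y, z) (a * (x - 4), b, a * (z - 1 / 2)) =
      rayHol φ (x, y, z) (a' * (x - 4), b', a' * (z - 1 / 2)) := by
  have hne : x - 4 ≠ 0 ∨ z - 1 / 2 ≠ 0 := by
    by_contra! h'
    rw [stadium, h'.1, h'.2] at h
    norm_num at h
  -- These are the nonzero combinations of an outward direction, with coefficient at least 0, and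
  -- the viewing direction. The two opposite viewing directions are joined through the outward one.
  let S : Set (ℝ × ℝ) := {w | 0 ≤ w.1 ∧ w ≠ 0}
  have hstar : StarConvex ℝ ((1, 0) : ℝ × ℝ) S := by
    rw [starConvex_iff_segment_subset]
    rintro ⟨s, t⟩ ⟨h0, h1⟩ w hw
    rw [segment_eq_image] at hw
    obtain ⟨k, ⟨hk0, hk1⟩, rfl⟩ := hw
    simp only [Prod.smul_mk, Prod.mk_add_mk, smul_eq_mul, mul_one, mul_zero, zero_add]
    refine ⟨by dsimp only at h0 ⊢; nlinarith, fun h2 => ?_⟩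
    simp only [Prod.mk_eq_zero] at h2
    rcases hk1.lt_or_eq with hk1 | rfl
    · dsimp only at h0
      have := mul_nonneg hk0 h0
      linarith [h2.1]
    · exact h1 (by simpa using h2)
  have hS : IsPathConnected S := by
    have : ContractibleSpace S := hstar.contractibleSpace ⟨(1, 0), by simp [S]⟩
    exact isPathConnected_iff_pathConnectedSpace.2 inferInstance
  have hS' := hS.image (f := fun w : ℝ × ℝ => (w.1 * (x - 4), w.2, w.1 * (z - 1 / 2)))
    (by fun_prop)
  refine rayHol_eq_of_isPathConnected φ hS' ?_ ⟨(a, b), ⟨ha, hab⟩, rfl⟩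
    ⟨(a', b'), ⟨ha', hab'⟩, rfl⟩
  rintro _ ⟨⟨s, t⟩, ⟨h0, h1⟩, rfl⟩
  refine ⟨fun h2 => h1 ?_, fun k hk => ?_⟩
  · simp only [Prod.mk_eq_zero, mul_eq_zero] at h2 ⊢
    tauto
  · have h3 : 25 < stadium 4 (4 + (1 + k * s) * (x - 4)) (1 / 2 + (1 + k * s) * (z - 1 / 2)) :=
      h.trans_le (stadium_le_scale (by nlinarith [mul_nonneg hk h0]))
    have e : ((x, y, z) : ℝ × ℝ × ℝ) + k • ((s * (x - 4), t, s * (z - 1 / 2)) : ℝ × ℝ × ℝ) =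
        (4 + (1 + k * s) * (x - 4), y + k * t, 1 / 2 + (1 + k * s) * (z - 1 / 2)) := by
      ext <;> simp <;> ring
    dsimp only
    rw [e]
    exact mem_freePlane_of_lt_stadium h3 _

/-- The ray towards the observer can be turned outwards into the opposite ray. -/
theorem lineHol_outer {x z : ℝ} (h : 25 < stadium 4 x z) : lineHol φ x z = 1 := by
  have h1 := rayHol_outer φ (y := 0) h le_rfl le_rfl (b := -1) (b' := 1) (by simp) (by simp)
  simp only [zero_mul] at h1
  rw [lineHol, inv_mul_eq_one]
  exact h1

end Pretzel

/-! ### Potentials on sheets in the complement -/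

theorem exists_isPotential_of_convex {E F : Type*} [TopologicalSpace E] [NormedAddCommGroup F]
    [NormedSpace ℝ F] {C : Set E} {G : Type*} [Group G]
    (φ : Holonomy ↥((fun v : E => (v : OnePoint E)) '' C)ᶜ G) {D : Set F} (hD : Convex ℝ D)
    (hne : D.Nonempty) {f : F → E}
    (hf : Continuous f) (h : ∀ w ∈ D, f w ∉ C) :
    ∃ k : F → G, φ.IsPotential ⟨fun w : D => complPoint (f w) (h w.1 w.2),
      continuous_complPoint (by fun_prop) _⟩ (fun w => k w) := by
  have : ContractibleSpace D := hD.contractibleSpace hne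
  obtain ⟨k, hk⟩ := φ.exists_isPotential ⟨fun w : D => complPoint (f w) (h w.1 w.2),
      continuous_complPoint (by fun_prop) _⟩
  classical
  refine ⟨fun w => if hw : w ∈ D then k ⟨w, hw⟩ else 1, ?_⟩
  convert hk using 2 with w
  simp

section Ray

variable {E F : Type*} [NormedAddCommGroup E] [NormedSpace ℝ E] [TopologicalSpace F]
  {C : Set E} {G : Type*} [Group G]
  (φ : Holonomy ↥((fun v : E => (v : OnePoint E)) '' C)ᶜ G)

/-- On a connected part T of the sheet where a ray is free, the sheet and the ray provide two
potentials of the same map. -/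
theorem inv_potential_mul_rayHol {D : Set F} {f : F → E} {hf : Continuous f}
    {h : ∀ w ∈ D, f w ∉ C} {k : F → G}
    (hk : φ.IsPotential ⟨fun w : D => complPoint (f w) (h w.1 w.2),
      continuous_complPoint (by fun_prop) _⟩ (fun w => k w))
    {T : Set F} (hTD : T ⊆ D) (hT : IsPathConnected T) {e : E}
    (hray : ∀ w ∈ T, (f w, e) ∈ raySet C) {a b : F} (ha : a ∈ T) (hb : b ∈ T) :
    (k a)⁻¹ * rayHol φ (f a) e = (k b)⁻¹ * rayHol φ (f b) e := by
  have h1 := hk.comp ⟨fun w : T => (⟨w.1, hTD w.2⟩ : D), by fun_prop⟩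
  have h2 := isPotential_rayHol φ (ContinuousMap.comp
    ⟨fun w : D => complPoint (f w) (h w.1 w.2), continuous_complPoint (by fun_prop) _⟩
    ⟨fun w : T => (⟨w.1, hTD w.2⟩ : D), by fun_prop⟩) (v := fun w : T => f w) (e := fun _ => e)
    (by fun_prop) continuous_const (fun w => hray w.1 w.2) (fun _ => rfl)
  exact h1.inv_mul_eq h2 (hT.joinedIn a ha b hb).joined_subtype

end Ray

/-- The elements k₁, k₂, k₃ and k₄, k₅, k₆ stand for the potential of a half twisted strip at the
lower end, the middle and the upper end of its two edges; the other letters stand for rays at these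
six points. Eliminating the potential leaves the crossing relation. -/
theorem inv_mul_eq_of_hexagon {G : Type*} [Group G] {k₁ k₂ k₃ k₄ k₅ k₆ a b c d e f g h : G}
    (h₁ : k₁⁻¹ * a = k₂⁻¹ * b) (h₂ : k₂⁻¹ * c = k₃⁻¹ * d) (h₃ : k₄⁻¹ * e = k₅⁻¹ * f)
    (h₄ : k₅⁻¹ * g = k₆⁻¹ * h) {i j : G} (h₅ : k₁⁻¹ * a = k₄⁻¹ * i) (h₆ : k₃⁻¹ * j = k₆⁻¹ * h) :
    j⁻¹ * d = g⁻¹ * f * (i⁻¹ * e)⁻¹ * (b⁻¹ * c) := by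
  rw [h₁] at h₅
  rw [← h₄] at h₆
  have hb : b = k₂ * k₄⁻¹ * i := by rw [mul_assoc, ← h₅, mul_inv_cancel_left]
  have hd : d = k₃ * k₂⁻¹ * c := by rw [mul_assoc, h₂, mul_inv_cancel_left]
  have hf : f = k₅ * k₄⁻¹ * e := by rw [mul_assoc, h₃, mul_inv_cancel_left]
  have hj : j = k₃ * k₅⁻¹ * g := by rw [mul_assoc, ← h₆, mul_inv_cancel_left]
  rw [hb, hd, hf, hj]
  group

/-! ### The relation at a half twist -/

namespace Pretzel

variable {p q r : ℤ} {c : ℝ} {n : ℤ}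

theorem mem_raySet_front_column {x y z : ℝ} (hc : IsColumn p q r c n) (h0 : 0 ≤ z) (h1 : z ≤ 1)
    (hx : |x - c| < 3) (hy : y ≤ 0) (hxy : 1 < (x - c) ^ 2 + y ^ 2) :
    ((x, y, z), ((0, -1, 0) : ℝ × ℝ × ℝ)) ∈ raySet (curve p q r) :=
  mem_raySet_front fun y' hy' h => by
    have := ((mem_curve_column hc h0 h1 hx).1 h).sq_add_sq
    dsimp only at hy' this
    nlinarith

theorem mem_raySet_back_column {x y z : ℝ} (hc : IsColumn p q r c n) (h0 : 0 ≤ z) (h1 : z ≤ 1)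
    (hx : |x - c| < 3) (hy : 0 ≤ y) (hxy : 1 < (x - c) ^ 2 + y ^ 2) :
    ((x, y, z), ((0, 1, 0) : ℝ × ℝ × ℝ)) ∈ raySet (curve p q r) :=
  mem_raySet_back fun y' hy' h => by
    have := ((mem_curve_column hc h0 h1 hx).1 h).sq_add_sq
    dsimp only at hy' this
    nlinarith

variable {G : Type*} [Group G]
  (φ : Holonomy ↥((fun v : ℝ × ℝ × ℝ => (v : S3)) '' curve p q r)ᶜ G)

theorem lineHol_beside {a x z : ℝ} (ha : a = -2 ∨ a = 2 ∨ a = 6 ∨ a = 10) (hx : |x - a| < 1)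
    (h0 : 0 ≤ z) (h1 : z ≤ 1) : lineHol φ x z = lineHol φ a (1 / 2) := by
  rw [abs_lt] at hx
  have hgap : a = 2 ∨ a = 6 → lineHol φ x z = lineHol φ a (1 / 2) := fun ha =>
    lineHol_eq_of_joinedIn φ (joinedIn_gap ha (by rw [stadium_mid h0 h1]; nlinarith))
  have hout : 5 < |a - 4| → 5 < |x - 4| → lineHol φ x z = lineHol φ a (1 / 2) := by
    intro h2 h3
    rw [lineHol_outer, lineHol_outer]
    · rw [stadium_mid (by norm_num) (by norm_num), ← sq_abs]
      nlinarith
    · rw [stadium_mid h0 h1, ← sq_abs]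
      nlinarith
  rcases ha with rfl | rfl | rfl | rfl
  · exact hout (by norm_num) (lt_abs.2 (Or.inr (by linarith)))
  · exact hgap (Or.inl rfl)
  · exact hgap (Or.inr rfl)
  · exact hout (by norm_num) (lt_abs.2 (Or.inl (by linarith)))

theorem IsColumn.beside (hc : IsColumn p q r c n) {σ : ℝ} (hσ : σ = 1 ∨ σ = -1) :
    c + 2 * σ = -2 ∨ c + 2 * σ = 2 ∨ c + 2 * σ = 6 ∨ c + 2 * σ = 10 := by
  rcases hc with ⟨rfl, -⟩ | ⟨rfl, -⟩ | ⟨rfl, -⟩ <;> rcases hσ with rfl | rfl <;> norm_num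

/-- The effect of a half twist on the holonomy of the line through the axis of a column. -/
theorem lineHol_halfTwist (hc : IsColumn p q r c n) {σ : ℝ} (hσ : σ = 1 ∨ σ = -1) {z₀ z₁ : ℝ}
    (h0 : 0 ≤ z₀) (h01 : z₀ ≤ z₁) (h1 : z₁ ≤ 1) {k : ℤ} (hk : n * z₀ = k)
    (hn : n * (z₁ - z₀) = σ) :
    lineHol φ c z₁ =
      lineHol φ (c + 2 * σ) (1 / 2) * (lineHol φ c z₀)⁻¹ * lineHol φ (c + 2 * -σ) (1 / 2) := by
  have hσ2 : σ ^ 2 = 1 := by rcases hσ with rfl | rfl <;> norm_num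
  -- A strip that separates the two strands: at each level it is perpendicular to the segment
  -- between them. It points along the line of sight at both ends, with opposite orientations, and
  -- lies in the plane of the diagram at half height.
  let f : ℝ × ℝ → ℝ × ℝ × ℝ := fun w => (c + w.1 * Real.sin (Real.pi * σ * w.2),
    w.1 * Real.cos (Real.pi * σ * w.2), z₀ + w.2 * (z₁ - z₀))
  have hf : Continuous f := by fun_prop
  have hlev : ∀ {t : ℝ}, t ∈ Set.Icc (0 : ℝ) 1 → 0 ≤ z₀ + t * (z₁ - z₀) ∧
      z₀ + t * (z₁ - z₀) ≤ 1 := by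
    rintro t ⟨ht0, ht1⟩
    constructor <;> nlinarith
  let D : Set (ℝ × ℝ) := Set.Icc (-(3 / 2)) (3 / 2) ×ˢ Set.Icc 0 1
  have hx : ∀ w ∈ D, |(f w).1 - c| < 3 := by
    intro w hw
    rw [add_sub_cancel_left, abs_mul]
    have h2 : |w.1| ≤ 3 / 2 := abs_le.2 hw.1
    have h3 := Real.abs_sin_le_one (Real.pi * σ * w.2)
    nlinarith [abs_nonneg w.1]
  have hD : ∀ w ∈ D, f w ∉ curve p q r := by
    intro w hw h
    have h2 := (mem_curve_column hc (hlev hw.2).1 (hlev hw.2).2 (hx w hw)).1 h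
    obtain ⟨ε, hε, h3, h4⟩ := h2
    have h5 : Real.pi * n * (z₀ + w.2 * (z₁ - z₀)) = Real.pi * σ * w.2 + k * Real.pi := by
      rw [← hk, ← hn]
      ring
    rw [h5, Real.cos_add_int_mul_pi] at h3
    rw [h5, Real.sin_add_int_mul_pi] at h4
    have h6 := Real.sin_sq_add_cos_sq (Real.pi * σ * w.2)
    have h7 : ((-1 : ℝ) ^ k) ^ 2 = 1 := by
      rcases Int.even_or_odd k with hk | hk
      · simp [hk.neg_one_zpow]
      · simp [hk.neg_one_zpow]
    -- The inner product with the direction of the strands: it vanishes on the strip and equals ±1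
    -- on the strands.
    have h8 : ε * (-1) ^ k = 0 := by
      linear_combination (-(ε * (-1) ^ k)) * h6 - Real.cos (Real.pi * σ * w.2) * h3 +
        Real.sin (Real.pi * σ * w.2) * h4
    have h9 : ε ^ 2 = 1 := by rcases hε with rfl | rfl <;> norm_num
    have h10 : (ε * (-1) ^ k) ^ 2 = 1 := by rw [mul_pow, h7, h9, one_mul]
    rw [h8] at h10
    norm_num at h10
  obtain ⟨K, hK⟩ := exists_isPotential_of_convex φ
    ((convex_Icc (-(3 / 2) : ℝ) (3 / 2)).prod (convex_Icc (0 : ℝ) 1)) ⟨(0, 0), by norm_num⟩ hf hD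
  have hrad : ∀ s t : ℝ, (c + s * Real.sin (Real.pi * σ * t) - c) ^ 2 +
      (s * Real.cos (Real.pi * σ * t)) ^ 2 = s ^ 2 := by
    intro s t
    have := Real.sin_sq_add_cos_sq (Real.pi * σ * t)
    linear_combination s ^ 2 * this
  have hcos : ∀ t, Real.cos (Real.pi * σ * t) = Real.cos (Real.pi * t) := by
    intro t
    rcases hσ with rfl | rfl
    · simp
    · rw [← Real.cos_neg]
      congr 1
      ring
  have hcos1 : ∀ t ∈ Set.Icc (0 : ℝ) (1 / 2), 0 ≤ Real.cos (Real.pi * σ * t) := by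
    rintro t ⟨ht0, ht1⟩
    rw [hcos]
    apply Real.cos_nonneg_of_neg_pi_div_two_le_of_le <;> nlinarith [Real.pi_pos]
  have hcos2 : ∀ t ∈ Set.Icc (1 / 2 : ℝ) 1, Real.cos (Real.pi * σ * t) ≤ 0 := by
    rintro t ⟨ht0, ht1⟩
    rw [hcos]
    apply Real.cos_nonpos_of_pi_div_two_le_of_le <;> nlinarith [Real.pi_pos]
  -- the two vertical edges of the rectangle, cut at half height
  have edge : ∀ (s : ℝ) (I : Set ℝ), s ∈ Set.Icc (-(3 / 2) : ℝ) (3 / 2) → I ⊆ Set.Icc 0 1 →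
      Convex ℝ I → I.Nonempty → ∀ e : ℝ × ℝ × ℝ,
      (∀ t ∈ I, (f (s, t), e) ∈ raySet (curve p q r)) → ∀ a ∈ I, ∀ b ∈ I,
      (K (s, a))⁻¹ * rayHol φ (f (s, a)) e = (K (s, b))⁻¹ * rayHol φ (f (s, b)) e := by
    intro s I hs hI hI' hne e he a ha b hb
    refine inv_potential_mul_rayHol φ (hf := hf) hK (T := {s} ×ˢ I) ?_ ?_ ?_ ⟨rfl, ha⟩ ⟨rfl, hb⟩
    · rintro ⟨s', t⟩ ⟨rfl, ht⟩
      exact ⟨hs, hI ht⟩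
    · exact ((convex_singleton s).prod hI').isPathConnected ((Set.singleton_nonempty s).prod hne)
    · rintro ⟨s', t⟩ ⟨rfl, ht⟩
      exact he t ht
  -- the two horizontal edges
  have hedge : ∀ t : ℝ, t ∈ Set.Icc (0 : ℝ) 1 → (∀ s, (c, z₀ + t * (z₁ - z₀)) ∈ freePlane p q r ∧
      (f (s, t)).1 = c) →
      (K (-(3 / 2), t))⁻¹ * frontHol φ (f (-(3 / 2), t)) =
        (K (3 / 2, t))⁻¹ * frontHol φ (f (3 / 2, t)) := by
    intro t ht h
    refine inv_potential_mul_rayHol φ (hf := hf) hK (T := Set.Icc (-(3 / 2)) (3 / 2) ×ˢ {t})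
      ?_ ?_ ?_ ⟨by norm_num, rfl⟩ ⟨by norm_num, rfl⟩
    · rintro ⟨s, t'⟩ ⟨hs, rfl⟩
      exact ⟨hs, ht⟩
    · exact ((convex_Icc _ _).prod (convex_singleton t)).isPathConnected ⟨(0, t), by norm_num⟩
    · rintro ⟨s, t'⟩ ⟨hs, rfl⟩
      refine mem_raySet_front fun y _ => ?_
      rw [(h s).2]
      exact (h s).1 y
  have half : ∀ s : ℝ, s ∈ Set.Icc (-(3 / 2) : ℝ) (3 / 2) → 1 < s ^ 2 → ∀ t ∈ Set.Icc (0 : ℝ) 1,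
      (s * Real.cos (Real.pi * σ * t) ≤ 0 →
        (f (s, t), ((0, -1, 0) : ℝ × ℝ × ℝ)) ∈ raySet (curve p q r)) ∧
      (0 ≤ s * Real.cos (Real.pi * σ * t) →
        (f (s, t), ((0, 1, 0) : ℝ × ℝ × ℝ)) ∈ raySet (curve p q r)) := by
    intro s hs hs' t ht
    have h2 := hlev ht
    refine ⟨fun h3 => ?_, fun h3 => ?_⟩
    · exact mem_raySet_front_column hc h2.1 h2.2 (hx (s, t) ⟨hs, ht⟩) h3
        (by rw [hrad]; exact hs')
    · exact mem_raySet_back_column hc h2.1 h2.2 (hx (s, t) ⟨hs, ht⟩) h3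
        (by rw [hrad]; exact hs')
  have sub1 : Set.Icc (0 : ℝ) (1 / 2) ⊆ Set.Icc 0 1 := Set.Icc_subset_Icc_right (by norm_num)
  have sub2 : Set.Icc (1 / 2 : ℝ) 1 ⊆ Set.Icc 0 1 := Set.Icc_subset_Icc_left (by norm_num)
  have m1 : (-(3 / 2) : ℝ) ∈ Set.Icc (-(3 / 2) : ℝ) (3 / 2) := by norm_num
  have m2 : (3 / 2 : ℝ) ∈ Set.Icc (-(3 / 2) : ℝ) (3 / 2) := by norm_num
  -- The edges at distance 3 / 2 from the axis stay outside the cylinder of radius 1 that contains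
  -- the strands. One edge passes from the front to the back at half height, the other from the back
  -- to the front, so there both rays are free.
  have ea := edge (-(3 / 2)) (Set.Icc 0 (1 / 2)) m1 sub1 (convex_Icc _ _) ⟨0, by norm_num⟩
    (0, -1, 0) (fun t ht => (half _ m1 (by norm_num) t (sub1 ht)).1 (by linarith [hcos1 t ht]))
    0 (by norm_num) (1 / 2) (by norm_num)
  have eb := edge (-(3 / 2)) (Set.Icc (1 / 2) 1) m1 sub2 (convex_Icc _ _) ⟨1, by norm_num⟩
    (0, 1, 0) (fun t ht => (half _ m1 (by norm_num) t (sub2 ht)).2 (by linarith [hcos2 t ht]))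
    (1 / 2) (by norm_num) 1 (by norm_num)
  have ec := edge (3 / 2) (Set.Icc 0 (1 / 2)) m2 sub1 (convex_Icc _ _) ⟨0, by norm_num⟩
    (0, 1, 0) (fun t ht => (half _ m2 (by norm_num) t (sub1 ht)).2 (by linarith [hcos1 t ht]))
    0 (by norm_num) (1 / 2) (by norm_num)
  have ed := edge (3 / 2) (Set.Icc (1 / 2) 1) m2 sub2 (convex_Icc _ _) ⟨1, by norm_num⟩
    (0, -1, 0) (fun t ht => (half _ m2 (by norm_num) t (sub2 ht)).1 (by linarith [hcos2 t ht]))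
    (1 / 2) (by norm_num) 1 (by norm_num)
  have hf0 : ∀ s, f (s, 0) = (c, s, z₀) := fun s => by simp [f]
  have hf1 : ∀ s, f (s, 1) = (c, -s, z₁) := fun s => by
    rcases hσ with rfl | rfl <;> simp [f]
  have hfm : ∀ s, f (s, 1 / 2) = (c + s * σ, 0, z₀ + 1 / 2 * (z₁ - z₀)) := fun s => by
    rcases hσ with rfl | rfl
    · simp [f, show Real.pi * 2⁻¹ = Real.pi / 2 by ring]
    · simp [f, show Real.pi * 2⁻¹ = Real.pi / 2 by ring]
  have free : ∀ z : ℝ, 0 ≤ z → z ≤ 1 → (∃ j : ℤ, n * z = j) → (c, z) ∈ freePlane p q r := by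
    rintro z hz0 hz1 ⟨j, hj⟩
    refine mem_freePlane_column hc hz0 hz1 ?_
    rw [mul_assoc, hj, mul_comm, sub_self]
    have := Real.sin_sq_add_cos_sq (j * Real.pi)
    rw [Real.sin_int_mul_pi] at this
    linarith
  have free0 := free z₀ h0 (h01.trans h1) ⟨k, hk⟩
  have free1 := free z₁ (h0.trans h01) h1 (by
    rcases hσ with rfl | rfl
    · exact ⟨k + 1, by push_cast; linarith⟩
    · exact ⟨k - 1, by push_cast; linarith⟩)
  have ee := hedge 0 (by norm_num) (fun s => ⟨by simpa using free0, by rw [hf0]⟩)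
  have ef := hedge 1 (by norm_num) (fun s => ⟨by simpa using free1, by rw [hf1]⟩)
  rw [hf0] at ea ec
  rw [hf0, hf0] at ee
  rw [hf1] at eb ed
  rw [hf1, hf1] at ef
  rw [hfm] at ea eb ec ed
  have gl : lineHol φ (c + -(3 / 2) * σ) (z₀ + 1 / 2 * (z₁ - z₀)) =
      lineHol φ (c + 2 * -σ) (1 / 2) := by
    refine lineHol_beside φ (hc.beside (σ := -σ) (by rcases hσ with rfl | rfl <;> norm_num)) ?_
      (by linarith) (by linarith)
    rcases hσ with rfl | rfl <;> rw [abs_lt] <;> constructor <;> linarith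
  have gr : lineHol φ (c + 3 / 2 * σ) (z₀ + 1 / 2 * (z₁ - z₀)) =
      lineHol φ (c + 2 * σ) (1 / 2) := by
    refine lineHol_beside φ (hc.beside hσ) ?_ (by linarith) (by linarith)
    rcases hσ with rfl | rfl <;> rw [abs_lt] <;> constructor <;> linarith
  have g0 := inv_frontHol_mul_backHol φ free0 (3 / 2)
  have g1 := inv_frontHol_mul_backHol φ free1 (3 / 2)
  rw [← gl, ← gr, ← g0, ← g1]
  rw [neg_neg] at ef eb
  exact inv_mul_eq_of_hexagon ea eb ec ed ee ef

/-- The line through the top of a column meets the diagram between the upper arcs. -/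
theorem lineHol_column_top (hc : IsColumn p q r c n) : lineHol φ c 1 = lineHol φ 4 5 := by
  apply lineHol_eq_of_joinedIn
  apply joinedIn_top le_rfl <;> rw [stadium_top le_rfl] <;>
    rcases hc with ⟨rfl, -⟩ | ⟨rfl, -⟩ | ⟨rfl, -⟩ <;> norm_num

theorem lineHol_column_bottom (hc : IsColumn p q r c n) : lineHol φ c 0 = lineHol φ 4 (-4) := by
  apply lineHol_eq_of_joinedIn
  apply joinedIn_bottom le_rfl <;> rw [stadium_bottom le_rfl] <;>
    rcases hc with ⟨rfl, -⟩ | ⟨rfl, -⟩ | ⟨rfl, -⟩ <;> norm_num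

/-- The effect of a half twist of two strands with the regions `l` and `r` beside them on the region
between them. -/
def halfTwist {G : Type*} [Group G] (l r m : G) : G := r * m⁻¹ * l

/-- At the level k / |n| exactly k half twists are complete and both strands lie in the plane of the
diagram again, so the half twist relation can be applied repeatedly. A negative n interchanges the
two sides. -/
theorem lineHol_iterate (hc : IsColumn p q r c n) {σ : ℝ} (hσ : σ = 1 ∨ σ = -1)
    (hn : (n : ℝ) = σ * n.natAbs) {k : ℕ} (hk : k ≤ n.natAbs) :
    lineHol φ c (k / n.natAbs) =
      (halfTwist (lineHol φ (c + 2 * -σ) (1 / 2)) (lineHol φ (c + 2 * σ) (1 / 2)))^[k]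
        (lineHol φ c 0) := by
  induction k with
  | zero => simp
  | succ k ih =>
    have hN : (0 : ℝ) < n.natAbs := by exact_mod_cast (Nat.zero_lt_succ k).trans_le hk
    have hk' : ((k : ℝ) + 1) ≤ n.natAbs := by exact_mod_cast hk
    rw [Function.iterate_succ_apply', ← ih (by omega), halfTwist]
    obtain ⟨j, hj⟩ : ∃ j : ℤ, (j : ℝ) = σ * k := by
      rcases hσ with rfl | rfl
      · exact ⟨k, by simp⟩
      · exact ⟨-k, by simp⟩
    refine lineHol_halfTwist φ hc hσ (by positivity) (by gcongr; simp) ?_ (k := j) ?_ ?_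
    · rw [div_le_one hN]
      push_cast
      exact hk'
    · rw [hn, hj]
      field_simp
    · rw [hn]
      push_cast
      field_simp
      ring

theorem lineHol_twist (hc : IsColumn p q r c n) {σ : ℝ} (hσ : σ = 1 ∨ σ = -1)
    (hn : (n : ℝ) = σ * n.natAbs) :
    lineHol φ 4 5 =
      (halfTwist (lineHol φ (c + 2 * -σ) (1 / 2)) (lineHol φ (c + 2 * σ) (1 / 2)))^[n.natAbs]
        (lineHol φ 4 (-4)) := by
  rw [← lineHol_column_top φ hc, ← lineHol_column_bottom φ hc, ← lineHol_iterate φ hc hσ hn le_rfl]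
  -- For n = 0 the quotient is 0 / 0 = 0; there is no crossing, and the region around the axis runs
  -- from the bottom to the top.
  rcases eq_or_ne n.natAbs 0 with h | h
  · rw [h, Nat.cast_zero, div_zero, lineHol_column_top φ hc, lineHol_column_bottom φ hc]
    have h' : n = 0 := Int.natAbs_eq_zero.1 h
    rw [← lineHol_column_top φ hc, ← lineHol_column_bottom φ hc]
    refine lineHol_eq_of_joinedIn φ (joinedIn_vertical hc zero_le_one le_rfl le_rfl zero_le_one ?_)
    simp [h']
  · rw [div_self (by exact_mod_cast h)]

end Pretzel

namespace Pretzel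

variable {p q r : ℤ} {c : ℝ} {n : ℤ} {G : Type*} [Group G]
  (φ : Holonomy ↥((fun v : ℝ × ℝ × ℝ => (v : S3)) '' curve p q r)ᶜ G)

/-! ### All lines -/

theorem halfTwist_mem_iff {S : Subgroup G} {l r m : G} (hl : l ∈ S) (hr : r ∈ S) :
    halfTwist l r m ∈ S ↔ m ∈ S := by
  rw [halfTwist, S.mul_mem_cancel_right hl, S.mul_mem_cancel_left hr, S.inv_mem_iff]

theorem iterate_halfTwist_mem_iff {S : Subgroup G} {l r m : G} (hl : l ∈ S) (hr : r ∈ S) (k : ℕ) :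
    (halfTwist l r)^[k] m ∈ S ↔ m ∈ S := by
  induction k with
  | zero => rfl
  | succ k ih => rw [Function.iterate_succ_apply', halfTwist_mem_iff hl hr, ih]

theorem exists_sign (n : ℤ) : ∃ σ : ℝ, (σ = 1 ∨ σ = -1) ∧ (n : ℝ) = σ * n.natAbs := by
  rcases Int.natAbs_eq n with h | h
  · refine ⟨1, Or.inl rfl, ?_⟩
    rw [one_mul, ← Int.cast_natCast]
    exact congrArg Int.cast h
  · refine ⟨-1, Or.inr rfl, ?_⟩
    rw [neg_one_mul, ← Int.cast_natCast, ← Int.cast_neg]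
    exact congrArg Int.cast h

theorem lineHol_beside_mem {S : Subgroup G} (h2 : lineHol φ 2 (1 / 2) ∈ S)
    (h6 : lineHol φ 6 (1 / 2) ∈ S) {a : ℝ} (ha : a = -2 ∨ a = 2 ∨ a = 6 ∨ a = 10) :
    lineHol φ a (1 / 2) ∈ S := by
  rcases ha with rfl | rfl | rfl | rfl
  · rw [lineHol_outer φ (by rw [stadium_mid] <;> norm_num)]
    exact S.one_mem
  · exact h2
  · exact h6
  · rw [lineHol_outer φ (by rw [stadium_mid] <;> norm_num)]
    exact S.one_mem

/-- Half twists whose sides lie in S preserve and reflect membership in S, so the first column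
carries membership from the top down to the bottom. -/
theorem lineHol_bottom_mem {S : Subgroup G} (h2 : lineHol φ 2 (1 / 2) ∈ S)
    (h6 : lineHol φ 6 (1 / 2) ∈ S) (h4 : lineHol φ 4 5 ∈ S) : lineHol φ 4 (-4) ∈ S := by
  obtain ⟨σ, hσ, hn⟩ := exists_sign p
  have hc : IsColumn p q r 0 p := Or.inl ⟨rfl, rfl⟩
  rw [lineHol_twist φ hc hσ hn, iterate_halfTwist_mem_iff
    (lineHol_beside_mem φ h2 h6 (hc.beside (σ := -σ) (by rcases hσ with rfl | rfl <;> norm_num)))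
    (lineHol_beside_mem φ h2 h6 (hc.beside hσ))] at h4
  exact h4

/-- Off the crossings a point of the axis lies in the region of the nearest level of the form k /
|n|, and the bottom region reaches this level by k half twists. -/
theorem lineHol_axis_mem {S : Subgroup G} (h2 : lineHol φ 2 (1 / 2) ∈ S)
    (h6 : lineHol φ 6 (1 / 2) ∈ S) (h4 : lineHol φ 4 5 ∈ S) (hc : IsColumn p q r c n) {z : ℝ}
    (h0 : 0 ≤ z) (h1 : z ≤ 1) (hz : Real.cos (Real.pi * n * z) ≠ 0) : lineHol φ c z ∈ S := by
  obtain ⟨σ, hσ, hn⟩ := exists_sign n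
  have hσ' : -σ = 1 ∨ -σ = -1 := by rcases hσ with rfl | rfl <;> norm_num
  have hcos : ∀ y : ℝ, Real.cos (Real.pi * n * y) = Real.cos (Real.pi * (n.natAbs * y)) := by
    intro y
    rw [hn]
    rcases hσ with rfl | rfl
    · congr 1
      ring
    · rw [← Real.cos_neg]
      congr 1
      ring
  rcases eq_or_ne n.natAbs 0 with hN | hN
  · have h : lineHol φ c z = lineHol φ c 1 :=
      lineHol_eq_of_joinedIn φ (joinedIn_vertical hc h0 h1 zero_le_one le_rfl
        (by simp [Int.natAbs_eq_zero.1 hN]))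
    rw [h, lineHol_column_top φ hc]
    exact h4
  · have hN' : (0 : ℝ) < n.natAbs := by positivity
    -- The integer nearest to |n| z. The distance is not 1 / 2, since z would then be the level of a
    -- crossing; so the cosine keeps its sign on the way to k / |n|.
    set k := ⌊n.natAbs * z + 1 / 2⌋₊ with hk
    have hk1 : (k : ℝ) ≤ n.natAbs * z + 1 / 2 := Nat.floor_le (by positivity)
    have hk2 : n.natAbs * z + 1 / 2 < k + 1 := Nat.lt_floor_add_one _
    have hkN : k ≤ n.natAbs := by
      have : (k : ℝ) < n.natAbs + 1 := by nlinarith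
      exact Nat.lt_succ_iff.1 (by exact_mod_cast this)
    have hkN' : (k : ℝ) ≤ n.natAbs := by exact_mod_cast hkN
    have hne : (n.natAbs : ℝ) * z - k ≠ -(1 / 2) := by
      intro h
      apply hz
      rw [hcos, show Real.pi * (n.natAbs * z) = -(Real.pi / 2) + k * Real.pi by
        linear_combination Real.pi * h, Real.cos_add_nat_mul_pi, Real.cos_neg, Real.cos_pi_div_two,
        mul_zero]
    have hlt : -(1 / 2) < (n.natAbs : ℝ) * z - k := lt_of_le_of_ne (by linarith) hne.symm
    have h : lineHol φ c z = lineHol φ c (k / n.natAbs) := by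
      refine lineHol_eq_of_joinedIn φ (joinedIn_vertical hc h0 h1 (by positivity)
        ((div_le_one hN').2 hkN') ?_)
      rintro t ⟨ht0, ht1⟩
      rw [hcos, show Real.pi * (n.natAbs * (z + t * (k / n.natAbs - z))) =
        Real.pi * ((1 - t) * (n.natAbs * z - k)) + k * Real.pi by field_simp; ring,
        Real.cos_add_nat_mul_pi]
      refine mul_ne_zero (pow_ne_zero _ (by norm_num)) (ne_of_gt ?_)
      apply Real.cos_pos_of_mem_Ioo
      have b1 : -(1 / 2) < (1 - t) * (n.natAbs * z - k) := by nlinarith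
      have b2 : (1 - t) * (n.natAbs * z - k) < 1 / 2 := by nlinarith
      constructor <;> nlinarith [Real.pi_pos]
    rw [h, lineHol_iterate φ hc hσ hn hkN, iterate_halfTwist_mem_iff
      (lineHol_beside_mem φ h2 h6 (hc.beside hσ')) (lineHol_beside_mem φ h2 h6 (hc.beside hσ)),
      lineHol_column_bottom φ hc]
    exact lineHol_bottom_mem φ h2 h6 h4

/-- Each region is the outer one, a gap, the top or bottom region, or lies between two crossings of
a column. -/
theorem lineHol_mem {S : Subgroup G} (h2 : lineHol φ 2 (1 / 2) ∈ S)
    (h6 : lineHol φ 6 (1 / 2) ∈ S) (h4 : lineHol φ 4 5 ∈ S) {x z : ℝ}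
    (h : (x, z) ∈ freePlane p q r) : lineHol φ x z ∈ S := by
  have hend : (z ≤ 0 ∨ 1 ≤ z) → lineHol φ x z ∈ S := by
    intro hz
    have hne : stadium 2 x z ≠ 1 ∧ stadium 6 x z ≠ 1 ∧ stadium 4 x z ≠ 25 := by
      rcases hz with hz | hz
      · exact (mem_freePlane_bottom hz).1 h
      · exact (mem_freePlane_top hz).1 h
    rcases hne.2.2.lt_or_gt with h4' | h4'
    · rcases hne.1.lt_or_gt with h2' | h2'
      · rw [lineHol_eq_of_joinedIn φ (joinedIn_gap (Or.inl rfl) h2')]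
        exact h2
      rcases hne.2.1.lt_or_gt with h6' | h6'
      · rw [lineHol_eq_of_joinedIn φ (joinedIn_gap (Or.inr rfl) h6')]
        exact h6
      rcases hz with hz | hz
      · rw [lineHol_eq_of_joinedIn φ (joinedIn_bottom hz h2' h6' h4')]
        exact lineHol_bottom_mem φ h2 h6 h4
      · rw [lineHol_eq_of_joinedIn φ (joinedIn_top hz h2' h6' h4')]
        exact h4
    · rw [lineHol_outer φ h4']
      exact S.one_mem
  rcases le_total z 0 with h0 | h0
  · exact hend (Or.inl h0)
  rcases le_total 1 z with h1 | h1
  · exact hend (Or.inr h1)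
  have hne := (mem_freePlane_mid h0 h1).1 h
  by_cases hcol : ∃ c n, IsColumn p q r c n ∧ (x - c) ^ 2 < Real.cos (Real.pi * n * z) ^ 2
  · obtain ⟨c, n, hc, hlt⟩ := hcol
    rw [lineHol_eq_of_joinedIn φ (joinedIn_column hc h0 h1 hlt)]
    refine lineHol_axis_mem φ h2 h6 h4 hc h0 h1 fun h' => ?_
    rw [h'] at hlt
    nlinarith [sq_nonneg (x - c)]
  · push Not at hcol
    obtain ⟨a, ha, hj⟩ := joinedIn_beside h0 h1
      (fun c n hc => lt_of_le_of_ne (hcol c n hc) (hne c n hc).symm)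
    rw [lineHol_eq_of_joinedIn φ hj, lineHol_beside φ ha (by simp) h0 h1]
    exact lineHol_beside_mem φ h2 h6 ha

end Pretzel

/-! ### Lifting paths to vectors, and paths near infinity -/

section Lift

variable {E : Type*} [TopologicalSpace E] {C : Set E}

theorem exists_lift {a b : ↥((fun v : E => (v : OnePoint E)) '' C)ᶜ} (γ : Path a b) {O : Set E}
    (h : ∀ t, ∃ v ∈ O, (γ t : OnePoint E) = v) :
    ∃ δ : C(unitInterval, E), ∀ t, δ t ∈ O ∧ (γ t : OnePoint E) = δ t := by
  choose δ hδ using h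
  refine ⟨⟨δ, ?_⟩, hδ⟩
  rw [OnePoint.isOpenEmbedding_coe.isInducing.continuous_iff]
  have : (fun v : E => (v : OnePoint E)) ∘ δ = fun t => (γ t : OnePoint E) :=
    funext fun t => (hδ t).2.symm
  rw [this]
  fun_prop

end Lift

section Ray

variable {E : Type*} [NormedAddCommGroup E] [NormedSpace ℝ E]
  {C : Set E} {G : Type*} [Group G] (φ : Holonomy ↥((fun v : E => (v : OnePoint E)) '' C)ᶜ G)

theorem Holonomy.val_eq_of_isPotential_path {X : Type*} [TopologicalSpace X] {φ : Holonomy X G}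
    {a b : X} {γ : Path a b} {k : unitInterval → G}
    (hk : φ.IsPotential ⟨γ, by fun_prop⟩ k) : φ.val γ = k 0 * (k 1)⁻¹ := by
  rw [← hk 0 1 ⟨⟨id, continuous_id⟩, rfl, rfl⟩]
  exact φ.val_congr _ _ fun t => rfl

theorem exists_val_eq_of_ray {a b : ↥((fun v : E => (v : OnePoint E)) '' C)ᶜ} (γ : Path a b)
    {e : E} (h : ∀ t, ∃ v ∈ {v | (v, e) ∈ raySet C}, (γ t : OnePoint E) = v) :
    ∃ u v : E, ((u, e) ∈ raySet C ∧ (a : OnePoint E) = u) ∧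
      ((v, e) ∈ raySet C ∧ (b : OnePoint E) = v) ∧
      φ.val γ = rayHol φ u e * (rayHol φ v e)⁻¹ := by
  obtain ⟨δ, hδ⟩ := exists_lift γ h
  refine ⟨δ 0, δ 1, ⟨(hδ 0).1, by rw [← (hδ 0).2, γ.source]⟩,
    ⟨(hδ 1).1, by rw [← (hδ 1).2, γ.target]⟩, ?_⟩
  exact Holonomy.val_eq_of_isPotential_path (k := fun t => rayHol φ (δ t) e)
    (isPotential_rayHol φ _ δ.continuous continuous_const (fun t => (hδ t).1) (fun t => (hδ t).2))

/-- The ray from a point away from `v₀`; the point at infinity is its own ray. -/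
noncomputable def outerPoint (v₀ : E) (x : OnePoint E) (t : ℝ) : OnePoint E :=
  x.elim OnePoint.infty fun v => rayPoint v (v - v₀) t

/-- The holonomy of the ray from a point away from `v₀`. -/
noncomputable def outerHol (v₀ : E) (x : OnePoint E) : G :=
  x.elim 1 fun v => rayHol φ v (v - v₀)

/-- Pushing a point away from v₀ multiplies its distance from v₀ by 1 + t / (1 - t) ≥ 1, so points
near infinity remain near infinity throughout. -/
theorem continuousWithinAt_outerPoint [ProperSpace E] {v₀ : E} {x : OnePoint E} (hx : x ≠ v₀) {t : ℝ}
    (ht : t ∈ Set.Icc (0 : ℝ) 1) :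
    ContinuousWithinAt (fun w : OnePoint E × ℝ => outerPoint v₀ w.1 w.2)
      (Set.univ ×ˢ Set.Icc 0 1) (x, t) := by
  induction x using OnePoint.rec with
  | coe v =>
    have hv : v - v₀ ≠ 0 := sub_ne_zero.2 fun h => hx (by rw [h])
    have h1 : ContinuousAt (fun w : E × ℝ => rayPoint w.1 (w.1 - v₀) w.2) (v, t) :=
      ContinuousAt.comp (f := fun w : E × ℝ => ((w.1, w.1 - v₀), w.2)) (x := (v, t))
        (g := fun w : (E × E) × ℝ => rayPoint w.1.1 w.1.2 w.2)
        (continuousAt_rayPoint hv ht.2) (by fun_prop)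
    have h2 : IsOpenEmbedding (fun w : E × ℝ => ((w.1 : OnePoint E), w.2)) :=
      OnePoint.isOpenEmbedding_coe.prodMap IsOpenEmbedding.id
    exact ((h2.continuousAt_iff (g := fun w : OnePoint E × ℝ => outerPoint v₀ w.1 w.2)
      (x := (v, t))).1 h1).continuousWithinAt
  | infty =>
    rw [ContinuousWithinAt]
    have h0 : outerPoint v₀ OnePoint.infty t = OnePoint.infty := rfl
    rw [h0, (OnePoint.hasBasis_nhds_infty (X := E)).tendsto_right_iff]
    rintro K ⟨-, hK⟩
    obtain ⟨R, hR⟩ := hK.isBounded.exists_norm_le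
    have h1 : ∀ᶠ x : OnePoint E in 𝓝 OnePoint.infty,
        x ∈ ((↑) : E → OnePoint E) '' (Metric.closedBall 0 (R + 2 * ‖v₀‖))ᶜ ∪ {OnePoint.infty} :=
      (OnePoint.hasBasis_nhds_infty (X := E)).mem_of_mem
        ⟨Metric.isClosed_closedBall, isCompact_closedBall _ _⟩
    have h2 : ∀ᶠ w : OnePoint E × ℝ in 𝓝[Set.univ ×ˢ Set.Icc 0 1] (OnePoint.infty, t),
        w.1 ∈ ((↑) : E → OnePoint E) '' (Metric.closedBall 0 (R + 2 * ‖v₀‖))ᶜ ∪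
          {OnePoint.infty} :=
      (continuousAt_fst.eventually h1).filter_mono nhdsWithin_le_nhds
    filter_upwards [h2, self_mem_nhdsWithin] with w hw hwt
    rcases w with ⟨x, s⟩
    rcases hw with ⟨v, hv, rfl⟩ | rfl
    · change rayPoint v (v - v₀) s ∈ _
      unfold rayPoint
      split_ifs with hs
      · left
        refine ⟨_, fun hmem => hv ?_, rfl⟩
        have h3 := hR _ hmem
        have h4 : 0 ≤ s / (1 - s) := div_nonneg hwt.2.1 (by linarith)
        have h5 : v + (s / (1 - s)) • (v - v₀) = (1 + s / (1 - s)) • (v - v₀) + v₀ := by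
          module
        have h6 := norm_sub_le (v + (s / (1 - s)) • (v - v₀)) v₀
        rw [h5, add_sub_cancel_right, norm_smul, ← h5,
          Real.norm_of_nonneg (by linarith : 0 ≤ 1 + s / (1 - s))] at h6
        have h7 := norm_sub_norm_le v v₀
        have h8 : ‖v - v₀‖ ≤ (1 + s / (1 - s)) * ‖v - v₀‖ :=
          le_mul_of_one_le_left (norm_nonneg _) (by linarith)
        rw [mem_closedBall_zero_iff]
        linarith
      · right
        rfl
    · right
      rfl

/-- In a set which is starlike with respect to infinity and `v₀`, the holonomy of a path is
given by rays. -/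
theorem val_eq_outerHol [ProperSpace E] {v₀ : E} {O : Set E}
    (hO : ∀ v ∈ O, (v, v - v₀) ∈ raySet C) {a b : ↥((fun v : E => (v : OnePoint E)) '' C)ᶜ}
    (γ : Path a b) (h : ∀ t, (γ t : OnePoint E) = OnePoint.infty ∨
      ∃ v ∈ O, (γ t : OnePoint E) = v) :
    φ.val γ = outerHol φ v₀ a * (outerHol φ v₀ b)⁻¹ := by
  have hne : ∀ t, (γ t : OnePoint E) ≠ v₀ := by
    intro t ht
    rcases h t with h | ⟨v, hv, h⟩
    · exact OnePoint.coe_ne_infty _ (ht.symm.trans h)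
    · have h1 : v₀ = v := OnePoint.coe_injective (ht.symm.trans h)
      exact (hO v hv).1 (by rw [h1, sub_self])
  have hmem : ∀ t, ∀ s ∈ Set.Icc (0 : ℝ) 1, outerPoint v₀ (γ t : OnePoint E) s ∈
      ((fun v : E => (v : OnePoint E)) '' C)ᶜ := by
    intro t s hs
    rcases h t with h | ⟨v, hv, h⟩
    · rw [h]
      rintro ⟨u, -, hu⟩
      exact OnePoint.coe_ne_infty _ hu
    · rw [h]
      exact rayPoint_notMem (hO v hv) hs.1
  let H : C(unitInterval × unitInterval, ↥((fun v : E => (v : OnePoint E)) '' C)ᶜ) :=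
    ⟨fun z => ⟨outerPoint v₀ (γ z.1) z.2, hmem _ _ z.2.2⟩, by
      refine Continuous.subtype_mk (continuous_iff_continuousAt.2 fun z => ?_) _
      have h1 := continuousWithinAt_outerPoint (hne z.1) z.2.2
      have h2 : ContinuousAt (fun z : unitInterval × unitInterval =>
        ((γ z.1 : OnePoint E), (z.2 : ℝ))) z := by fun_prop
      exact Filter.Tendsto.comp (x := 𝓝 z) h1 (tendsto_nhdsWithin_iff.2
        ⟨h2, Filter.Eventually.of_forall fun y => ⟨trivial, y.2.2⟩⟩)⟩
  have hend : ∀ x : OnePoint E, outerPoint v₀ x 1 = OnePoint.infty := by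
    intro x
    induction x using OnePoint.rec <;> simp [outerPoint, rayPoint]
  have hstart : ∀ x : OnePoint E, outerPoint v₀ x 0 = x := by
    intro x
    induction x using OnePoint.rec <;> simp [outerPoint, rayPoint]
  have hpot := φ.isPotential_of_contraction H
    (fun y y' => Subtype.ext ((hend _).trans (hend _).symm)) ⟨γ, by fun_prop⟩
    (fun y => Subtype.ext (hstart _))
  have htrack : ∀ t, φ.val (Holonomy.track H t) = outerHol φ v₀ (γ t : OnePoint E) := by
    intro t
    rcases h t with h | ⟨v, hv, h⟩
    · rw [h]
      change _ = (1 : G)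
      rw [← φ.val_refl (γ t)]
      refine φ.val_congr _ _ fun s => Subtype.ext ?_
      change outerPoint v₀ (γ t : OnePoint E) s = (γ t : OnePoint E)
      rw [h]
      rfl
    · rw [h]
      change _ = rayHol φ v (v - v₀)
      rw [rayHol, dif_pos (hO v hv)]
      refine φ.val_congr _ _ fun s => Subtype.ext ?_
      change outerPoint v₀ (γ t : OnePoint E) s = rayPoint v (v - v₀) s
      rw [h]
      rfl
  rw [Holonomy.val_eq_of_isPotential_path hpot, htrack, htrack, γ.source, γ.target]

end Ray

/-! ### Compactness of the knot and openness of the visible points -/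

namespace Pretzel

variable {p q r : ℤ} {c : ℝ} {n : ℤ}

theorem isClosed_curve : IsClosed (curve p q r) := by
  have hs : ∀ (c : ℝ) (n : ℤ), IsClosed (twistedStrands c n) := by
    intro c n
    have h1 : ∀ ε : ℝ, IsClosed {v : ℝ × ℝ × ℝ | 0 ≤ v.2.2 ∧ v.2.2 ≤ 1 ∧
        v.1 = c + ε * Real.cos (Real.pi * n * v.2.2) ∧
        v.2.1 = -(ε * Real.sin (Real.pi * n * v.2.2))} := by
      intro ε
      refine (isClosed_le ?_ ?_).and ((isClosed_le ?_ ?_).and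
        ((isClosed_eq ?_ ?_).and (isClosed_eq ?_ ?_))) <;> fun_prop
    convert (h1 1).union (h1 (-1)) using 1
    ext v
    simp only [twistedStrands, Set.mem_ofPred_eq, Set.mem_union]
    constructor
    · rintro ⟨h0, h1, ε, rfl | rfl, h2, h3⟩
      · exact Or.inl ⟨h0, h1, h2, h3⟩
      · exact Or.inr ⟨h0, h1, h2, h3⟩
    · rintro (⟨h0, h1, h2, h3⟩ | ⟨h0, h1, h2, h3⟩)
      · exact ⟨h0, h1, 1, Or.inl rfl, h2, h3⟩
      · exact ⟨h0, h1, -1, Or.inr rfl, h2, h3⟩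
  have ht : ∀ a b : ℝ, IsClosed (topArc a b) := by
    intro a b
    refine (isClosed_eq ?_ ?_).and ((isClosed_le ?_ ?_).and (isClosed_eq ?_ ?_)) <;> fun_prop
  have hb : ∀ a b : ℝ, IsClosed (bottomArc a b) := by
    intro a b
    refine (isClosed_eq ?_ ?_).and ((isClosed_le ?_ ?_).and (isClosed_eq ?_ ?_)) <;> fun_prop
  exact ((((hs _ _).union (hs _ _)).union (hs _ _)).union
    (((ht _ _).union (ht _ _)).union (ht _ _))).union (((hb _ _).union (hb _ _)).union (hb _ _))

/-- The points of space that are close to the plane of the diagram, and close to the diagram. -/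
def nearSet : Set (ℝ × ℝ × ℝ) := {v | |v.2.1| ≤ 1 ∧ stadium 4 v.1 v.2.2 ≤ 25}

theorem isCompact_nearSet : IsCompact nearSet := by
  have h1 : IsClosed nearSet := by
    unfold nearSet stadium
    refine (isClosed_le ?_ ?_).and (isClosed_le ?_ ?_) <;> fun_prop
  refine IsCompact.of_isClosed_subset (isCompact_Icc (a := ((-1, -1, -5) : ℝ × ℝ × ℝ))
    (b := (9, 1, 6))) h1 ?_
  rintro ⟨x, y, z⟩ ⟨hy, h⟩
  rw [abs_le] at hy
  dsimp only [stadium] at h hy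
  have h2 : |x - 4| ≤ 5 := abs_le_of_sq_le_sq (by nlinarith [sq_nonneg (max (|z - 1 / 2| - 1 / 2) 0)])
    (by norm_num)
  have h3 : max (|z - 1 / 2| - 1 / 2) 0 ≤ 5 :=
    le_of_sq_le_sq (by nlinarith [sq_nonneg (x - 4)]) (by norm_num)
  have h4 : |z - 1 / 2| ≤ 11 / 2 := by linarith [le_max_left (|z - 1 / 2| - 1 / 2) 0]
  rw [abs_le] at h2 h4
  exact ⟨⟨by linarith, by linarith, by linarith⟩, ⟨by linarith, by linarith, by linarith⟩⟩

theorem isCompact_curve : IsCompact (curve p q r) :=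
  isCompact_nearSet.of_isClosed_subset isClosed_curve fun _ h => curve_subset h

/-- The points hidden from the front form the sum of the compact curve and a closed half line, which
is closed. -/
theorem isOpen_front : IsOpen {v | (v, ((0, -1, 0) : ℝ × ℝ × ℝ)) ∈ raySet (curve p q r)} := by
  have h1 : IsClosed {v : ℝ × ℝ × ℝ | v.1 = 0 ∧ 0 ≤ v.2.1 ∧ v.2.2 = 0} := by
    refine (isClosed_eq ?_ ?_).and ((isClosed_le ?_ ?_).and (isClosed_eq ?_ ?_)) <;> fun_prop
  have h2 := h1.add_left_of_isCompact (isCompact_curve (p := p) (q := q) (r := r))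
  convert h2.isOpen_compl using 1
  ext v
  simp only [raySet, Set.mem_ofPred_eq, Set.mem_compl_iff, Set.mem_add, not_exists, not_and]
  constructor
  · rintro ⟨-, h⟩ x hx y ⟨hy1, hy2, hy3⟩ rfl
    apply h y.2.1 hy2
    convert hx using 1
    ext <;> simp [hy1, hy3]
  · intro h
    refine ⟨by simp, fun s hs hmem => h _ hmem (0, s, 0) ⟨rfl, hs, rfl⟩ ?_⟩
    ext <;> simp

theorem isOpen_back : IsOpen {v | (v, ((0, 1, 0) : ℝ × ℝ × ℝ)) ∈ raySet (curve p q r)} := by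
  have h1 : IsClosed {v : ℝ × ℝ × ℝ | v.1 = 0 ∧ v.2.1 ≤ 0 ∧ v.2.2 = 0} := by
    refine (isClosed_eq ?_ ?_).and ((isClosed_le ?_ ?_).and (isClosed_eq ?_ ?_)) <;> fun_prop
  have h2 := h1.add_left_of_isCompact (isCompact_curve (p := p) (q := q) (r := r))
  convert h2.isOpen_compl using 1
  ext v
  simp only [raySet, Set.mem_ofPred_eq, Set.mem_compl_iff, Set.mem_add, not_exists, not_and]
  constructor
  · rintro ⟨-, h⟩ x hx y ⟨hy1, hy2, hy3⟩ rfl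
    apply h (-y.2.1) (by linarith)
    convert hx using 1
    ext <;> simp [hy1, hy3]
  · intro h
    refine ⟨by simp, fun s hs hmem => h _ hmem (0, -s, 0) ⟨rfl, by simpa using hs, rfl⟩ ?_⟩
    ext <;> simp

end Pretzel

namespace Pretzel

variable {p q r : ℤ} {c : ℝ} {n : ℤ} {G : Type*} [Group G]
  (φ : Holonomy ↥((fun v : ℝ × ℝ × ℝ => (v : S3)) '' curve p q r)ᶜ G)

/-! ### Points that can be seen from the front or from the back -/

/-- The point `v` can be seen from the front. -/
def FrontVisible (p q r : ℤ) (v : ℝ × ℝ × ℝ) : Prop :=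
  (v, ((0, -1, 0) : ℝ × ℝ × ℝ)) ∈ raySet (curve p q r)

/-- The point `v` can be seen from the back. -/
def BackVisible (p q r : ℤ) (v : ℝ × ℝ × ℝ) : Prop :=
  (v, ((0, 1, 0) : ℝ × ℝ × ℝ)) ∈ raySet (curve p q r)

theorem mem_freePlane_of_visible {x y z : ℝ} (h : FrontVisible p q r (x, y, z))
    (h' : BackVisible p q r (x, y, z)) : (x, z) ∈ freePlane p q r := by
  intro y'
  rcases le_total y' y with hy | hy
  · have := h.2 (y - y') (by linarith)
    simpa using this
  · have := h'.2 (y' - y) (by linarith)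
    simpa using this

/-- The value `g` is the holonomy of a ray from `x` towards or away from the observer. -/
def IsRayValue (x : ↥((fun v : ℝ × ℝ × ℝ => (v : S3)) '' curve p q r)ᶜ) (g : G) : Prop :=
  ∃ v : ℝ × ℝ × ℝ, (x : S3) = v ∧ ((FrontVisible p q r v ∧ g = frontHol φ v) ∨
    (BackVisible p q r v ∧ g = backHol φ v))

variable {φ} {S : Subgroup G}

/-- Two different values occur only at a point visible from both sides; they then differ by the Dehn
generator of a region or its inverse. -/
theorem IsRayValue.inv_mul_mem (h2 : lineHol φ 2 (1 / 2) ∈ S) (h6 : lineHol φ 6 (1 / 2) ∈ S)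
    (h4 : lineHol φ 4 5 ∈ S) {x : ↥((fun v : ℝ × ℝ × ℝ => (v : S3)) '' curve p q r)ᶜ} {g g' : G}
    (h : IsRayValue φ x g) (h' : IsRayValue φ x g') : g⁻¹ * g' ∈ S := by
  obtain ⟨v, hv, h⟩ := h
  obtain ⟨v', hv', h'⟩ := h'
  obtain rfl : v = v' := OnePoint.coe_injective (hv.symm.trans hv')
  have key : FrontVisible p q r v → BackVisible p q r v →
      (frontHol φ v)⁻¹ * backHol φ v ∈ S := by
    obtain ⟨x, y, z⟩ := v
    intro hf hb
    have := mem_freePlane_of_visible hf hb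
    rw [inv_frontHol_mul_backHol φ this]
    exact lineHol_mem φ h2 h6 h4 this
  rcases h with ⟨hf, rfl⟩ | ⟨hb, rfl⟩ <;> rcases h' with ⟨hf', rfl⟩ | ⟨hb', rfl⟩
  · simp
  · exact key hf hb'
  · rw [← S.inv_mem_iff, mul_inv_rev, inv_inv]
    exact key hf' hb
  · simp

theorem exists_isOpen_of_visible {x : ↥((fun v : ℝ × ℝ × ℝ => (v : S3)) '' curve p q r)ᶜ}
    {v : ℝ × ℝ × ℝ} (hx : (x : S3) = v) (hv : FrontVisible p q r v ∨ BackVisible p q r v) :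
    ∃ U : Set ↥((fun v : ℝ × ℝ × ℝ => (v : S3)) '' curve p q r)ᶜ, IsOpen U ∧ x ∈ U ∧
      ∀ (a b : _) (δ : Path a b), (∀ s, δ s ∈ U) →
        ∃ g g', IsRayValue φ a g ∧ IsRayValue φ b g' ∧ g⁻¹ * φ.val δ * g' ∈ S := by
  rcases hv with hv | hv
  · refine ⟨Subtype.val ⁻¹' ((↑) '' {v | FrontVisible p q r v}),
      (OnePoint.isOpenEmbedding_coe.isOpenMap _ isOpen_front).preimage continuous_subtype_val,
      ⟨v, hv, hx.symm⟩, fun a b δ hδ => ?_⟩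
    obtain ⟨u, w, ⟨hu, ha⟩, ⟨hw, hb⟩, h⟩ := exists_val_eq_of_ray φ δ (e := (0, -1, 0)) (fun t => by
      obtain ⟨v, hv, h⟩ := hδ t
      exact ⟨v, hv, h.symm⟩)
    refine ⟨_, _, ⟨u, ha, Or.inl ⟨hu, rfl⟩⟩, ⟨w, hb, Or.inl ⟨hw, rfl⟩⟩, ?_⟩
    rw [h, frontHol, frontHol]
    simp
  · refine ⟨Subtype.val ⁻¹' ((↑) '' {v | BackVisible p q r v}),
      (OnePoint.isOpenEmbedding_coe.isOpenMap _ isOpen_back).preimage continuous_subtype_val,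
      ⟨v, hv, hx.symm⟩, fun a b δ hδ => ?_⟩
    obtain ⟨u, w, ⟨hu, ha⟩, ⟨hw, hb⟩, h⟩ := exists_val_eq_of_ray φ δ (e := (0, 1, 0)) (fun t => by
      obtain ⟨v, hv, h⟩ := hδ t
      exact ⟨v, hv, h.symm⟩)
    refine ⟨_, _, ⟨u, ha, Or.inr ⟨hu, rfl⟩⟩, ⟨w, hb, Or.inr ⟨hw, rfl⟩⟩, ?_⟩
    rw [h, backHol, backHol]
    simp

/-! ### Points near infinity -/

theorem mem_raySet_outer {v : ℝ × ℝ × ℝ} (hv : v ∉ nearSet) :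
    (v, v - (4, 0, 1 / 2)) ∈ raySet (curve p q r) := by
  refine ⟨fun h => hv ?_, fun s hs hmem => hv ?_⟩
  · rw [sub_eq_zero] at h
    subst h
    simp [nearSet, stadium]
  · obtain ⟨x, y, z⟩ := v
    have e : ((x, y, z) : ℝ × ℝ × ℝ) + s • ((x, y, z) - (4, 0, 1 / 2)) =
        (4 + (1 + s) * (x - 4), (1 + s) * y, 1 / 2 + (1 + s) * (z - 1 / 2)) := by
      ext <;> simp <;> ring
    dsimp only at hmem
    rw [e] at hmem
    obtain ⟨h1, h2⟩ := curve_subset hmem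
    refine ⟨?_, (stadium_le_scale (by linarith)).trans h2⟩
    rw [abs_mul, abs_of_nonneg (by linarith)] at h1
    nlinarith [abs_nonneg y]

/-- Such a point lies over the outer region or at depth beyond ±1. In either case its radial ray can
be turned into a ray along the line of sight without meeting the knot. -/
theorem isRayValue_outer {x : ↥((fun v : ℝ × ℝ × ℝ => (v : S3)) '' curve p q r)ᶜ}
    {v : ℝ × ℝ × ℝ} (hx : (x : S3) = v) (hv : v ∉ nearSet) :
    IsRayValue φ x (rayHol φ v (v - (4, 0, 1 / 2))) := by
  refine ⟨v, hx, ?_⟩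
  obtain ⟨x, y, z⟩ := v
  have hy : ∀ y', 1 < |y'| → ∀ x z, (x, y', z) ∉ curve p q r := fun y' h x z hm =>
    h.not_ge (curve_subset hm).1
  by_cases h : 25 < stadium 4 x z
  · left
    refine ⟨mem_raySet_front fun y _ => mem_freePlane_of_lt_stadium h y, ?_⟩
    have := rayHol_outer φ (y := y) h (a := 1) (b := y) (a' := 0) (b' := -1) zero_le_one le_rfl
      (by simp) (by simp)
    simp only [one_mul, zero_mul] at this
    have e : ((x, y, z) : ℝ × ℝ × ℝ) - (4, 0, 1 / 2) = (x - 4, y, z - 1 / 2) := by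
      ext <;> simp
    rw [e]
    exact this
  · have hy1 : 1 < |y| := by
      by_contra hy1
      exact hv ⟨not_lt.1 hy1, not_lt.1 h⟩
    rcases lt_abs.1 hy1 with hy1 | hy1
    · right
      refine ⟨mem_raySet_back fun y' hy' => hy _ (lt_abs.2 (Or.inl (hy1.trans_le hy'))) _ _, ?_⟩
      have hconv : Convex ℝ {e : ℝ × ℝ × ℝ | 0 < e.2.1} :=
        (convex_Ioi (0 : ℝ)).is_linear_preimage (f := fun e : ℝ × ℝ × ℝ => e.2.1)
          ⟨fun _ _ => rfl, fun _ _ => rfl⟩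
      refine rayHol_eq_of_isPathConnected φ (hconv.isPathConnected ⟨(0, 1, 0), by simp⟩) ?_ ?_ ?_
      · rintro ⟨a, b, d⟩ he
        refine ⟨fun h0 => ?_, fun s hs => hy _ (lt_abs.2 (Or.inl ?_)) _ _⟩
        · simp_all
        · have : 0 ≤ s * b := mul_nonneg hs (le_of_lt he)
          simp
          linarith
      · simp
        linarith
      · simp
    · left
      refine ⟨mem_raySet_front fun y' hy' => hy _ (lt_abs.2 (Or.inr ?_)) _ _, ?_⟩
      · dsimp only at hy'
        linarith
      have hconv : Convex ℝ {e : ℝ × ℝ × ℝ | e.2.1 < 0} :=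
        (convex_Iio (0 : ℝ)).is_linear_preimage (f := fun e : ℝ × ℝ × ℝ => e.2.1)
          ⟨fun _ _ => rfl, fun _ _ => rfl⟩
      refine rayHol_eq_of_isPathConnected φ (hconv.isPathConnected ⟨(0, -1, 0), by simp⟩) ?_ ?_ ?_
      · rintro ⟨a, b, d⟩ he
        refine ⟨fun h0 => ?_, fun s hs => hy _ (lt_abs.2 (Or.inr ?_)) _ _⟩
        · simp_all
        · have : 0 ≤ s * -b := mul_nonneg hs (by simpa using le_of_lt he)
          simp
          linarith
      · simp
        linarith
      · simp

/-- Outside a compact set the radial rays provide a potential with value 1 at infinity, and at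
finite points it agrees with a ray along the line of sight. -/
theorem exists_isOpen_of_infty {x : ↥((fun v : ℝ × ℝ × ℝ => (v : S3)) '' curve p q r)ᶜ}
    (hx : (x : S3) = OnePoint.infty) :
    ∃ U : Set ↥((fun v : ℝ × ℝ × ℝ => (v : S3)) '' curve p q r)ᶜ, IsOpen U ∧ x ∈ U ∧
      ∀ (a b : _) (δ : Path a b), (∀ s, δ s ∈ U) →
        ∃ g g', (IsRayValue φ a g ∨ ((a : S3) = OnePoint.infty ∧ g = 1)) ∧
          (IsRayValue φ b g' ∨ ((b : S3) = OnePoint.infty ∧ g' = 1)) ∧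
          g⁻¹ * φ.val δ * g' ∈ S := by
  refine ⟨Subtype.val ⁻¹' ((↑) '' nearSet)ᶜ,
    ((OnePoint.isOpen_compl_image_coe).2 ⟨isCompact_nearSet.isClosed, isCompact_nearSet⟩).preimage
      continuous_subtype_val, ?_, fun a b δ hδ => ?_⟩
  · rintro ⟨v, -, hv⟩
    exact OnePoint.coe_ne_infty _ (hv.trans hx)
  · have hcase : ∀ y : S3, y ∈ ((↑) '' nearSet : Set S3)ᶜ →
        y = OnePoint.infty ∨ ∃ v ∈ nearSetᶜ, y = (v : S3) := by
      intro y hy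
      induction y using OnePoint.rec with
      | infty => exact Or.inl rfl
      | coe v => exact Or.inr ⟨v, fun hv => hy ⟨v, hv, rfl⟩, rfl⟩
    have hval : ∀ y : ↥((fun v : ℝ × ℝ × ℝ => (v : S3)) '' curve p q r)ᶜ,
        (y : S3) ∈ ((↑) '' nearSet : Set S3)ᶜ →
        IsRayValue φ y (outerHol φ (4, 0, 1 / 2) (y : S3)) ∨
          ((y : S3) = OnePoint.infty ∧ outerHol φ (4, 0, 1 / 2) (y : S3) = 1) := by
      intro y hy
      rcases hcase y hy with h | ⟨v, hv, h⟩
      · right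
        refine ⟨h, ?_⟩
        rw [h]
        rfl
      · left
        have := isRayValue_outer (φ := φ) h hv
        rw [h]
        exact this
    refine ⟨_, _, hval a (by simpa using hδ 0), hval b (by simpa using hδ 1), ?_⟩
    rw [val_eq_outerHol φ (v₀ := (4, 0, 1 / 2)) (O := nearSetᶜ)
      (fun v hv => mem_raySet_outer hv) δ (fun t => hcase _ (hδ t))]
    simp

end Pretzel

namespace Pretzel

variable {p q r : ℤ} {c : ℝ} {n : ℤ} {G : Type*} [Group G]
  (φ : Holonomy ↥((fun v : ℝ × ℝ × ℝ => (v : S3)) '' curve p q r)ᶜ G)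

/-! ### The inside of a column -/

/-- The coordinates in which the strands of a column are straight. -/
noncomputable def untwist (c : ℝ) (n : ℤ) (v : ℝ × ℝ × ℝ) : ℝ × ℝ × ℝ :=
  ((v.1 - c) * Real.cos (Real.pi * n * v.2.2) - v.2.1 * Real.sin (Real.pi * n * v.2.2),
    (v.1 - c) * Real.sin (Real.pi * n * v.2.2) + v.2.1 * Real.cos (Real.pi * n * v.2.2), v.2.2)

/-- The inverse of `untwist`. -/
noncomputable def twist (c : ℝ) (n : ℤ) (w : ℝ × ℝ × ℝ) : ℝ × ℝ × ℝ :=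
  (c + w.1 * Real.cos (Real.pi * n * w.2.2) + w.2.1 * Real.sin (Real.pi * n * w.2.2),
    -(w.1 * Real.sin (Real.pi * n * w.2.2)) + w.2.1 * Real.cos (Real.pi * n * w.2.2), w.2.2)

theorem twist_untwist (v : ℝ × ℝ × ℝ) : twist c n (untwist c n v) = v := by
  obtain ⟨x, y, z⟩ := v
  have h := Real.sin_sq_add_cos_sq (Real.pi * n * z)
  refine Prod.ext ?_ (Prod.ext ?_ rfl)
  · simp only [twist, untwist]
    linear_combination (x - c) * h
  · simp only [twist, untwist]
    linear_combination y * h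

theorem untwist_twist (w : ℝ × ℝ × ℝ) : untwist c n (twist c n w) = w := by
  obtain ⟨x, y, z⟩ := w
  have h := Real.sin_sq_add_cos_sq (Real.pi * n * z)
  refine Prod.ext ?_ (Prod.ext ?_ rfl)
  · simp only [twist, untwist]
    linear_combination x * h
  · simp only [twist, untwist]
    linear_combination y * h

theorem continuous_untwist : Continuous (untwist c n) := by
  unfold untwist
  fun_prop

theorem continuous_twist : Continuous (twist c n) := by
  unfold twist
  fun_prop

/-- The untwisted inside of a column. -/
def box : Set (ℝ × ℝ × ℝ) := Set.Ioo (-1) 1 ×ˢ Set.Ioo (-1) 1 ×ˢ Set.Ioo 0 1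

theorem convex_box : Convex ℝ box :=
  (convex_Ioo _ _).prod ((convex_Ioo _ _).prod (convex_Ioo _ _))

theorem isOpen_box : IsOpen box := isOpen_Ioo.prod (isOpen_Ioo.prod isOpen_Ioo)

/-- Twisting preserves the distance from the axis, which is below √2 < 3 / 2 in the box. Hence the
insides of different columns do not meet. -/
theorem abs_twist_sub_lt {w : ℝ × ℝ × ℝ} (hw : w ∈ box) : |(twist c n w).1 - c| < 3 / 2 := by
  obtain ⟨⟨h1, h2⟩, ⟨h3, h4⟩, -⟩ := hw
  have h5 := Real.sin_sq_add_cos_sq (Real.pi * n * w.2.2)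
  apply abs_lt_of_sq_lt_sq _ (by norm_num)
  simp only [twist]
  have h6 : (c + w.1 * Real.cos (Real.pi * n * w.2.2) + w.2.1 * Real.sin (Real.pi * n * w.2.2) - c) ^ 2
      ≤ w.1 ^ 2 + w.2.1 ^ 2 := by
    nlinarith [sq_nonneg (w.1 * Real.sin (Real.pi * n * w.2.2) -
      w.2.1 * Real.cos (Real.pi * n * w.2.2))]
  nlinarith

/-- In the untwisted coordinates the strands are the lines over (±1, 0), on the boundary of the box.
-/
theorem twist_notMem_curve (hc : IsColumn p q r c n) {w : ℝ × ℝ × ℝ} (hw : w ∈ box) :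
    twist c n w ∉ curve p q r := by
  intro h
  have h0 := hw.2.2
  obtain ⟨ε, hε, h1, h2⟩ := (mem_curve_column hc h0.1.le h0.2.le ((abs_twist_sub_lt hw).trans (by norm_num))).1 h
  have h3 := Real.sin_sq_add_cos_sq (Real.pi * n * w.2.2)
  simp only [twist] at h1 h2
  have h4 : w.1 = ε := by
    linear_combination Real.cos (Real.pi * n * w.2.2) * h1 -
      Real.sin (Real.pi * n * w.2.2) * h2 + (ε - w.1) * h3
  have h5 := hw.1
  rcases hε with rfl | rfl
  · exact h5.2.ne h4
  · exact h5.1.ne' h4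

theorem exists_of_not_frontVisible {v : ℝ × ℝ × ℝ} (hv : v ∉ curve p q r)
    (h : ¬ FrontVisible p q r v) : ∃ y < v.2.1, (v.1, y, v.2.2) ∈ curve p q r := by
  by_contra! h'
  refine h (mem_raySet_front fun y hy => ?_)
  rcases hy.lt_or_eq with hy | rfl
  · exact h' y hy
  · exact hv

theorem exists_of_not_backVisible {v : ℝ × ℝ × ℝ} (hv : v ∉ curve p q r)
    (h : ¬ BackVisible p q r v) : ∃ y > v.2.1, (v.1, y, v.2.2) ∈ curve p q r := by
  by_contra! h'
  refine h (mem_raySet_back fun y hy => ?_)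
  rcases hy.lt_or_eq with hy | rfl
  · exact h' y hy
  · exact hv

/-- Two points of different depth on the strands of a column that look the same to the observer. -/
theorem OnStrand.crossing {θ x y y' : ℝ} (h : OnStrand c θ x y) (h' : OnStrand c θ x y')
    (hy : y < y') : Real.cos θ = 0 ∧ x = c ∧ -1 ≤ y ∧ y' ≤ 1 := by
  have e1 := h.sq_add_sq
  have e2 := h'.sq_add_sq
  obtain ⟨ε, hε, h1, h2⟩ := h
  obtain ⟨ε', hε', h1', h2'⟩ := h'
  have hcos : Real.cos θ = 0 := by
    rcases hε with rfl | rfl <;> rcases hε' with rfl | rfl <;> linarith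
  refine ⟨hcos, by rw [h1, hcos, mul_zero, add_zero], ?_, ?_⟩
  · nlinarith [sq_nonneg (x - c)]
  · nlinarith [sq_nonneg (x - c)]

/-- A point that is hidden on both sides lies inside a column. -/
theorem exists_untwist_mem_box {v : ℝ × ℝ × ℝ} (hv : v ∉ curve p q r)
    (hf : ¬ FrontVisible p q r v) (hb : ¬ BackVisible p q r v) :
    ∃ c n, IsColumn p q r c n ∧ untwist c n v ∈ box := by
  obtain ⟨y, hy, h⟩ := exists_of_not_frontVisible hv hf
  obtain ⟨y', hy', h'⟩ := exists_of_not_backVisible hv hb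
  obtain ⟨x, y₀, z⟩ := v
  dsimp only at hy hy' h h'
  have hz0 : 0 < z := by
    by_contra! hz
    have e1 := ((mem_curve_bottom hz).1 h).1
    have e2 := ((mem_curve_bottom hz).1 h').1
    linarith
  have hz1 : z < 1 := by
    by_contra! hz
    have e1 := ((mem_curve_top hz).1 h).1
    have e2 := ((mem_curve_top hz).1 h').1
    linarith
  obtain ⟨c, n, hc, h1⟩ := (mem_curve_mid hz0.le hz1.le).1 h
  have hx : |x - c| < 3 := by
    apply abs_lt_of_sq_lt_sq _ (by norm_num)
    nlinarith [h1.sq_add_sq, sq_nonneg y]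
  have h2 := (mem_curve_column hc hz0.le hz1.le hx).1 h'
  obtain ⟨hcos, rfl, h3, h4⟩ := h1.crossing h2 (hy.trans hy')
  refine ⟨x, n, hc, ?_⟩
  have h5 := Real.sin_sq_add_cos_sq (Real.pi * n * z)
  rw [hcos] at h5
  have h6 : |y₀ * Real.sin (Real.pi * n * z)| < 1 := by
    apply abs_lt_of_sq_lt_sq _ (by norm_num)
    rw [mul_pow]
    nlinarith
  rw [abs_lt] at h6
  simp only [untwist, hcos, sub_self, zero_mul, mul_zero, zero_add, zero_sub]
  exact ⟨⟨by linarith, by linarith⟩, by norm_num, hz0, hz1⟩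

/-- The points inside a column that are hidden on both sides. -/
theorem of_twist_not_visible (hc : IsColumn p q r c n) {w : ℝ × ℝ × ℝ} (hw : w ∈ box)
    (hf : ¬ FrontVisible p q r (twist c n w)) (hb : ¬ BackVisible p q r (twist c n w)) :
    Real.cos (Real.pi * n * w.2.2) = 0 ∧ w.2.1 = 0 := by
  have hv := twist_notMem_curve hc hw
  obtain ⟨y, hy, h⟩ := exists_of_not_frontVisible hv hf
  obtain ⟨y', hy', h'⟩ := exists_of_not_backVisible hv hb
  have h0 := hw.2.2
  have h1 := (mem_curve_column hc h0.1.le h0.2.le ((abs_twist_sub_lt hw).trans (by norm_num))).1 h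
  have h2 := (mem_curve_column hc h0.1.le h0.2.le ((abs_twist_sub_lt hw).trans (by norm_num))).1 h'
  obtain ⟨hcos, h3, -, -⟩ := h1.crossing h2 (hy.trans hy')
  have h4 : Real.cos (Real.pi * n * w.2.2) = 0 := hcos
  refine ⟨h4, ?_⟩
  have h5 := Real.sin_sq_add_cos_sq (Real.pi * n * w.2.2)
  simp only [twist, h4, mul_zero, add_zero] at h3
  have h6 : w.2.1 * Real.sin (Real.pi * n * w.2.2) = 0 := by linarith
  rw [h4] at h5
  linear_combination Real.sin (Real.pi * n * w.2.2) * h6 - w.2.1 * h5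

/-- The points of the box that are not hidden on both sides after twisting. -/
def visibleBox (p q r : ℤ) (c : ℝ) (n : ℤ) : Set (ℝ × ℝ × ℝ) :=
  {w | w ∈ box ∧ (FrontVisible p q r (twist c n w) ∨ BackVisible p q r (twist c n w))}

theorem mem_visibleBox (hc : IsColumn p q r c n) {w : ℝ × ℝ × ℝ} (hw : w ∈ box)
    (h : Real.cos (Real.pi * n * w.2.2) ≠ 0 ∨ w.2.1 ≠ 0) : w ∈ visibleBox p q r c n := by
  refine ⟨hw, ?_⟩
  by_contra! h'
  have := of_twist_not_visible hc hw h'.1 h'.2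
  tauto

/-- At a crossing the strands pass at depth ±1, and a point of the box with untwisted second
coordinate 0 lies strictly between them on the same line of sight. -/
theorem cos_ne_zero_of_mem_visibleBox (hc : IsColumn p q r c n) {x z : ℝ}
    (hw : (x, 0, z) ∈ visibleBox p q r c n) : Real.cos (Real.pi * n * z) ≠ 0 := by
  intro hz
  obtain ⟨⟨⟨hx1, hx2⟩, -, hz0, hz1⟩, hv⟩ := hw
  have h5 := Real.sin_sq_add_cos_sq (Real.pi * n * z)
  rw [hz] at h5
  have h6 : |x * Real.sin (Real.pi * n * z)| < 1 := by
    apply abs_lt_of_sq_lt_sq _ (by norm_num)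
    rw [mul_pow]
    nlinarith
  rw [abs_lt] at h6
  have hmem : ∀ y : ℝ, y ^ 2 = 1 → (c, y, z) ∈ curve p q r := by
    intro y hy
    refine (mem_curve_column hc (le_of_lt hz0) (le_of_lt hz1) (by simp)).2
      ⟨-(y * Real.sin (Real.pi * n * z)), by
        rw [← sq_eq_one_iff]
        nlinarith, ?_, ?_⟩
    · rw [hz]
      ring
    · linear_combination -y * h5
  rcases hv with hv | hv
  · refine hv.2 (1 - x * Real.sin (Real.pi * n * z)) (by linarith) ?_
    convert hmem (-1) (by norm_num) using 1
    ext <;> simp [twist, hz]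
    ring
  · refine hv.2 (1 + x * Real.sin (Real.pi * n * z)) (by linarith) ?_
    convert hmem 1 (by norm_num) using 1
    ext <;> simp [twist, hz]

/-- At the chosen level the strands have turned by less than a right angle. -/
theorem exists_level (n : ℤ) : ∃ z ∈ Set.Ioo (0 : ℝ) 1, Real.cos (Real.pi * n * z) ≠ 0 := by
  refine ⟨1 / (2 * (|(n : ℝ)| + 1)), ⟨by positivity, ?_⟩, ne_of_gt (Real.cos_pos_of_mem_Ioo ?_)⟩
  · rw [div_lt_one (by positivity)]
    linarith [abs_nonneg (n : ℝ)]
  · have h1 : |Real.pi * n * (1 / (2 * (|(n : ℝ)| + 1)))| < Real.pi / 2 := by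
      rw [abs_mul, abs_mul, abs_of_pos Real.pi_pos,
        abs_of_pos (by positivity : 0 < 1 / (2 * (|(n : ℝ)| + 1))), mul_one_div, div_lt_iff₀ (by positivity)]
      nlinarith [Real.pi_pos]
    exact abs_lt.1 h1

/-- The removed points lie on the plane with second coordinate 0, at crossing levels only. One
leaves this plane within a level, changes the level off the plane, and returns at the level z₁,
which is not a crossing. -/
theorem joinedIn_visibleBox (hc : IsColumn p q r c n) {z₁ : ℝ} (hz₁ : z₁ ∈ Set.Ioo (0 : ℝ) 1)
    (hcos : Real.cos (Real.pi * n * z₁) ≠ 0) {w : ℝ × ℝ × ℝ} (hw : w ∈ visibleBox p q r c n) :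
    JoinedIn (visibleBox p q r c n) w (0, 0, z₁) := by
  have seg : ∀ w w' : ℝ × ℝ × ℝ, w ∈ box → w' ∈ box → (∀ t ∈ Set.Icc (0 : ℝ) 1,
      Real.cos (Real.pi * n * (AffineMap.lineMap w w' t).2.2) ≠ 0 ∨
        (AffineMap.lineMap w w' t).2.1 ≠ 0) →
      JoinedIn (visibleBox p q r c n) w w' := by
    intro w w' hw hw' h
    refine JoinedIn.ofLine (f := AffineMap.lineMap w w') ?_ (by simp) (by simp) ?_
    · exact AffineMap.lineMap_continuous.continuousOn
    · rintro _ ⟨t, ht, rfl⟩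
      exact mem_visibleBox hc (convex_box.lineMap_mem hw hw' ht) (h t ht)
  have main : ∀ x y z, (x, y, z) ∈ box → y ≠ 0 →
      JoinedIn (visibleBox p q r c n) (x, y, z) (0, 0, z₁) := by
    intro x y z h hy
    have h1 : (x, y, z₁) ∈ box := ⟨h.1, h.2.1, hz₁⟩
    have h2 : ((0, 0, z₁) : ℝ × ℝ × ℝ) ∈ box := ⟨by norm_num, by norm_num, hz₁⟩
    refine (seg _ _ h h1 fun t ht => Or.inr ?_).trans (seg _ _ h1 h2 fun t ht => Or.inl ?_)
    · simpa [AffineMap.lineMap_apply] using hy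
    · simpa [AffineMap.lineMap_apply] using hcos
  obtain ⟨x, y, z⟩ := w
  rcases ne_or_eq y 0 with hy | rfl
  · exact main x y z hw.1 hy
  · have hz := cos_ne_zero_of_mem_visibleBox hc hw
    have h1 : (x, 1 / 2, z) ∈ box := ⟨hw.1.1, by norm_num, hw.1.2.2⟩
    refine (seg _ _ hw.1 h1 fun t ht => Or.inl ?_).trans (main _ _ _ h1 (by norm_num))
    simpa [AffineMap.lineMap_apply] using hz

end Pretzel

/-! ### Conjugacy of inverses -/

section Conj

variable {G : Type*} [Group G] {a b : G}

theorem isConj_inv_inv (h : IsConj a b) : IsConj a⁻¹ b⁻¹ := by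
  obtain ⟨c, rfl⟩ := isConj_iff.1 h
  exact isConj_iff.2 ⟨c, by group⟩

theorem isConj_of_isConj_inv (h : IsConj a⁻¹ b⁻¹) : IsConj a b := by
  simpa using isConj_inv_inv h

theorem isConj_inv_of_isConj (h : IsConj a⁻¹ b) : IsConj a b⁻¹ := by
  simpa using isConj_inv_inv h

end Conj

namespace Pretzel

variable {p q r : ℤ} {c : ℝ} {n : ℤ} {G : Type*} [Group G]
  (φ : Holonomy ↥((fun v : ℝ × ℝ × ℝ => (v : S3)) '' curve p q r)ᶜ G)

/-! ### Generators of the values of a holonomy on loops -/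

/-- The inside of a column carries a potential that agrees with the rays up to a subgroup. -/
theorem exists_columnHol {S : Subgroup G} (h2 : lineHol φ 2 (1 / 2) ∈ S)
    (h6 : lineHol φ 6 (1 / 2) ∈ S) (h4 : lineHol φ 4 5 ∈ S) (hc : IsColumn p q r c n) :
    ∃ J : ℝ × ℝ × ℝ → G,
      (∀ (a b : ↥((fun v : ℝ × ℝ × ℝ => (v : S3)) '' curve p q r)ᶜ) (δ : Path a b),
        (∀ t, ∃ v ∈ untwist c n ⁻¹' box, (δ t : S3) = v) →
        ∃ u v, (untwist c n u ∈ box ∧ (a : S3) = u) ∧ (untwist c n v ∈ box ∧ (b : S3) = v) ∧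
          φ.val δ = J u * (J v)⁻¹) ∧
      ∀ (x : ↥((fun v : ℝ × ℝ × ℝ => (v : S3)) '' curve p q r)ᶜ) (v : ℝ × ℝ × ℝ) (g : G),
        untwist c n v ∈ box → (x : S3) = v → IsRayValue φ x g → (J v)⁻¹ * g ∈ S := by
  obtain ⟨z₁, hz₁, hcos⟩ := exists_level n
  have hw₀ : ((0, 0, z₁) : ℝ × ℝ × ℝ) ∈ box := ⟨by norm_num, by norm_num, hz₁⟩
  obtain ⟨K, hK⟩ := exists_isPotential_of_convex φ convex_box ⟨_, hw₀⟩ continuous_twist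
    (fun w hw => twist_notMem_curve hc hw)
  obtain ⟨g₀, hg₀⟩ : ∃ g₀, IsRayValue φ
      (complPoint (twist c n (0, 0, z₁)) (twist_notMem_curve hc hw₀)) g₀ := by
    rcases (mem_visibleBox hc hw₀ (Or.inl hcos)).2 with h | h
    · exact ⟨_, _, rfl, Or.inl ⟨h, rfl⟩⟩
    · exact ⟨_, _, rfl, Or.inr ⟨h, rfl⟩⟩
  have hval : ∀ (a b : ↥((fun v : ℝ × ℝ × ℝ => (v : S3)) '' curve p q r)ᶜ) (δ : Path a b),
      (∀ t, ∃ v ∈ untwist c n ⁻¹' box, (δ t : S3) = v) →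
      ∃ u v, (untwist c n u ∈ box ∧ (a : S3) = u) ∧ (untwist c n v ∈ box ∧ (b : S3) = v) ∧
        φ.val δ = K (untwist c n u) * (K (untwist c n v))⁻¹ := by
    intro a b δ hδ
    obtain ⟨η, hη⟩ := exists_lift δ hδ
    refine ⟨η 0, η 1, ⟨(hη 0).1, by rw [← (hη 0).2, δ.source]⟩,
      ⟨(hη 1).1, by rw [← (hη 1).2, δ.target]⟩, ?_⟩
    have h1 := hK.comp ⟨fun t : unitInterval => (⟨untwist c n (η t), (hη t).1⟩ : box),
      (continuous_untwist.comp η.continuous).subtype_mk _⟩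
    refine Holonomy.val_eq_of_isPotential_path (k := fun t => K (untwist c n (η t)))
      (h1.congr fun t => Subtype.ext ?_)
    change ((twist c n (untwist c n (η t)) : ℝ × ℝ × ℝ) : S3) = _
    rw [twist_untwist, ← (hη t).2]
    rfl
  -- The potential is normalized to equal the ray value g₀ at the base point of the box.
  refine ⟨fun v => K (untwist c n v) * (K (0, 0, z₁))⁻¹ * g₀, fun a b δ hδ => ?_,
    fun x v g hv hx hg => ?_⟩
  · obtain ⟨u, v, hu, hv, h⟩ := hval a b δ hδ
    refine ⟨u, v, hu, hv, ?_⟩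
    rw [h]
    group
  · have hvis : untwist c n v ∈ visibleBox p q r c n := by
      refine ⟨hv, ?_⟩
      rw [twist_untwist]
      obtain ⟨v', hv', h⟩ := hg
      obtain rfl : v = v' := OnePoint.coe_injective (hx.symm.trans hv')
      exact h.imp And.left And.left
    have hj := joinedIn_visibleBox hc hz₁ hcos hvis
    let β : Path x (complPoint (twist c n (0, 0, z₁)) (twist_notMem_curve hc hw₀)) :=
      { toFun := fun t => complPoint (twist c n (hj.somePath t))
          (twist_notMem_curve hc (hj.somePath_mem t).1)
        continuous_toFun := continuous_complPoint
          (continuous_twist.comp hj.somePath.continuous) _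
        source' := by
          apply Subtype.ext
          simp only [hj.somePath.source, twist_untwist, hx]
          rfl
        target' := by
          apply Subtype.ext
          simp only [hj.somePath.target] }
    -- The path β stays among the visible points, so ray values compute its holonomy modulo S; the
    -- potential of the box computes it exactly.
    have hglue := φ.inv_mul_val_mul_mem S (IsRayValue φ)
      (fun x g g' h h' => h.inv_mul_mem h2 h6 h4 h') β
      (fun t => exists_isOpen_of_visible (v := twist c n (hj.somePath t)) rfl
        (hj.somePath_mem t).2) hg hg₀
    obtain ⟨u, w, ⟨-, hu⟩, ⟨-, hw⟩, h⟩ := hval _ _ β (fun t =>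
      ⟨twist c n (hj.somePath t), by
        rw [Set.mem_preimage, untwist_twist]
        exact (hj.somePath_mem t).1, rfl⟩)
    obtain rfl : v = u := OnePoint.coe_injective (hx.symm.trans hu)
    obtain rfl : twist c n (0, 0, z₁) = w := OnePoint.coe_injective hw
    rw [h, untwist_twist] at hglue
    rw [← S.inv_mem_iff]
    convert hglue using 1
    group

theorem IsColumn.eq_of_abs_lt {c c' x : ℝ} {n n' : ℤ} (hc : IsColumn p q r c n)
    (hc' : IsColumn p q r c' n') (h : |x - c| < 3 / 2) (h' : |x - c'| < 3 / 2) :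
    c = c' ∧ n = n' := by
  rw [abs_lt] at h h'
  rcases hc with ⟨rfl, rfl⟩ | ⟨rfl, rfl⟩ | ⟨rfl, rfl⟩ <;>
    rcases hc' with ⟨rfl, rfl⟩ | ⟨rfl, rfl⟩ | ⟨rfl, rfl⟩ <;>
    first | exact ⟨rfl, rfl⟩ | (exfalso; linarith)

/-- Up to conjugation, the values of a holonomy on loops are generated by three of its values. -/
theorem exists_conj_val_mem {S : Subgroup G} (h2 : lineHol φ 2 (1 / 2) ∈ S)
    (h6 : lineHol φ 6 (1 / 2) ∈ S) (h4 : lineHol φ 4 5 ∈ S)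
    (y : ↥((fun v : ℝ × ℝ × ℝ => (v : S3)) '' curve p q r)ᶜ) :
    ∃ k : G, ∀ γ : Path y y, k⁻¹ * φ.val γ * k ∈ S := by
  choose! J hJ₁ hJ₂ using fun (c : ℝ) (n : ℤ) (hc : IsColumn p q r c n) =>
    exists_columnHol φ h2 h6 h4 hc
  -- Local values of three kinds cover the complement: rays along the line of sight, the value 1 at
  -- infinity, and the potentials inside the columns for points hidden on both sides. On overlaps
  -- they agree modulo S.
  let P : ↥((fun v : ℝ × ℝ × ℝ => (v : S3)) '' curve p q r)ᶜ → G → Prop := fun x g =>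
    (IsRayValue φ x g ∨ ((x : S3) = OnePoint.infty ∧ g = 1)) ∨
      ∃ c n v, IsColumn p q r c n ∧ untwist c n v ∈ box ∧ (x : S3) = v ∧ g = J c n v
  have hsymm : ∀ g g' : G, g⁻¹ * g' ∈ S → g'⁻¹ * g ∈ S := by
    intro g g' h
    rw [← S.inv_mem_iff]
    convert h using 1
    group
  have hP : ∀ x g g', P x g → P x g' → g⁻¹ * g' ∈ S := by
    rintro x g g' ((h | ⟨h, rfl⟩) | ⟨c, n, v, hc, hv, h, rfl⟩)
      ((h' | ⟨h', rfl⟩) | ⟨c', n', v', hc', hv', h', rfl⟩)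
    · exact h.inv_mul_mem h2 h6 h4 h'
    · obtain ⟨v, hv, -⟩ := h
      exact absurd (hv.symm.trans h') (OnePoint.coe_ne_infty _)
    · exact hsymm _ _ (hJ₂ c' n' hc' x v' g hv' h' h)
    · obtain ⟨v, hv, -⟩ := h'
      exact absurd (hv.symm.trans h) (OnePoint.coe_ne_infty _)
    · simp
    · exact absurd (h'.symm.trans h) (OnePoint.coe_ne_infty _)
    · exact hJ₂ c n hc x v g' hv h h'
    · exact absurd (h.symm.trans h') (OnePoint.coe_ne_infty _)
    · obtain rfl : v = v' := OnePoint.coe_injective (h.symm.trans h')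
      have e : |v.1 - c| < 3 / 2 := by
        have := abs_twist_sub_lt (c := c) (n := n) hv
        rwa [twist_untwist] at this
      have e' : |v.1 - c'| < 3 / 2 := by
        have := abs_twist_sub_lt (c := c') (n := n') hv'
        rwa [twist_untwist] at this
      obtain ⟨rfl, rfl⟩ := hc.eq_of_abs_lt hc' e e'
      simp
  have hloc : ∀ x : ↥((fun v : ℝ × ℝ × ℝ => (v : S3)) '' curve p q r)ᶜ, ∃ U, IsOpen U ∧ x ∈ U ∧
      ∀ (a b : _) (δ : Path a b), (∀ s, δ s ∈ U) → ∃ g g', P a g ∧ P b g' ∧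
        g⁻¹ * φ.val δ * g' ∈ S := by
    intro x
    obtain ⟨x', hx'⟩ : ∃ x' : S3, x' = x := ⟨_, rfl⟩
    induction x' using OnePoint.rec with
    | infty =>
      obtain ⟨U, hU, hxU, h⟩ := exists_isOpen_of_infty (φ := φ) (S := S) hx'.symm
      refine ⟨U, hU, hxU, fun a b δ hδ => ?_⟩
      obtain ⟨g, g', h1, h2, h3⟩ := h a b δ hδ
      exact ⟨g, g', Or.inl h1, Or.inl h2, h3⟩
    | coe v =>
      by_cases hvis : FrontVisible p q r v ∨ BackVisible p q r v
      · obtain ⟨U, hU, hxU, h⟩ := exists_isOpen_of_visible (φ := φ) (S := S) hx'.symm hvis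
        refine ⟨U, hU, hxU, fun a b δ hδ => ?_⟩
        obtain ⟨g, g', h1, h2, h3⟩ := h a b δ hδ
        exact ⟨g, g', Or.inl (Or.inl h1), Or.inl (Or.inl h2), h3⟩
      · rw [not_or] at hvis
        obtain ⟨c, n, hc, hv⟩ := exists_untwist_mem_box
          (fun h => x.2 ⟨v, h, hx'⟩) hvis.1 hvis.2
        refine ⟨Subtype.val ⁻¹' ((↑) '' (untwist c n ⁻¹' box)),
          (OnePoint.isOpenEmbedding_coe.isOpenMap _
            (isOpen_box.preimage continuous_untwist)).preimage continuous_subtype_val,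
          ⟨v, hv, hx'⟩, fun a b δ hδ => ?_⟩
        obtain ⟨u, w, ⟨hu, ha⟩, ⟨hw, hb⟩, h⟩ := hJ₁ c n hc a b δ (fun t => by
          obtain ⟨v, hv, h⟩ := hδ t
          exact ⟨v, hv, h.symm⟩)
        refine ⟨J c n u, J c n w, Or.inr ⟨c, n, u, hc, hu, ha, rfl⟩,
          Or.inr ⟨c, n, w, hc, hw, hb, rfl⟩, ?_⟩
        rw [h]
        simp
  obtain ⟨U, -, hy, h⟩ := hloc y
  obtain ⟨k, -, hk, -⟩ := h y y (Path.refl y) (fun _ => hy)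
  exact ⟨k, fun γ => φ.inv_mul_val_mul_mem S P hP γ (fun t => hloc _) hk hk⟩

/-- Every group element is the holonomy of a loop, and a fixed conjugation maps all of these into
the subgroup, which is therefore everything. -/
theorem closure_lineHol_eq_top (y : ↥((fun v : ℝ × ℝ × ℝ => (v : S3)) '' curve p q r)ᶜ) :
    Subgroup.closure {lineHol (loopHolonomy y) 4 5, lineHol (loopHolonomy y) 2 (1 / 2),
      lineHol (loopHolonomy y) 6 (1 / 2)} = ⊤ := by
  obtain ⟨k, hk⟩ := exists_conj_val_mem (loopHolonomy y)
    (Subgroup.subset_closure (k := {lineHol (loopHolonomy y) 4 5, lineHol (loopHolonomy y) 2 (1 / 2),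
      lineHol (loopHolonomy y) 6 (1 / 2)}) (by simp)) (Subgroup.subset_closure (by simp))
    (Subgroup.subset_closure (by simp)) y
  rw [eq_top_iff]
  rintro g -
  obtain ⟨γ, hγ⟩ := exists_loopHolonomy_eq (k * g * k⁻¹)
  have := hk γ
  rw [hγ] at this
  convert this using 1
  group

/-! ### The meridian -/

/-- The highest and the lowest point of the circle divide it into a half visible from the front and
a half visible from the back. The highest point lies over the outer region, so only the line through
the lowest point contributes. -/
theorem isConj_val_meridianLoop :
    IsConj (φ.val (X := ↥((fun v : ℝ × ℝ × ℝ => (v : S3)) '' curve p q r)ᶜ) (meridianLoop p q r))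
      (lineHol φ 4 5) := by
  have hmem : ∀ t : ℝ, meridianCircle t ∉ curve p q r := fun t h =>
    meridianCircle_notMem p q r t ⟨_, h, rfl⟩
  have hpi := Real.pi_pos
  have hcont : Continuous meridianCircle := by
    unfold meridianCircle
    fun_prop
  obtain ⟨K, hK⟩ := exists_isPotential_of_convex φ (convex_Icc (0 : ℝ) 1) ⟨0, by simp⟩ hcont
    (fun t _ => hmem t)
  have hval : φ.val (X := ↥((fun v : ℝ × ℝ × ℝ => (v : S3)) '' curve p q r)ᶜ)
      (meridianLoop p q r) = K 0 * (K 1)⁻¹ := by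
    have h1 := hK.comp (⟨fun t => t, continuous_id⟩ : C(unitInterval, Set.Icc (0 : ℝ) 1))
    exact Holonomy.val_eq_of_isPotential_path (k := fun t : unitInterval => K t)
      (h1.congr fun t => rfl)
  have htop : ∀ t y : ℝ, (4, y, 6 + Real.sin (2 * Real.pi * t)) ∈ curve p q r → y = 0 ∧
      Real.sin (2 * Real.pi * t) = 0 := by
    intro t y h
    have h1 := Real.neg_one_le_sin (2 * Real.pi * t)
    obtain ⟨h0, h⟩ := (mem_curve_top (by linarith)).1 h
    refine ⟨h0, ?_⟩
    rcases h with h | h | h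
    · nlinarith
    · nlinarith
    · have h2 : Real.sin (2 * Real.pi * t) * (10 + Real.sin (2 * Real.pi * t)) = 0 := by
        linear_combination h
      rcases mul_eq_zero.1 h2 with h2 | h2
      · exact h2
      · linarith
  have hback : ∀ t, 0 ≤ Real.cos (2 * Real.pi * t) →
      (meridianCircle t, ((0, 1, 0) : ℝ × ℝ × ℝ)) ∈ raySet (curve p q r) := by
    intro t ht
    refine mem_raySet_back fun y hy h => ?_
    obtain ⟨h1, h2⟩ := htop t y h
    have h3 := Real.sin_sq_add_cos_sq (2 * Real.pi * t)
    simp only [meridianCircle] at hy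
    rw [h1] at hy
    rw [h2, le_antisymm hy ht] at h3
    norm_num at h3
  have hfront : ∀ t, Real.cos (2 * Real.pi * t) ≤ 0 →
      (meridianCircle t, ((0, -1, 0) : ℝ × ℝ × ℝ)) ∈ raySet (curve p q r) := by
    intro t ht
    refine mem_raySet_front fun y hy h => ?_
    obtain ⟨h1, h2⟩ := htop t y h
    have h3 := Real.sin_sq_add_cos_sq (2 * Real.pi * t)
    simp only [meridianCircle] at hy
    rw [h1] at hy
    rw [h2, le_antisymm ht hy] at h3
    norm_num at h3
  have hseg : ∀ a b : ℝ, a ≤ b → IsPathConnected (Set.Icc a b) := fun a b h =>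
    (convex_Icc a b).isPathConnected ⟨a, by simp [h]⟩
  have e1 := inv_potential_mul_rayHol φ (hf := hcont) (h := fun t _ => hmem t) hK (T := Set.Icc 0 (1 / 4)) (e := (0, 1, 0))
    (fun t ht => ⟨ht.1, by linarith [ht.2]⟩) (hseg _ _ (by norm_num))
    (fun t ht => hback t (Real.cos_nonneg_of_mem_Icc ⟨by nlinarith [ht.1], by nlinarith [ht.2]⟩))
    (a := 0) (b := 1 / 4) (by norm_num) (by norm_num)
  have e2 := inv_potential_mul_rayHol φ (hf := hcont) (h := fun t _ => hmem t) hK (T := Set.Icc (1 / 4) (3 / 4)) (e := (0, -1, 0))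
    (fun t ht => ⟨by linarith [ht.1], by linarith [ht.2]⟩) (hseg _ _ (by norm_num))
    (fun t ht => hfront t (Real.cos_nonpos_of_pi_div_two_le_of_le (by nlinarith [ht.1])
      (by nlinarith [ht.2])))
    (a := 1 / 4) (b := 3 / 4) (by norm_num) (by norm_num)
  have e3 := inv_potential_mul_rayHol φ (hf := hcont) (h := fun t _ => hmem t) hK (T := Set.Icc (3 / 4) 1) (e := (0, 1, 0))
    (fun t ht => ⟨by linarith [ht.1], ht.2⟩) (hseg _ _ (by norm_num))
    (fun t ht => hback t (by
      rw [← Real.cos_sub_two_pi]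
      exact Real.cos_nonneg_of_mem_Icc ⟨by nlinarith [ht.1], by nlinarith [ht.2]⟩))
    (a := 3 / 4) (b := 1) (by norm_num) (by norm_num)
  have c0 : meridianCircle 0 = meridianCircle 1 := by simp [meridianCircle]
  have c1 : meridianCircle (1 / 4) = (4, 0, 7) := by
    have : 2 * Real.pi * (1 / 4) = Real.pi / 2 := by ring
    rw [meridianCircle, this, Real.cos_pi_div_two, Real.sin_pi_div_two]
    norm_num
  have c3 : meridianCircle (3 / 4) = (4, 0, 5) := by
    have : 2 * Real.pi * (3 / 4) = Real.pi / 2 + Real.pi := by ring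
    rw [meridianCircle, this, Real.cos_add_pi, Real.sin_add_pi, Real.cos_pi_div_two,
      Real.sin_pi_div_two]
    norm_num
  -- At the highest point the front ray and the back ray have equal holonomy, which joins the first
  -- two arcs.
  have o := lineHol_outer φ (x := 4) (z := 7) (by rw [stadium_top (by norm_num)]; norm_num)
  rw [c0, c1] at e1
  rw [c1, c3] at e2
  rw [c3] at e3
  rw [lineHol, frontHol, backHol, inv_mul_eq_one] at o
  rw [hval, lineHol, frontHol, backHol]
  refine isConj_iff.2 ⟨(rayHol φ (meridianCircle 1) (0, 1, 0))⁻¹, ?_⟩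
  have e4 := congrArg (·⁻¹) ((e1.trans (by rw [← o])).trans e2)
  simp only [mul_inv_rev, inv_inv] at e4
  rw [inv_inv, ← mul_assoc, e4, mul_assoc, mul_assoc, ← e3]
  group

/-- The two orientations of the meridian account for the two signs; the tautological holonomy
inverts the classes of loops. -/
theorem isConj_of_isMeridian {y : Complement p q r} {m : KnotGroup p q r y}
    (hm : IsMeridian p q r m) :
    IsConj m (lineHol (p := p) (q := q) (r := r) (loopHolonomy y) 4 5) ∨
      IsConj m (lineHol (p := p) (q := q) (r := r) (loopHolonomy y) 4 5)⁻¹ := by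
  have h := isConj_val_meridianLoop (p := p) (q := q) (r := r) (loopHolonomy (X := Complement p q r) y)
  obtain ⟨γ, hm⟩ := hm
  have hγ : ∀ δ : Path _ _, IsConj ((loopHolonomy y).val (γ.symm.trans (δ.trans γ)))
      ((loopHolonomy y).val δ) := by
    intro δ
    refine isConj_iff.2 ⟨(loopHolonomy y).val γ, ?_⟩
    rw [Holonomy.val_trans, Holonomy.val_trans, Holonomy.val_symm]
    group
  rcases hm with hm | hm
  · right
    refine isConj_inv_of_isConj (IsConj.trans ?_ h)
    have := hγ (meridianLoop p q r)
    rw [loopHolonomy_val_loop] at this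
    rw [hm]
    exact this
  · left
    refine isConj_of_isConj_inv (IsConj.trans ?_ (isConj_inv_inv h))
    rw [← Holonomy.val_symm]
    have := hγ (meridianLoop p q r).symm
    rw [loopHolonomy_val_loop] at this
    rw [hm]
    exact this

end Pretzel

namespace Pretzel

/-! ### Twists in a group with a central involution -/

/-- The element `m'` arises from `m` by `n` half twists with sides `l` and `r`. -/
def IsTwist {G : Type*} [Group G] (n : ℤ) (l r m m' : G) : Prop :=
  (0 ≤ n ∧ m' = (halfTwist l r)^[n.natAbs] m) ∨ (n < 0 ∧ m' = (halfTwist r l)^[n.natAbs] m)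

theorem lineHol_isTwist {p q r : ℤ} {c : ℝ} {n : ℤ} {G : Type*} [Group G]
    (φ : Holonomy ↥((fun v : ℝ × ℝ × ℝ => (v : S3)) '' curve p q r)ᶜ G)
    (hc : IsColumn p q r c n) :
    IsTwist n (lineHol φ (c - 2) (1 / 2)) (lineHol φ (c + 2) (1 / 2)) (lineHol φ 4 (-4))
      (lineHol φ 4 5) := by
  have e1 : c + 2 * -1 = c - 2 := by ring
  have e2 : c + 2 * 1 = c + 2 := by ring
  rcases le_or_gt 0 n with hn | hn
  · refine Or.inl ⟨hn, ?_⟩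
    have := lineHol_twist φ hc (σ := 1) (Or.inl rfl) (by
      rw [Nat.cast_natAbs, abs_of_nonneg hn, one_mul])
    rwa [e1, e2] at this
  · refine Or.inr ⟨hn, ?_⟩
    have := lineHol_twist φ hc (σ := -1) (Or.inr rfl) (by
      rw [Nat.cast_natAbs, abs_of_neg hn]
      simp)
    rwa [neg_neg, e1, e2] at this

section Group

variable {G H : Type*} [Group G] [Group H] {n : ℤ} {s l r m m' : G}

theorem IsTwist.map (h : IsTwist n l r m m') (f : G →* H) :
    IsTwist n (f l) (f r) (f m) (f m') := by
  have key : ∀ (l r : G) (k : ℕ), f ((halfTwist l r)^[k] m) = (halfTwist (f l) (f r))^[k] (f m) := by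
    intro l r k
    refine Function.Semiconj.iterate_right (f := f) (fun a => ?_) k m
    simp [halfTwist]
  rcases h with ⟨h, rfl⟩ | ⟨h, rfl⟩
  · exact Or.inl ⟨h, key _ _ _⟩
  · exact Or.inr ⟨h, key _ _ _⟩

theorem inv_mul_self_eq_iff (hs2 : s * s = 1) {a : G} : a⁻¹ * a⁻¹ = s ↔ a * a = s := by
  rw [← mul_inv_rev, inv_eq_iff_eq_inv, ← eq_inv_of_mul_eq_one_left hs2]

theorem conj_mul_self_eq_iff (hs : ∀ g, Commute s g) {a : G} (g : G) :
    (g * a * g⁻¹) * (g * a * g⁻¹) = s ↔ a * a = s := by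
  have h1 : (g * a * g⁻¹) * (g * a * g⁻¹) = g * (a * a) * g⁻¹ := by group
  rw [h1, mul_inv_eq_iff_eq_mul, (hs g).eq]
  exact mul_right_inj g

/-- The quotient of the generators of two regions beside a strand is a meridian of this strand. Up
to inversion, the left meridian after a half twist is the right meridian before it. -/
theorem halfTwist_left_iff (hs2 : s * s = 1) :
    l * (halfTwist l r m)⁻¹ * (l * (halfTwist l r m)⁻¹) = s ↔ r * m⁻¹ * (r * m⁻¹) = s := by
  have h1 : l * (halfTwist l r m)⁻¹ = (r * m⁻¹)⁻¹ := by
    unfold halfTwist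
    group
  rw [h1, inv_mul_self_eq_iff hs2]

/-- The right meridian after a half twist is a conjugate of the inverse of the left one before it,
and neither operation affects having the square s. -/
theorem halfTwist_right_iff (hs : ∀ g, Commute s g) (hs2 : s * s = 1) :
    r * (halfTwist l r m)⁻¹ * (r * (halfTwist l r m)⁻¹) = s ↔ l * m⁻¹ * (l * m⁻¹) = s := by
  have h1 : r * (halfTwist l r m)⁻¹ = (r * l⁻¹) * (l * m⁻¹)⁻¹ * (r * l⁻¹)⁻¹ := by
    unfold halfTwist
    group
  rw [h1, conj_mul_self_eq_iff hs, inv_mul_self_eq_iff hs2]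

theorem iterate_halfTwist_parity (hs : ∀ g, Commute s g) (hs2 : s * s = 1) (l r m : G) (k : ℕ) :
    (Even k →
      (l * ((halfTwist l r)^[k] m)⁻¹ * (l * ((halfTwist l r)^[k] m)⁻¹) = s ↔
        l * m⁻¹ * (l * m⁻¹) = s) ∧
      (r * ((halfTwist l r)^[k] m)⁻¹ * (r * ((halfTwist l r)^[k] m)⁻¹) = s ↔
        r * m⁻¹ * (r * m⁻¹) = s)) ∧
    (¬ Even k →
      (l * ((halfTwist l r)^[k] m)⁻¹ * (l * ((halfTwist l r)^[k] m)⁻¹) = s ↔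
        r * m⁻¹ * (r * m⁻¹) = s) ∧
      (r * ((halfTwist l r)^[k] m)⁻¹ * (r * ((halfTwist l r)^[k] m)⁻¹) = s ↔
        l * m⁻¹ * (l * m⁻¹) = s)) := by
  induction k with
  | zero => simp
  | succ k ih =>
    rw [Function.iterate_succ_apply', halfTwist_left_iff hs2, halfTwist_right_iff hs hs2,
      Nat.even_add_one]
    tauto

theorem IsTwist.parity (hs : ∀ g, Commute s g) (hs2 : s * s = 1) (h : IsTwist n l r m m') :
    (Even n →
      (l * m'⁻¹ * (l * m'⁻¹) = s ↔ l * m⁻¹ * (l * m⁻¹) = s) ∧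
      (r * m'⁻¹ * (r * m'⁻¹) = s ↔ r * m⁻¹ * (r * m⁻¹) = s)) ∧
    (¬ Even n →
      (l * m'⁻¹ * (l * m'⁻¹) = s ↔ r * m⁻¹ * (r * m⁻¹) = s) ∧
      (r * m'⁻¹ * (r * m'⁻¹) = s ↔ l * m⁻¹ * (l * m⁻¹) = s)) := by
  rw [← Int.natAbs_even]
  rcases h with ⟨-, rfl⟩ | ⟨-, rfl⟩
  · exact iterate_halfTwist_parity hs hs2 l r m _
  · have := iterate_halfTwist_parity hs hs2 r l m n.natAbs
    tauto

/-- If l m⁻¹ has square s, then m⁻¹ l = s l⁻¹ m, so the half twist no longer inverts m. This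
linearizes the iteration. -/
theorem halfTwist_eq_mul (hs : ∀ g, Commute s g) (hl : l * m⁻¹ * (l * m⁻¹) = s) :
    halfTwist l r m = s * r * l⁻¹ * m := by
  have h1 : m⁻¹ * l = l⁻¹ * s * m := by
    rw [← hl]
    group
  rw [halfTwist, mul_assoc, h1, (hs r).eq, mul_assoc r s, ← (hs l⁻¹).eq]
  group

theorem iterate_halfTwist_eq_mul (hs : ∀ g, Commute s g) (hs2 : s * s = 1)
    (hl : l * m⁻¹ * (l * m⁻¹) = s) (hr : r * m⁻¹ * (r * m⁻¹) = s) (k : ℕ) :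
    (halfTwist l r)^[k] m = (s * r * l⁻¹) ^ k * m := by
  induction k with
  | zero => simp
  | succ k ih =>
    rw [Function.iterate_succ_apply', halfTwist_eq_mul hs, ih, pow_succ', mul_assoc _ _ m]
    have := iterate_halfTwist_parity hs hs2 l r m k
    tauto

/-- For negative n the sides are interchanged, and s l r⁻¹ is the inverse of s r l⁻¹. -/
theorem IsTwist.eq_zpow_mul (hs : ∀ g, Commute s g) (hs2 : s * s = 1) (h : IsTwist n l r m m')
    (hl : l * m⁻¹ * (l * m⁻¹) = s) (hr : r * m⁻¹ * (r * m⁻¹) = s) :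
    m' = (s * r * l⁻¹) ^ n * m := by
  rcases h with ⟨hn, rfl⟩ | ⟨hn, rfl⟩
  · rw [iterate_halfTwist_eq_mul hs hs2 hl hr, ← zpow_natCast, Int.natCast_natAbs, abs_of_nonneg hn]
  · rw [iterate_halfTwist_eq_mul hs hs2 hr hl, ← zpow_natCast, Int.natCast_natAbs, abs_of_neg hn,
      zpow_neg, ← inv_zpow]
    congr 2
    rw [mul_inv_rev, mul_inv_rev, inv_inv, ← eq_inv_of_mul_eq_one_left hs2, ← mul_assoc,
      ← (hs _).eq, mul_assoc]

theorem not_even_and_even {a b : ℤ} (h : IsCoprime a b) : ¬ (Even a ∧ Even b) := by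
  rintro ⟨ha, hb⟩
  have := h.isUnit_of_dvd' ha.two_dvd hb.two_dvd
  rw [Int.isUnit_iff] at this
  omega

/-- This traces the knot through its columns. P, Q, R say that an exponent is even, and A₁, A₂, A₃
and B₁, B₂, B₃ are the conditions on the strands at the top and at the bottom. With at most one even
exponent the trace visits all of them. -/
theorem parity_chain {P Q R A₁ A₂ A₃ B₁ B₂ B₃ : Prop} (n₁ : ¬ (P ∧ Q)) (n₂ : ¬ (Q ∧ R))
    (n₃ : ¬ (P ∧ R)) (hp : (P → (A₁ ↔ B₁) ∧ (A₂ ↔ B₂)) ∧ (¬ P → (A₁ ↔ B₂) ∧ (A₂ ↔ B₁)))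
    (hq : (Q → (A₂ ↔ B₂) ∧ (A₃ ↔ B₃)) ∧ (¬ Q → (A₂ ↔ B₃) ∧ (A₃ ↔ B₂)))
    (hr : (R → (A₃ ↔ B₃) ∧ (A₁ ↔ B₁)) ∧ (¬ R → (A₃ ↔ B₁) ∧ (A₁ ↔ B₃))) (h : A₁) :
    (A₂ ∧ A₃) ∧ B₁ ∧ B₂ ∧ B₃ := by
  by_cases P <;> by_cases Q <;> by_cases R <;> simp_all

/-- Generators and relations of a group of pretzel type with a central involution `s` such that the
squares of the meridians are equal to `s`. -/
theorem exists_dihedral_generators {p q r : ℤ} (hpq : IsCoprime p q) (hqr : IsCoprime q r)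
    (hpr : IsCoprime p r) (hs : ∀ g, Commute s g) (hs2 : s * s = 1) {u d e v : G}
    (hu : u * u = s) (hgen : Subgroup.closure {u, d, e, s} = ⊤)
    (hp : IsTwist p 1 d v u) (hq : IsTwist q d e v u) (hr : IsTwist r e 1 v u) :
    ∃ x y : G, Subgroup.closure {u, x, y, s} = ⊤ ∧ u * x * u⁻¹ = x⁻¹ ∧ u * y * u⁻¹ = y⁻¹ ∧
      x ^ p = y ^ r ∧ x ^ p = (s * (x * y)⁻¹) ^ q := by
  have h0 : 1 * u⁻¹ * (1 * u⁻¹) = s := by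
    rwa [one_mul, inv_mul_self_eq_iff hs2]
  obtain ⟨⟨hud, hue⟩, hv1, hvd, hve⟩ := parity_chain (not_even_and_even hpq)
    (not_even_and_even hqr) (not_even_and_even hpr) (hp.parity hs hs2) (hq.parity hs hs2)
    (hr.parity hs hs2) h0
  have hs1 : s⁻¹ = s := (eq_inv_of_mul_eq_one_left hs2).symm
  -- The product of u² = s with the factor s from the square of a u⁻¹ is 1, so a is inverted exactly
  -- and not just up to s.
  have conj : ∀ a : G, a * u⁻¹ * (a * u⁻¹) = s → u * a * u⁻¹ = a⁻¹ := by
    intro a ha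
    have h1 : u⁻¹ * a * u⁻¹ = a⁻¹ * s := by
      rw [← ha]
      group
    have h2 : u * a * u⁻¹ = u * u * (u⁻¹ * a * u⁻¹) := by group
    rw [h2, h1, hu, (hs _).eq, mul_assoc, hs2, mul_one]
  have conj_s : ∀ a : G, u * a * u⁻¹ = a⁻¹ → u * (s * a) * u⁻¹ = (s * a)⁻¹ := by
    intro a ha
    rw [← mul_assoc, ← (hs u).eq, mul_assoc, mul_assoc, ← mul_assoc u, ha, mul_inv_rev, hs1, (hs _).eq]
  have conj_inv : ∀ a : G, u * a * u⁻¹ = a⁻¹ → u * a⁻¹ * u⁻¹ = a⁻¹⁻¹ := by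
    intro a ha
    have := congrArg (·⁻¹) ha
    simpa [mul_assoc] using this
  have e1 := hp.eq_zpow_mul hs hs2 hv1 hvd
  have e2 := hq.eq_zpow_mul hs hs2 hvd hve
  have e3 := hr.eq_zpow_mul hs hs2 hve hv1
  -- These are the factors s r l⁻¹ of the outer columns. The factor of the middle column is s e d⁻¹
  -- = s (x y)⁻¹, because the two copies of s in x y cancel.
  refine ⟨s * d, s * e⁻¹, ?_, conj_s _ (conj _ hud), conj_s _ (conj_inv _ (conj _ hue)), ?_, ?_⟩
  · rw [eq_top_iff, ← hgen, Subgroup.closure_le]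
    have hmem : ∀ a ∈ ({u, s * d, s * e⁻¹, s} : Set G),
        a ∈ Subgroup.closure {u, s * d, s * e⁻¹, s} := fun a ha => Subgroup.subset_closure ha
    have hs' := hmem s (by simp)
    rintro _ (rfl | rfl | rfl | rfl)
    · exact hmem _ (by simp)
    · exact (Subgroup.mul_mem_cancel_left _ hs').1 (hmem _ (by simp))
    · exact (Subgroup.inv_mem_iff _).1 ((Subgroup.mul_mem_cancel_left _ hs').1 (hmem _ (by simp)))
    · exact hs'
  · have := mul_right_cancel (e1.symm.trans e3)
    simpa using this
  · have := mul_right_cancel (e1.symm.trans e2)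
    rw [inv_one, mul_one] at this
    rw [this]
    congr 1
    rw [mul_inv_rev, mul_inv_rev, mul_inv_rev, inv_inv, hs1, ← (hs e).eq, ← (hs d⁻¹).eq]
    have : s * (s * e * (s * d⁻¹)) = s * s * (e * s) * d⁻¹ := by group
    rw [this, hs2, one_mul, ← (hs e).eq]

end Group

/-! ### The group `G_{m,𝐢}` of a pretzel knot -/

/-- The element `-1` of `G_{m,𝐢}`. -/
def centralElt {G : Type} [Group G] (m : G) : TracelessGroup m :=
  QuotientGroup.mk' (Subgroup.normalClosure {((m ^ 2, -1) : G × ℤˣ)}) (1, -1)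

/-- The projection from `G` to `G_{m,𝐢}`. -/
def tracelessMk {G : Type} [Group G] (m : G) : G →* TracelessGroup m :=
  (QuotientGroup.mk' (Subgroup.normalClosure {((m ^ 2, -1) : G × ℤˣ)})).comp (MonoidHom.inl G ℤˣ)

section

variable {G : Type} [Group G] {m : G}

theorem commute_centralElt (g : TracelessGroup m) : Commute (centralElt m) g := by
  obtain ⟨⟨a, b⟩, rfl⟩ := QuotientGroup.mk'_surjective _ g
  change _ * _ = _ * _
  rw [centralElt, ← map_mul, ← map_mul, Prod.mk_mul_mk, Prod.mk_mul_mk, one_mul, mul_one, mul_comm]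

theorem centralElt_mul_self : centralElt m * centralElt m = 1 := by
  rw [centralElt, ← map_mul, Prod.mk_mul_mk, one_mul, neg_mul_neg, one_mul]
  exact map_one _

theorem tracelessMk_mul_self : tracelessMk m m * tracelessMk m m = centralElt m := by
  have h : tracelessMk m m * tracelessMk m m * centralElt m = 1 := by
    change QuotientGroup.mk' _ (m, 1) * QuotientGroup.mk' _ (m, 1) * QuotientGroup.mk' _ (1, -1) = 1
    rw [← map_mul, ← map_mul, Prod.mk_mul_mk, Prod.mk_mul_mk]
    refine (QuotientGroup.eq_one_iff _).2 (Subgroup.subset_normalClosure ?_)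
    simp [pow_two]
  rw [eq_inv_of_mul_eq_one_left h, ← eq_inv_of_mul_eq_one_left centralElt_mul_self]

theorem closure_tracelessMk {u d e : G} (h : Subgroup.closure {u, d, e} = ⊤) :
    Subgroup.closure {tracelessMk m u, tracelessMk m d, tracelessMk m e, centralElt m} = ⊤ := by
  rw [eq_top_iff]
  rintro g -
  obtain ⟨⟨a, b⟩, rfl⟩ := QuotientGroup.mk'_surjective _ g
  have hs : centralElt m ∈
      Subgroup.closure {tracelessMk m u, tracelessMk m d, tracelessMk m e, centralElt m} :=
    Subgroup.subset_closure (by simp)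
  have ha : ∀ a, tracelessMk m a ∈
      Subgroup.closure {tracelessMk m u, tracelessMk m d, tracelessMk m e, centralElt m} := by
    intro a
    rw [← Subgroup.mem_comap]
    have h1 : Subgroup.closure {u, d, e} ≤ Subgroup.comap (tracelessMk m)
        (Subgroup.closure {tracelessMk m u, tracelessMk m d, tracelessMk m e, centralElt m}) := by
      rw [Subgroup.closure_le]
      rintro _ (rfl | rfl | rfl) <;> exact Subgroup.subset_closure (by simp)
    exact h1 (h ▸ Subgroup.mem_top a)
  rcases Int.units_eq_one_or b with rfl | rfl
  · exact ha a
  · have : QuotientGroup.mk' (Subgroup.normalClosure {((m ^ 2, -1) : G × ℤˣ)}) (a, -1) =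
        tracelessMk m a * centralElt m := by
      change _ = QuotientGroup.mk' _ (a, 1) * QuotientGroup.mk' _ (1, -1)
      rw [← map_mul, Prod.mk_mul_mk, mul_one, one_mul]
    rw [this]
    exact mul_mem (ha a) hs

/-- Having the square s is invariant under conjugation, as s is central, and under inversion, as s
has order dividing two. -/
theorem tracelessMk_mul_self_of_isConj {u : G} (h : IsConj m u ∨ IsConj m u⁻¹) :
    tracelessMk m u * tracelessMk m u = centralElt m := by
  have key : ∀ a, IsConj m a → tracelessMk m a * tracelessMk m a = centralElt m := by
    intro a ha
    obtain ⟨c, rfl⟩ := isConj_iff.1 ha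
    rw [map_mul, map_mul, map_inv, conj_mul_self_eq_iff commute_centralElt, tracelessMk_mul_self]
  rcases h with h | h
  · exact key _ h
  · rw [← inv_mul_self_eq_iff centralElt_mul_self, ← map_inv]
    exact key _ h

end

/-- The columns lie between the outer region and d, between d and e, and between e and the outer
region, whose generator is 1. -/
theorem exists_tracelessGroup_generators {p q r : ℤ} (hpq : IsCoprime p q) (hqr : IsCoprime q r)
    (hpr : IsCoprime p r) {y₀ : Complement p q r} {m : KnotGroup p q r y₀}
    (hm : IsMeridian p q r m) :
    ∃ u x y : TracelessGroup m, Subgroup.closure {u, x, y, centralElt m} = ⊤ ∧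
      u * u = centralElt m ∧ u * x * u⁻¹ = x⁻¹ ∧ u * y * u⁻¹ = y⁻¹ ∧
      x ^ p = y ^ r ∧ x ^ p = (centralElt m * (x * y)⁻¹) ^ q := by
  let φ : Holonomy ↥((fun v : ℝ × ℝ × ℝ => (v : S3)) '' curve p q r)ᶜ (KnotGroup p q r y₀) :=
    loopHolonomy y₀
  have hout : ∀ x : ℝ, x = -2 ∨ x = 10 → lineHol φ x (1 / 2) = 1 := by
    intro x hx
    refine lineHol_outer φ ?_
    rw [stadium_mid (by norm_num) (by norm_num)]
    rcases hx with rfl | rfl <;> norm_num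
  have hp := (lineHol_isTwist φ (c := 0) (n := p) (Or.inl ⟨rfl, rfl⟩)).map (tracelessMk m)
  have hq := (lineHol_isTwist φ (c := 4) (n := q) (Or.inr (Or.inl ⟨rfl, rfl⟩))).map (tracelessMk m)
  have hr := (lineHol_isTwist φ (c := 8) (n := r) (Or.inr (Or.inr ⟨rfl, rfl⟩))).map (tracelessMk m)
  rw [hout (0 - 2) (by norm_num), map_one, zero_add] at hp
  rw [show (4 : ℝ) - 2 = 2 by norm_num, show (4 : ℝ) + 2 = 6 by norm_num] at hq
  rw [hout (8 + 2) (by norm_num), map_one, show (8 : ℝ) - 2 = 6 by norm_num] at hr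
  have hu := tracelessMk_mul_self_of_isConj (isConj_of_isMeridian hm)
  obtain ⟨x, y, h⟩ := exists_dihedral_generators hpq hqr hpr commute_centralElt centralElt_mul_self hu
    (closure_tracelessMk (closure_lineHol_eq_top y₀)) hp hq hr
  exact ⟨_, x, y, h.1, hu, h.2⟩

end Pretzel

namespace Pretzel

open Matrix

/-! ### Coordinates for `SU(2)` and `𝔰𝔲(2)` -/

/-- The real part of an element of `SU(2)`, seen as a quaternion. -/
def SU2.re (g : SU2) : ℝ := ((g : Matrix (Fin 2) (Fin 2) ℂ) 0 0).re

/-- The imaginary part of an element of `SU(2)`, seen as a quaternion. -/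
def SU2.im (g : SU2) : Fin 3 → ℝ :=
  ![((g : Matrix (Fin 2) (Fin 2) ℂ) 0 0).im, ((g : Matrix (Fin 2) (Fin 2) ℂ) 0 1).re,
    ((g : Matrix (Fin 2) (Fin 2) ℂ) 0 1).im]

/-- The quaternion with given real and imaginary parts, as a matrix. -/
def quatMatrix (t : ℝ) (w : Fin 3 → ℝ) : Matrix (Fin 2) (Fin 2) ℂ :=
  !![⟨t, w 0⟩, ⟨w 1, w 2⟩; ⟨-w 1, w 2⟩, ⟨t, -w 0⟩]

theorem quatMatrix_mul (t t' : ℝ) (w w' : Fin 3 → ℝ) :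
    quatMatrix t w * quatMatrix t' w' =
      quatMatrix (t * t' - w ⬝ᵥ w') (t • w' + t' • w + w ⨯₃ w') := by
  ext i j
  fin_cases i <;> fin_cases j <;> apply Complex.ext <;>
    simp [quatMatrix, Matrix.mul_apply, Fin.sum_univ_two, cross_apply, vec3_dotProduct] <;> ring

theorem quatMatrix_injective {t t' : ℝ} {w w' : Fin 3 → ℝ} (h : quatMatrix t w = quatMatrix t' w') :
    t = t' ∧ w = w' := by
  have h0 := congrFun (congrFun h 0) 0
  have h1 := congrFun (congrFun h 0) 1
  simp only [quatMatrix, Matrix.of_apply, Matrix.cons_val', Matrix.cons_val_zero,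
    Matrix.cons_val_one, Complex.mk.injEq] at h0 h1
  refine ⟨h0.1, ?_⟩
  ext i
  fin_cases i
  · exact h0.2
  · exact h1.1
  · exact h1.2

theorem SU2.coe_inv (g : SU2) : ((g⁻¹ : SU2) : Matrix (Fin 2) (Fin 2) ℂ) =
    (g : Matrix (Fin 2) (Fin 2) ℂ).conjTranspose := rfl

/-- For determinant 1 the inverse is the adjugate, and for a unitary matrix it is the conjugate
transpose; comparing the two expresses the second row by the first. -/
theorem SU2.coe_eq (g : SU2) : (g : Matrix (Fin 2) (Fin 2) ℂ) = quatMatrix g.re g.im := by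
  have hdet : (g : Matrix (Fin 2) (Fin 2) ℂ).det = 1 :=
    (Matrix.mem_specialUnitaryGroup_iff.1 g.2).2
  have h1 : (g : Matrix (Fin 2) (Fin 2) ℂ).conjTranspose =
      (g : Matrix (Fin 2) (Fin 2) ℂ).adjugate := by
    have h2 := Matrix.mul_adjugate (g : Matrix (Fin 2) (Fin 2) ℂ)
    rw [hdet, one_smul] at h2
    rw [← SU2.coe_inv, ← mul_one ((g⁻¹ : SU2) : Matrix (Fin 2) (Fin 2) ℂ), ← h2, ← mul_assoc,
      SU2.coe_inv_mul_coe, one_mul]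
  rw [Matrix.adjugate_fin_two] at h1
  have h00 := congrFun (congrFun h1 0) 0
  have h10 := congrFun (congrFun h1 1) 0
  simp only [Matrix.conjTranspose_apply, Matrix.of_apply, Matrix.cons_val', Matrix.cons_val_zero,
    Matrix.cons_val_one] at h00 h10
  ext i j
  fin_cases i <;> fin_cases j
  · rfl
  · rfl
  · have : (g : Matrix (Fin 2) (Fin 2) ℂ) 1 0 = -star ((g : Matrix (Fin 2) (Fin 2) ℂ) 0 1) := by
      rw [h10, neg_neg]
    apply Complex.ext <;> simp [this, quatMatrix, SU2.im]
  · apply Complex.ext <;> simp [← h00, quatMatrix, SU2.re, SU2.im]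

theorem SU2.ext_iff' {g g' : SU2} : g = g' ↔ g.re = g'.re ∧ g.im = g'.im := by
  refine ⟨fun h => by simp [h], fun h => Subtype.ext ?_⟩
  rw [SU2.coe_eq, SU2.coe_eq, h.1, h.2]

theorem SU2.re_mul_im_mul (g g' : SU2) : (g * g').re = g.re * g'.re - g.im ⬝ᵥ g'.im ∧
    (g * g').im = g.re • g'.im + g'.re • g.im + g.im ⨯₃ g'.im := by
  apply quatMatrix_injective
  rw [← quatMatrix_mul, ← SU2.coe_eq, ← SU2.coe_eq, ← SU2.coe_eq]
  rfl

theorem SU2.re_mul (g g' : SU2) : (g * g').re = g.re * g'.re - g.im ⬝ᵥ g'.im :=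
  (SU2.re_mul_im_mul g g').1

theorem SU2.im_mul (g g' : SU2) :
    (g * g').im = g.re • g'.im + g'.re • g.im + g.im ⨯₃ g'.im :=
  (SU2.re_mul_im_mul g g').2

theorem SU2.re_one : (1 : SU2).re = 1 := by simp [SU2.re]

theorem SU2.im_one : (1 : SU2).im = 0 := by
  ext i
  fin_cases i <;> simp [SU2.im]

theorem SU2.re_inv (g : SU2) : (g⁻¹).re = g.re := by
  simp [SU2.re, SU2.coe_inv]

theorem SU2.im_inv (g : SU2) : (g⁻¹).im = -g.im := by
  have h := SU2.coe_eq g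
  have h10 := congrFun (congrFun h 1) 0
  simp only [quatMatrix, Matrix.of_apply, Matrix.cons_val', Matrix.cons_val_zero,
    Matrix.cons_val_one] at h10
  ext i
  fin_cases i <;> simp [SU2.im, SU2.coe_inv, h10]

theorem SU2.re_sq_add (g : SU2) : g.re ^ 2 + g.im ⬝ᵥ g.im = 1 := by
  have h := SU2.re_mul g g⁻¹
  rw [mul_inv_cancel, SU2.re_one, SU2.re_inv, SU2.im_inv, dotProduct_neg] at h
  linarith

/-- The rotation given by conjugation with a quaternion. -/
def rot (t : ℝ) (n w : Fin 3 → ℝ) : Fin 3 → ℝ :=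
  (t ^ 2 - n ⬝ᵥ n) • w + (2 * t) • (n ⨯₃ w) + (2 * (n ⬝ᵥ w)) • n

theorem quatMatrix_conj (t s : ℝ) (n w : Fin 3 → ℝ) (h : t ^ 2 + n ⬝ᵥ n = 1) :
    quatMatrix t n * quatMatrix s w * quatMatrix t (-n) = quatMatrix s (rot t n w) := by
  rw [quatMatrix_mul, quatMatrix_mul]
  rw [vec3_dotProduct] at h
  congr 1
  · simp [cross_apply, vec3_dotProduct, Matrix.vecHead, Matrix.vecTail]
    linear_combination s * h
  · ext i
    fin_cases i
    all_goals simp [rot, cross_apply, vec3_dotProduct, Matrix.vecHead, Matrix.vecTail]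
    · ring
    · ring
    · ring

theorem SU2.coe_conj (g : SU2) (s : ℝ) (w : Fin 3 → ℝ) :
    (g : Matrix (Fin 2) (Fin 2) ℂ) * quatMatrix s w * ((g⁻¹ : SU2) : Matrix (Fin 2) (Fin 2) ℂ) =
      quatMatrix s (rot g.re g.im w) := by
  rw [SU2.coe_eq g, SU2.coe_eq g⁻¹, SU2.re_inv, SU2.im_inv, quatMatrix_conj _ _ _ _ g.re_sq_add]

theorem SU2.im_conj (k g : SU2) : (k * g * k⁻¹).im = rot k.re k.im g.im := by
  have h : ((k * g * k⁻¹ : SU2) : Matrix (Fin 2) (Fin 2) ℂ) = quatMatrix g.re (rot k.re k.im g.im) := by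
    rw [← SU2.coe_conj, ← SU2.coe_eq]
    rfl
  rw [SU2.coe_eq] at h
  exact (quatMatrix_injective h).2

/-- The identification of `ℝ³` with `𝔰𝔲(2)`. -/
def su2Equiv : (Fin 3 → ℝ) ≃ₗ[ℝ] su2 where
  toFun w := ⟨quatMatrix 0 w, by
    constructor
    · ext i j
      fin_cases i <;> fin_cases j <;> apply Complex.ext <;> simp [quatMatrix]
    · apply Complex.ext <;> simp [quatMatrix, Matrix.trace_fin_two]⟩
  map_add' v w := by
    apply Subtype.ext
    ext i j
    fin_cases i <;> fin_cases j <;> apply Complex.ext <;> simp [quatMatrix] <;> ring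
  map_smul' a w := by
    apply Subtype.ext
    ext i j
    fin_cases i <;> fin_cases j <;> apply Complex.ext <;> simp [quatMatrix]
  invFun v := ![((v : Matrix (Fin 2) (Fin 2) ℂ) 0 0).im, ((v : Matrix (Fin 2) (Fin 2) ℂ) 0 1).re,
    ((v : Matrix (Fin 2) (Fin 2) ℂ) 0 1).im]
  left_inv w := by
    ext i
    fin_cases i <;> simp [quatMatrix]
  right_inv v := by
    obtain ⟨v, h1, h2⟩ := v
    have h00 := congrFun (congrFun h1 0) 0
    have h10 := congrFun (congrFun h1 1) 0
    rw [Matrix.trace_fin_two] at h2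
    simp only [Matrix.conjTranspose_apply, Matrix.neg_apply] at h00 h10
    have h3 := congrArg Complex.re h00
    have h4 := congrArg Complex.re h10
    have h5 := congrArg Complex.im h10
    have h6 := congrArg Complex.re h2
    have h7 := congrArg Complex.im h2
    simp at h3 h4 h5 h6 h7
    apply Subtype.ext
    ext i j
    fin_cases i <;> fin_cases j <;> apply Complex.ext <;> simp [quatMatrix] <;> linarith

theorem Ad_su2Equiv (g : SU2) (w : Fin 3 → ℝ) :
    Ad g (su2Equiv w) = su2Equiv (rot g.re g.im w) :=
  Subtype.ext (g.coe_conj 0 w)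

end Pretzel

/-! ### Linear algebra of rotations -/

namespace Pretzel

open Matrix

theorem dotProduct_rot_self {t : ℝ} {n : Fin 3 → ℝ} (h : t ^ 2 + n ⬝ᵥ n = 1) (w : Fin 3 → ℝ) :
    n ⬝ᵥ rot t n w = n ⬝ᵥ w := by
  rw [vec3_dotProduct] at h
  simp [rot, cross_apply, vec3_dotProduct, Matrix.vecHead, Matrix.vecTail]
  linear_combination (n 0 * w 0 + n 1 * w 1 + n 2 * w 2) * h

/-- A nontrivial rotation has no fixed vector in the plane perpendicular to its axis, so identity
minus rotation is invertible there. -/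
theorem exists_sub_rot_add_smul {t : ℝ} {n : Fin 3 → ℝ} (h : t ^ 2 + n ⬝ᵥ n = 1) (hn : n ≠ 0)
    (v : Fin 3 → ℝ) : ∃ (w : Fin 3 → ℝ) (c : ℝ), v = (w - rot t n w) + c • n := by
  have hν : n ⬝ᵥ n ≠ 0 := by rwa [Ne, dotProduct_self_eq_zero]
  obtain ⟨e, he⟩ : ∃ e : ℝ, e * (n ⬝ᵥ n) = 1 := ⟨(n ⬝ᵥ n)⁻¹, inv_mul_cancel₀ hν⟩
  -- For a rotation by 2θ with t = cos θ and |n| = sin θ, the inverse of identity minus rotation on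
  -- the plane is (1 + cot θ J) / 2, where J is the quarter turn about n.
  refine ⟨(1 / 2 : ℝ) • v + (t * e / 2) • (n ⨯₃ v), (n ⬝ᵥ v) * e, ?_⟩
  rw [vec3_dotProduct] at h he
  ext i
  fin_cases i
  all_goals
    simp [rot, cross_apply, vec3_dotProduct, Matrix.vecHead, Matrix.vecTail]
  · linear_combination (-(v 0) / 2 + t * e / 2 * (n 1 * v 2 - n 2 * v 1) +
      (n 0 * v 0 + n 1 * v 1 + n 2 * v 2) * e * n 0) * h -
      (t * (n 1 * v 2 - n 2 * v 1) + t ^ 2 * v 0 + (n 0 * v 0 + n 1 * v 1 + n 2 * v 2) * n 0) * he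
  · linear_combination (-(v 1) / 2 + t * e / 2 * (n 2 * v 0 - n 0 * v 2) +
      (n 0 * v 0 + n 1 * v 1 + n 2 * v 2) * e * n 1) * h -
      (t * (n 2 * v 0 - n 0 * v 2) + t ^ 2 * v 1 + (n 0 * v 0 + n 1 * v 1 + n 2 * v 2) * n 1) * he
  · linear_combination (-(v 2) / 2 + t * e / 2 * (n 0 * v 1 - n 1 * v 0) +
      (n 0 * v 0 + n 1 * v 1 + n 2 * v 2) * e * n 2) * h -
      (t * (n 0 * v 1 - n 1 * v 0) + t ^ 2 * v 2 + (n 0 * v 0 + n 1 * v 1 + n 2 * v 2) * n 2) * he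

/-- The inner product of w with w - rot t n w is 2 |n × w|², so a fixed vector is parallel to the
axis. -/
theorem eq_smul_of_rot_eq {t : ℝ} {n w : Fin 3 → ℝ} (h : t ^ 2 + n ⬝ᵥ n = 1) (hn : n ≠ 0)
    (hw : rot t n w = w) : ∃ c : ℝ, w = c • n := by
  have hν : n ⬝ᵥ n ≠ 0 := by rwa [Ne, dotProduct_self_eq_zero]
  obtain ⟨e, he⟩ : ∃ e : ℝ, e * (n ⬝ᵥ n) = 1 := ⟨(n ⬝ᵥ n)⁻¹, inv_mul_cancel₀ hν⟩
  have h0 := congrFun hw 0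
  have h1 := congrFun hw 1
  have h2 := congrFun hw 2
  rw [vec3_dotProduct] at h he
  simp [rot, cross_apply, vec3_dotProduct, Matrix.vecHead, Matrix.vecTail] at h0 h1 h2
  have hsq : (n 1 * w 2 - n 2 * w 1) ^ 2 + (n 2 * w 0 - n 0 * w 2) ^ 2 +
      (n 0 * w 1 - n 1 * w 0) ^ 2 = 0 := by
    linear_combination -(1 / 2) * (w 0 * h0 + w 1 * h1 + w 2 * h2) +
      (1 / 2) * (w 0 ^ 2 + w 1 ^ 2 + w 2 ^ 2) * h
  have e0 : n 1 * w 2 - n 2 * w 1 = 0 := by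
    rw [← sq_eq_zero_iff]
    nlinarith [sq_nonneg (n 1 * w 2 - n 2 * w 1), sq_nonneg (n 2 * w 0 - n 0 * w 2),
      sq_nonneg (n 0 * w 1 - n 1 * w 0)]
  have e1 : n 2 * w 0 - n 0 * w 2 = 0 := by
    rw [← sq_eq_zero_iff]
    nlinarith [sq_nonneg (n 1 * w 2 - n 2 * w 1), sq_nonneg (n 2 * w 0 - n 0 * w 2),
      sq_nonneg (n 0 * w 1 - n 1 * w 0)]
  have e2 : n 0 * w 1 - n 1 * w 0 = 0 := by
    rw [← sq_eq_zero_iff]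
    nlinarith [sq_nonneg (n 1 * w 2 - n 2 * w 1), sq_nonneg (n 2 * w 0 - n 0 * w 2),
      sq_nonneg (n 0 * w 1 - n 1 * w 0)]
  refine ⟨(n ⬝ᵥ w) * e, ?_⟩
  ext i
  fin_cases i
  all_goals
    simp only [vec3_dotProduct, Pi.smul_apply, smul_eq_mul, Fin.zero_eta, Fin.mk_one, Fin.reduceFinMk]
  · linear_combination e * (-n 1 * e2 + n 2 * e1) - w 0 * he
  · linear_combination e * (n 0 * e2 - n 2 * e0) - w 1 * he
  · linear_combination e * (-n 0 * e1 + n 1 * e0) - w 2 * he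

/-- The vector t b + s a + a × b is the imaginary part of the product of the quaternions t + a and s
+ b, that is, an axis of the composed rotation. -/
theorem dotProduct_rot_mul {t s : ℝ} {a b : Fin 3 → ℝ} (h : t ^ 2 + a ⬝ᵥ a = 1) (w : Fin 3 → ℝ) :
    (t • b + s • a + a ⨯₃ b) ⬝ᵥ rot t a w =
      (t • b + s • a + a ⨯₃ b) ⬝ᵥ w - 2 * (w ⬝ᵥ (a ⨯₃ b)) := by
  rw [vec3_dotProduct] at h
  simp [rot, cross_apply, vec3_dotProduct, Matrix.vecHead, Matrix.vecTail]
  linear_combination ((t * b 0 + s * a 0 + (a 1 * b 2 - a 2 * b 1)) * w 0 +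
    (t * b 1 + s * a 1 + (a 2 * b 0 - a 0 * b 2)) * w 1 +
    (t * b 2 + s * a 2 + (a 0 * b 1 - a 1 * b 0)) * w 2 -
    2 * (w 0 * (a 1 * b 2 - a 2 * b 1) + w 1 * (a 2 * b 0 - a 0 * b 2) +
      w 2 * (a 0 * b 1 - a 1 * b 0))) * h

/-- The coefficients come from the basis dual to a, b in the plane perpendicular to a × b. -/
theorem exists_eq_smul_add_smul {a b w : Fin 3 → ℝ} (h : a ⨯₃ b ≠ 0) (hw : w ⬝ᵥ (a ⨯₃ b) = 0) :
    ∃ α β : ℝ, w = α • a + β • b := by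
  have hν : (a ⨯₃ b) ⬝ᵥ (a ⨯₃ b) ≠ 0 := by rwa [Ne, dotProduct_self_eq_zero]
  obtain ⟨e, he⟩ : ∃ e : ℝ, e * ((a ⨯₃ b) ⬝ᵥ (a ⨯₃ b)) = 1 :=
    ⟨((a ⨯₃ b) ⬝ᵥ (a ⨯₃ b))⁻¹, inv_mul_cancel₀ hν⟩
  refine ⟨e * (w ⬝ᵥ (b ⨯₃ (a ⨯₃ b))), e * (w ⬝ᵥ ((a ⨯₃ b) ⨯₃ a)), ?_⟩
  rw [vec3_dotProduct] at he hw
  simp [cross_apply] at he hw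
  ext i
  fin_cases i
  all_goals
    simp [cross_apply, Matrix.vecHead, Matrix.vecTail]
  · linear_combination e * (a 1 * b 2 - a 2 * b 1) * hw - w 0 * he
  · linear_combination e * (a 2 * b 0 - a 0 * b 2) * hw - w 1 * he
  · linear_combination e * (a 0 * b 1 - a 1 * b 0) * hw - w 2 * he

theorem rot_of_eq_zero {t : ℝ} (h : t ^ 2 + (0 : Fin 3 → ℝ) ⬝ᵥ 0 = 1) (w : Fin 3 → ℝ) :
    rot t 0 w = w := by
  rw [dotProduct_zero, add_zero] at h
  simp [rot, h]

/-! ### The adjoint action -/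

/-- The traceless part of an element of `SU(2)`. -/
noncomputable def SU2.axis (g : SU2) : su2 := su2Equiv g.im

theorem SU2.Ad_axis (k g : SU2) : Ad k g.axis = (k * g * k⁻¹).axis := by
  rw [SU2.axis, Ad_su2Equiv, SU2.axis, SU2.im_conj]

theorem SU2.axis_inv (g : SU2) : (g⁻¹).axis = -g.axis := by
  rw [SU2.axis, SU2.axis, SU2.im_inv, map_neg]

theorem SU2.Ad_axis_of_commute {k g : SU2} (h : Commute k g) : Ad k g.axis = g.axis := by
  rw [SU2.Ad_axis, h.eq, mul_inv_cancel_right]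

theorem SU2.Ad_of_im_eq_zero {g : SU2} (h : g.im = 0) (v : su2) : Ad g v = v := by
  obtain ⟨w, rfl⟩ := su2Equiv.surjective v
  have h1 := g.re_sq_add
  rw [h] at h1
  rw [Ad_su2Equiv, h, rot_of_eq_zero h1]

theorem SU2.commute_of_im_eq_zero {g : SU2} (h : g.im = 0) (k : SU2) : Commute g k := by
  rw [commute_iff_eq, SU2.ext_iff', SU2.re_mul, SU2.re_mul, SU2.im_mul, SU2.im_mul, h]
  simp [mul_comm]

theorem SU2.mul_self_of_im_eq_zero {g : SU2} (h : g.im = 0) : g * g = 1 := by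
  have h1 := g.re_sq_add
  rw [SU2.ext_iff', SU2.re_mul, SU2.im_mul, SU2.re_one, SU2.im_one]
  rw [h] at h1 ⊢
  simp only [dotProduct_zero, add_zero] at h1
  simp [← pow_two, h1]

theorem SU2.im_eq_zero_of_mul_self {g : SU2} (h : g * g = 1) : g.im = 0 := by
  have h1 := g.re_sq_add
  have h2 := SU2.re_mul g g
  rw [h, SU2.re_one] at h2
  rw [← dotProduct_self_eq_zero]
  linarith

theorem SU2.exists_sub_Ad_add_smul {g : SU2} (h : g.im ≠ 0) (v : su2) :
    ∃ (w : su2) (c : ℝ), v = (w - Ad g w) + c • g.axis := by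
  obtain ⟨v, rfl⟩ := su2Equiv.surjective v
  obtain ⟨w, c, hw⟩ := Pretzel.exists_sub_rot_add_smul g.re_sq_add h v
  refine ⟨su2Equiv w, c, ?_⟩
  rw [Ad_su2Equiv, SU2.axis, ← map_smul, ← map_sub, ← map_add, ← hw]

theorem SU2.eq_smul_axis {g : SU2} (h : g.im ≠ 0) {v : su2} (hv : Ad g v = v) :
    ∃ c : ℝ, v = c • g.axis := by
  obtain ⟨v, rfl⟩ := su2Equiv.surjective v
  rw [Ad_su2Equiv] at hv
  obtain ⟨c, hc⟩ := eq_smul_of_rot_eq g.re_sq_add h (su2Equiv.injective hv)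
  exact ⟨c, by rw [SU2.axis, ← map_smul, ← hc]⟩

theorem SU2.im_ne_zero_left {g k : SU2} (h : ¬ Commute g k) : g.im ≠ 0 := fun h0 =>
  h (SU2.commute_of_im_eq_zero h0 k)

theorem SU2.im_ne_zero_right {g k : SU2} (h : ¬ Commute g k) : k.im ≠ 0 := fun h0 =>
  h (SU2.commute_of_im_eq_zero h0 g).symm

theorem SU2.commute_iff {g k : SU2} : Commute g k ↔ g.im ⨯₃ k.im = 0 := by
  have h1 : k.im ⨯₃ g.im = -(g.im ⨯₃ k.im) := by rw [← cross_anticomm]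
  rw [commute_iff_eq, SU2.ext_iff', SU2.re_mul, SU2.re_mul, SU2.im_mul, SU2.im_mul, h1]
  constructor
  · rintro ⟨-, h⟩
    have h2 : (2 : ℝ) • (g.im ⨯₃ k.im) = 0 := by
      rw [two_smul]
      linear_combination (exp := 1) h
    simpa using h2
  · intro h
    rw [h]
    refine ⟨by rw [mul_comm, dotProduct_comm], by simp [add_comm]⟩

/-- A nonzero common fixed vector would span both axes, and elements with parallel axes commute. -/
theorem SU2.eq_zero_of_Ad_eq {g k : SU2} (h : ¬ Commute g k) {v : su2} (hg : Ad g v = v)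
    (hk : Ad k v = v) : v = 0 := by
  obtain ⟨c, hc⟩ := SU2.eq_smul_axis (SU2.im_ne_zero_left h) hg
  by_contra hv
  have hc0 : c ≠ 0 := by
    rintro rfl
    exact hv (by rw [hc, zero_smul])
  rw [hc, map_smul] at hk
  have h1 := smul_right_injective su2 hc0 hk
  obtain ⟨d, hd⟩ := SU2.eq_smul_axis (SU2.im_ne_zero_right h) h1
  apply h
  rw [SU2.axis, SU2.axis, ← map_smul] at hd
  rw [SU2.commute_iff, su2Equiv.injective hd]
  simp

/-- Pairing the hypothesis with the axis of g k kills every coboundary of g k. What remains is the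
triple product of w with the axes of g and k, so w lies in their plane. -/
theorem SU2.exists_eq_smul_axis_add {g k : SU2} (h : ¬ Commute g k) {w w' : su2}
    (hw : Ad g (w - Ad k w) = w' - Ad (g * k) w') :
    ∃ α β : ℝ, w = α • g.axis + β • k.axis := by
  obtain ⟨w, rfl⟩ := su2Equiv.surjective w
  obtain ⟨w', rfl⟩ := su2Equiv.surjective w'
  have h1 : Ad g (Ad k (su2Equiv w)) = Ad (g * k) (su2Equiv w) := by rw [map_mul]; rfl
  rw [map_sub, h1, Ad_su2Equiv, Ad_su2Equiv, Ad_su2Equiv, ← map_sub, ← map_sub] at hw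
  have h2 := congrArg ((g * k).im ⬝ᵥ ·) (su2Equiv.injective hw)
  simp only [dotProduct_sub, dotProduct_rot_self (g * k).re_sq_add] at h2
  rw [SU2.im_mul, dotProduct_rot_mul g.re_sq_add] at h2
  obtain ⟨α, β, h3⟩ := exists_eq_smul_add_smul (mt SU2.commute_iff.2 h) (w := w) (by linarith)
  exact ⟨α, β, by rw [SU2.axis, SU2.axis, ← map_smul, ← map_smul, ← map_add, ← h3]⟩

theorem SU2.im_centralHom_neg_one : (centralHom (-1)).im = 0 := by
  ext i
  fin_cases i <;> simp [SU2.im, centralHom]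

end Pretzel

namespace Pretzel

/-! ### Cocycles with values in `𝔰𝔲(2)` -/

/-- Crossed homomorphisms with respect to the adjoint action. -/
def IsCrossed {Γ : Type*} [Group Γ] (ρ : Γ →* SU2) (f : Γ → su2) : Prop :=
  ∀ g h, f (g * h) = f g + Ad (ρ g) (f h)

/-- The elements of `SU(2)` that fix a vector. -/
def fixer (v : su2) : Subgroup SU2 where
  carrier := {g | Ad g v = v}
  mul_mem' := by
    intro a b (ha : Ad a v = v) (hb : Ad b v = v)
    change Ad (a * b) v = v
    rw [map_mul, Module.End.mul_apply, hb, ha]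
  one_mem' := by
    change Ad 1 v = v
    rw [map_one, Module.End.one_apply]
  inv_mem' := by
    intro a (ha : Ad a v = v)
    change Ad a⁻¹ v = v
    conv_lhs => rw [← ha]
    rw [← Module.End.mul_apply, ← map_mul, inv_mul_cancel, map_one, Module.End.one_apply]

theorem neg_mem_fixer {v : su2} {g : SU2} (h : g ∈ fixer v) : g ∈ fixer (-v) := by
  have h' : Ad g v = v := h
  change Ad g (-v) = -v
  rw [map_neg, h']

theorem mem_fixer {v : su2} {g : SU2} : g ∈ fixer v ↔ Ad g v = v := Iff.rfl

section

variable {Γ : Type*} [Group Γ] {ρ : Γ →* SU2} {f : Γ → su2}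

theorem IsCrossed.map_one (hf : IsCrossed ρ f) : f 1 = 0 := by
  have h := hf 1 1
  rw [mul_one, _root_.map_one, _root_.map_one, Module.End.one_apply] at h
  exact left_eq_add.1 h

theorem IsCrossed.map_inv (hf : IsCrossed ρ f) (g : Γ) : f g⁻¹ = -Ad (ρ g)⁻¹ (f g) := by
  have h := hf g⁻¹ g
  rw [inv_mul_cancel, hf.map_one, _root_.map_inv] at h
  exact eq_neg_of_add_eq_zero_left h.symm

theorem IsCrossed.map_zpow (hf : IsCrossed ρ f) {g : Γ} (hg : ρ g ∈ fixer (f g)) (n : ℤ) :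
    f (g ^ n) = (n : ℝ) • f g := by
  have hfix : ∀ n : ℤ, Ad (ρ (g ^ n)) (f g) = f g := by
    intro n
    rw [_root_.map_zpow]
    exact (fixer (f g)).zpow_mem hg n
  induction n with
  | zero => simp [hf.map_one]
  | succ n ih =>
    rw [zpow_add_one, hf, ih, hfix]
    push_cast
    module
  | pred n ih =>
    have h := hf (g ^ (-(n : ℤ) - 1)) g
    rw [← zpow_add_one, sub_add_cancel, ih, hfix] at h
    rw [eq_sub_of_add_eq h.symm]
    push_cast
    module

theorem IsCrossed.sub_coboundary (hf : IsCrossed ρ f) (w : su2) :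
    IsCrossed ρ (fun g => f g - (w - Ad (ρ g) w)) := by
  intro g h
  have h1 : Ad (ρ (g * h)) w = Ad (ρ g) (Ad (ρ h) w) := by
    rw [map_mul, map_mul, Module.End.mul_apply]
  simp only [hf g h, h1, map_sub]
  abel

/-- The zeros of a crossed homomorphism. -/
def IsCrossed.zeros (hf : IsCrossed ρ f) : Subgroup Γ where
  carrier := {g | f g = 0}
  mul_mem' := by
    intro a b (ha : f a = 0) (hb : f b = 0)
    change f (a * b) = 0
    rw [hf, ha, hb, map_zero, add_zero]
  one_mem' := hf.map_one
  inv_mem' := by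
    intro a (ha : f a = 0)
    change f a⁻¹ = 0
    rw [hf.map_inv, ha, map_zero, neg_zero]

/-- The crossed homomorphism `f` is principal. -/
def IsPrincipal (ρ : Γ →* SU2) (f : Γ → su2) : Prop := ∃ w, ∀ g, f g = w - Ad (ρ g) w

theorem IsPrincipal.of_sub {w : su2} (h : IsPrincipal ρ (fun g => f g - (w - Ad (ρ g) w))) :
    IsPrincipal ρ f := by
  obtain ⟨v, hv⟩ := h
  refine ⟨w + v, fun g => ?_⟩
  have h := hv g
  dsimp only at h
  rw [← sub_add_cancel (f g) (w - Ad (ρ g) w), h, map_add]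
  abel

/-- As s acts trivially, 0 = f(s²) = 2 f(s). -/
theorem IsCrossed.map_eq_zero (hf : IsCrossed ρ f) {s : Γ} (hs2 : s * s = 1) (hs : (ρ s).im = 0) :
    f s = 0 := by
  have h := hf s s
  rw [hs2, hf.map_one, SU2.Ad_of_im_eq_zero hs, ← two_smul ℝ] at h
  simpa using h.symm

/-- Compare the expansions of f(ab) and f(ba). -/
theorem IsCrossed.Ad_eq_of_commute (hf : IsCrossed ρ f) {a b : Γ} (h : Commute a b)
    (hab : ρ a ∈ fixer (f b)) : Ad (ρ b) (f a) = f a := by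
  have h1 := hf a b
  rw [h.eq, hf b a, mem_fixer.1 hab, add_comm] at h1
  exact add_right_cancel h1

/-- The relation says a u a = u; expand f of the left side. -/
theorem IsCrossed.Ad_eq_of_conj (hf : IsCrossed ρ f) {u a : Γ} (h : u * a * u⁻¹ = a⁻¹)
    (ha : f a = 0) : Ad (ρ a) (f u) = f u := by
  have h1 : a * (u * a) = u := by
    rw [mul_inv_eq_iff_eq_mul.1 h, mul_inv_cancel_left]
  have h2 := hf a (u * a)
  rw [h1, ha, hf, ha, map_zero, add_zero, zero_add] at h2
  exact h2.symm

/-- A crossed homomorphism that vanishes on a power of an element is principal on this element. -/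
theorem IsCrossed.exists_eq_sub (hf : IsCrossed ρ f) {a h : Γ} {n : ℤ} (hn : n ≠ 0)
    (han : a ^ n = h) (hh : f h = 0) (hh' : (ρ h).im = 0) (ha : (ρ a).im ≠ 0) :
    ∃ w, f a = w - Ad (ρ a) w := by
  obtain ⟨w, c, hw⟩ := SU2.exists_sub_Ad_add_smul ha (f a)
  have hf' := hf.sub_coboundary w
  have h1 : f a - (w - Ad (ρ a) w) = c • (ρ a).axis := by
    rw [hw]
    abel
  -- After subtracting the coboundary, the value at a lies on the axis of ρ(a), where f is additive
  -- on powers: n times this value is the value at h, which is 0.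
  have h2 := hf'.map_zpow (g := a) (by
    rw [mem_fixer, h1, map_smul, SU2.Ad_axis_of_commute (Commute.refl _)]) n
  simp only [han, hh, SU2.Ad_of_im_eq_zero hh', sub_self] at h2
  rw [h1] at h2
  have h3 := (smul_eq_zero.1 h2.symm).resolve_left (Int.cast_ne_zero.2 hn)
  refine ⟨w, ?_⟩
  rw [h3] at h1
  exact sub_eq_zero.1 h1

end

/-! ### Arithmetic of the exponents -/

/-- If the sum vanished, each number would divide the product of the other two and so be a unit. But
a sum of three signs is odd. -/
theorem mul_add_mul_add_mul_ne_zero {p q r : ℤ} (hpq : IsCoprime p q) (hqr : IsCoprime q r)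
    (hpr : IsCoprime p r) : p * q + q * r + r * p ≠ 0 := by
  intro h
  have hp : IsUnit p := by
    refine (hpq.mul_right hpr).isUnit_of_dvd' dvd_rfl ⟨-(q + r), ?_⟩
    linear_combination h
  have hq : IsUnit q := by
    refine (hpq.symm.mul_right hqr).isUnit_of_dvd' dvd_rfl ⟨-(p + r), ?_⟩
    linear_combination h
  have hr : IsUnit r := by
    refine (hpr.symm.mul_right hqr.symm).isUnit_of_dvd' dvd_rfl ⟨-(p + q), ?_⟩
    linear_combination h
  rw [Int.isUnit_iff] at hp hq hr
  rcases hp with rfl | rfl <;> rcases hq with rfl | rfl <;> rcases hr with rfl | rfl <;>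
    norm_num at h

/-- The system implies that pq + qr + rp annihilates p ξ. As at most one exponent is zero, two of ξ,
η, ξ + η vanish. -/
theorem eq_zero_of_smul_eq {V : Type*} [AddCommGroup V] [Module ℝ V] {p q r : ℤ}
    (hpq : IsCoprime p q) (hqr : IsCoprime q r) (hpr : IsCoprime p r) {ξ η : V}
    (h1 : (p : ℝ) • ξ = (r : ℝ) • η) (h2 : (p : ℝ) • ξ = -((q : ℝ) • (ξ + η))) :
    ξ = 0 ∧ η = 0 := by
  have h3 : ((p * q + q * r + r * p : ℤ) : ℝ) • ((p : ℝ) • ξ) = 0 := by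
    have e : (p * r : ℝ) • ((p : ℝ) • ξ) =
        -((q * r : ℝ) • ((p : ℝ) • ξ)) - (p * q : ℝ) • ((p : ℝ) • ξ) := by
      calc (p * r : ℝ) • ((p : ℝ) • ξ) = (p * r : ℝ) • -((q : ℝ) • (ξ + η)) := congrArg _ h2
        _ = -((q * r : ℝ) • ((p : ℝ) • ξ)) - (p * q : ℝ) • ((r : ℝ) • η) := by module
        _ = _ := by rw [← h1]
    have e' : ((p * q + q * r + r * p : ℤ) : ℝ) • ((p : ℝ) • ξ) =
        (p * q : ℝ) • ((p : ℝ) • ξ) + (q * r : ℝ) • ((p : ℝ) • ξ) +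
          (p * r : ℝ) • ((p : ℝ) • ξ) := by
      push_cast
      module
    rw [e', e]
    abel
  have h4 := (smul_eq_zero.1 h3).resolve_left
    (Int.cast_ne_zero.2 (mul_add_mul_add_mul_ne_zero hpq hqr hpr))
  have hξ : p ≠ 0 → ξ = 0 := fun hp => (smul_eq_zero.1 h4).resolve_left (Int.cast_ne_zero.2 hp)
  have hη : r ≠ 0 → η = 0 := fun hr =>
    (smul_eq_zero.1 (h1.symm.trans h4)).resolve_left (Int.cast_ne_zero.2 hr)
  have hξη : q ≠ 0 → ξ + η = 0 := fun hq =>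
    (smul_eq_zero.1 (neg_eq_zero.1 (h2.symm.trans h4))).resolve_left (Int.cast_ne_zero.2 hq)
  have ne : ∀ a b : ℤ, IsCoprime a b → a = 0 → b ≠ 0 := by
    rintro a b hab rfl rfl
    exact not_isUnit_zero (isCoprime_zero_left.1 hab)
  by_cases hp : p = 0
  · have h5 := hη (ne _ _ hpr hp)
    refine ⟨?_, h5⟩
    simpa [h5] using hξη (ne _ _ hpq hp)
  · have h5 := hξ hp
    refine ⟨h5, ?_⟩
    by_cases hr : r = 0
    · simpa [h5] using hξη (ne _ _ hqr.symm hr)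
    · exact hη hr

theorem eq_one_of_zpow {G : Type*} [Group G] {a : G} {m n : ℤ} (h : IsCoprime m n)
    (hm : a ^ m = 1) (hn : a ^ n = 1) : a = 1 := by
  obtain ⟨k, l, hkl⟩ := h
  rw [← zpow_one a, ← hkl, zpow_add, mul_comm k, mul_comm l, zpow_mul, zpow_mul, hm, hn]
  simp

/-! ### Vanishing of the cohomology -/

section

variable {Γ : Type*} [Group Γ] {ρ : Γ →* SU2} {f : Γ → su2} {p q r : ℤ} {s u x y : Γ}

theorem IsCrossed.isPrincipal_of_eq_zero (hf : IsCrossed ρ f)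
    (hgen : Subgroup.closure {u, x, y, s} = ⊤) (hs : f s = 0) (hx : f x = 0) (hy : f y = 0)
    (hu : f u = 0) : IsPrincipal ρ f := by
  have h : (⊤ : Subgroup Γ) ≤ hf.zeros := by
    rw [← hgen, Subgroup.closure_le]
    rintro _ (rfl | rfl | rfl | rfl) <;> assumption
  refine ⟨0, fun g => ?_⟩
  rw [map_zero, sub_zero]
  exact h (Subgroup.mem_top g)

theorem conj_zpow_eq_inv {a : Γ} (h : u * a * u⁻¹ = a⁻¹) (n : ℤ) :
    u * a ^ n * u⁻¹ = (a ^ n)⁻¹ := by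
  rw [← conj_zpow, h, inv_zpow]

/-- Where the action fixes the values, f is additive, and the relations among x, y and s(xy)⁻¹
become the linear system for f(x), f(y). -/
theorem IsCrossed.eq_zero_of_mem_fixer (hf : IsCrossed ρ f) (hpq : IsCoprime p q)
    (hqr : IsCoprime q r) (hpr : IsCoprime p r) (hs2 : s * s = 1) (hρs : (ρ s).im = 0)
    (h1 : x ^ p = y ^ r) (h2 : x ^ p = (s * (x * y)⁻¹) ^ q)
    (hxx : ρ x ∈ fixer (f x)) (hyx : ρ y ∈ fixer (f x)) (hxy : ρ x ∈ fixer (f y))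
    (hyy : ρ y ∈ fixer (f y)) : f x = 0 ∧ f y = 0 := by
  have hsum : ∀ g, Ad g (f x) = f x → Ad g (f y) = f y → g ∈ fixer (f x + f y) := by
    intro g hx hy
    rw [mem_fixer, map_add, hx, hy]
  have hm : (ρ (x * y))⁻¹ ∈ fixer (f x + f y) := by
    rw [map_mul]
    exact inv_mem (mul_mem (hsum _ hxx hxy) (hsum _ hyx hyy))
  have hz : f (s * (x * y)⁻¹) = -(f x + f y) := by
    rw [hf, SU2.Ad_of_im_eq_zero hρs, hf.map_eq_zero hs2 hρs, zero_add, hf.map_inv, hf x y,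
      mem_fixer.1 hxy, mem_fixer.1 hm]
  have hz' : ρ (s * (x * y)⁻¹) ∈ fixer (f (s * (x * y)⁻¹)) := by
    rw [hz, map_mul, _root_.map_inv]
    exact neg_mem_fixer (mul_mem (SU2.Ad_of_im_eq_zero hρs _) hm)
  refine eq_zero_of_smul_eq hpq hqr hpr ?_ ?_
  · rw [← hf.map_zpow hxx, ← hf.map_zpow hyy, h1]
  · rw [← hf.map_zpow hxx, h2, hf.map_zpow hz', hz, smul_neg]

/-- Since x and y commute with h = x^p, their values are forced onto the axis of ρ(h), where the
linear system kills them. Then f(h) = 0, so f(u) lies on the axis too, because u inverts h. -/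
theorem IsCrossed.isPrincipal_of_eq_smul_axis (hf : IsCrossed ρ f) (hpq : IsCoprime p q)
    (hqr : IsCoprime q r) (hpr : IsCoprime p r) (hs2 : s * s = 1) (hρs : (ρ s).im = 0)
    (hgen : Subgroup.closure {u, x, y, s} = ⊤) (hux : u * x * u⁻¹ = x⁻¹)
    (h1 : x ^ p = y ^ r) (h2 : x ^ p = (s * (x * y)⁻¹) ^ q) (hH : (ρ (x ^ p)).im ≠ 0) {c : ℝ}
    (hc : f (x ^ p) = c • (ρ (x ^ p)).axis) : IsPrincipal ρ f := by
  have hfix : ∀ (g : SU2) (c : ℝ), Commute g (ρ (x ^ p)) → g ∈ fixer (c • (ρ (x ^ p)).axis) := by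
    intro g c hg
    rw [mem_fixer, map_smul, SU2.Ad_axis_of_commute hg]
  have hcx : Commute x (x ^ p) := (Commute.refl x).zpow_right p
  have hcy : Commute y (x ^ p) := by
    rw [h1]
    exact (Commute.refl y).zpow_right r
  obtain ⟨a, ha⟩ := SU2.eq_smul_axis hH (hf.Ad_eq_of_commute hcx (by
    rw [hc]
    exact hfix _ _ (hcx.map ρ)))
  obtain ⟨b, hb⟩ := SU2.eq_smul_axis hH (hf.Ad_eq_of_commute hcy (by
    rw [hc]
    exact hfix _ _ (hcy.map ρ)))
  have hxx : ρ x ∈ fixer (f x) := by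
    rw [ha]
    exact hfix _ _ (hcx.map ρ)
  obtain ⟨hx, hy⟩ := hf.eq_zero_of_mem_fixer hpq hqr hpr hs2 hρs h1 h2 hxx
    (by rw [ha]; exact hfix _ _ (hcy.map ρ)) (by rw [hb]; exact hfix _ _ (hcx.map ρ))
    (by rw [hb]; exact hfix _ _ (hcy.map ρ))
  have hh : f (x ^ p) = 0 := by rw [hf.map_zpow hxx, hx, smul_zero]
  have hconj := conj_zpow_eq_inv hux p
  obtain ⟨d, hd⟩ := SU2.eq_smul_axis hH (hf.Ad_eq_of_conj hconj hh)
  have hAu : Ad (ρ u) (ρ (x ^ p)).axis = -(ρ (x ^ p)).axis := by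
    rw [SU2.Ad_axis, ← SU2.axis_inv, ← _root_.map_inv, ← _root_.map_inv, ← map_mul, ← map_mul, hconj]
  -- The element u reverses the axis, so the coboundary of w is 2 w at u; at x and y it vanishes.
  refine IsPrincipal.of_sub (w := (d / 2) • (ρ (x ^ p)).axis)
    ((hf.sub_coboundary _).isPrincipal_of_eq_zero hgen ?_ ?_ ?_ ?_)
  · rw [hf.map_eq_zero hs2 hρs, SU2.Ad_of_im_eq_zero hρs, sub_self, sub_self]
  · rw [hx, mem_fixer.1 (hfix _ _ (hcx.map ρ)), sub_self, sub_self]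
  · rw [hy, mem_fixer.1 (hfix _ _ (hcy.map ρ)), sub_self, sub_self]
  · rw [hd, map_smul, hAu]
    module

/-- The case that the common power of the generators is not central. -/
theorem IsCrossed.isPrincipal_of_im_ne_zero (hf : IsCrossed ρ f) (hpq : IsCoprime p q)
    (hqr : IsCoprime q r) (hpr : IsCoprime p r) (hs2 : s * s = 1) (hρs : (ρ s).im = 0)
    (hgen : Subgroup.closure {u, x, y, s} = ⊤) (hux : u * x * u⁻¹ = x⁻¹)
    (h1 : x ^ p = y ^ r) (h2 : x ^ p = (s * (x * y)⁻¹) ^ q) (hH : (ρ (x ^ p)).im ≠ 0) :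
    IsPrincipal ρ f := by
  obtain ⟨w, c, hw⟩ := SU2.exists_sub_Ad_add_smul hH (f (x ^ p))
  refine IsPrincipal.of_sub (w := w) ((hf.sub_coboundary w).isPrincipal_of_eq_smul_axis hpq hqr hpr
    hs2 hρs hgen hux h1 h2 hH (c := c) ?_)
  rw [sub_eq_iff_eq_add', ← hw]

theorem IsCrossed.isPrincipal_of_not_commute_of_eq_zero (hf : IsCrossed ρ f) (hs2 : s * s = 1)
    (hρs : (ρ s).im = 0) (hgen : Subgroup.closure {u, x, y, s} = ⊤) (hux : u * x * u⁻¹ = x⁻¹)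
    (huy : u * y * u⁻¹ = y⁻¹) (hxy : ¬ Commute (ρ x) (ρ y)) (hx : f x = 0) (hy : f y = 0) :
    IsPrincipal ρ f :=
  hf.isPrincipal_of_eq_zero hgen (hf.map_eq_zero hs2 hρs) hx hy
    (SU2.eq_zero_of_Ad_eq hxy (hf.Ad_eq_of_conj hux hx) (hf.Ad_eq_of_conj huy hy))

/-- The power relation concerns z = s(xy)⁻¹, which is not central. As f(s) = 0 and s acts trivially,
a coboundary matching f on z also matches it on xy. -/
theorem IsCrossed.exists_eq_sub_of_eq_zero (hf : IsCrossed ρ f) (hs2 : s * s = 1)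
    (hρs : (ρ s).im = 0) (hxy : ¬ Commute (ρ x) (ρ y)) (hq : q ≠ 0) {h : Γ}
    (h2 : (s * (x * y)⁻¹) ^ q = h) (hh : f h = 0) (hh' : (ρ h).im = 0) :
    ∃ w, f (x * y) = w - Ad (ρ (x * y)) w := by
  have him : (ρ (s * (x * y)⁻¹)).im ≠ 0 := by
    intro h0
    apply hxy
    have h3 := SU2.commute_of_im_eq_zero h0 (ρ x)
    have h4 : Commute (ρ x) (ρ (x * y)) := by
      have e : x * y = (s * (x * y)⁻¹)⁻¹ * s := by group
      rw [e, map_mul, _root_.map_inv]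
      exact h3.symm.inv_right.mul_right (SU2.commute_of_im_eq_zero hρs _).symm
    rw [map_mul, commute_iff_eq, mul_assoc] at h4
    exact mul_left_cancel h4
  obtain ⟨w, hw⟩ := hf.exists_eq_sub hq h2 hh hh' him
  refine ⟨w, ?_⟩
  have hz : s * (x * y)⁻¹ ∈ (hf.sub_coboundary w).zeros := sub_eq_zero.2 hw
  have hs : s ∈ (hf.sub_coboundary w).zeros := (hf.sub_coboundary w).map_eq_zero hs2 hρs
  have e : x * y = (s * (x * y)⁻¹)⁻¹ * s := by group
  have hxy' : x * y ∈ (hf.sub_coboundary w).zeros := by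
    rw [e]
    exact mul_mem (inv_mem hz) hs
  exact sub_eq_zero.1 hxy'

/-- The case that the common power of the generators is central, but that the generators do not
commute. -/
theorem IsCrossed.isPrincipal_of_not_commute (hf : IsCrossed ρ f) (hpq : IsCoprime p q)
    (hqr : IsCoprime q r) (hpr : IsCoprime p r) (hs2 : s * s = 1) (hρs : (ρ s).im = 0)
    (hgen : Subgroup.closure {u, x, y, s} = ⊤) (hux : u * x * u⁻¹ = x⁻¹)
    (huy : u * y * u⁻¹ = y⁻¹)
    (h1 : x ^ p = y ^ r) (h2 : x ^ p = (s * (x * y)⁻¹) ^ q) (hH : (ρ (x ^ p)).im = 0)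
    (hxy : ¬ Commute (ρ x) (ρ y)) : IsPrincipal ρ f := by
  have hcx : Commute x (x ^ p) := (Commute.refl x).zpow_right p
  have hcy : Commute y (x ^ p) := by
    rw [h1]
    exact (Commute.refl y).zpow_right r
  have hh : f (x ^ p) = 0 := SU2.eq_zero_of_Ad_eq hxy
    (hf.Ad_eq_of_commute hcx.symm (SU2.Ad_of_im_eq_zero hH _))
    (hf.Ad_eq_of_commute hcy.symm (SU2.Ad_of_im_eq_zero hH _))
  have unit : ∀ (a : Γ) (n : ℤ), IsUnit n → a ^ n = 1 → a = 1 := by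
    intro a n hn ha
    rcases Int.isUnit_iff.1 hn with rfl | rfl <;> simpa using ha
  -- If one exponent is 0, then h = 1 and the other exponents are units, so x or y is trivial and
  -- the images commute.
  have hp : p ≠ 0 := by
    rintro rfl
    rw [zpow_zero] at h1
    exact hxy (by rw [unit y r (isCoprime_zero_left.1 hpr) h1.symm, _root_.map_one]; exact Commute.one_right _)
  have hq : q ≠ 0 := by
    rintro rfl
    rw [zpow_zero] at h2
    exact hxy (by rw [unit x p (isCoprime_zero_right.1 hpq) h2, _root_.map_one]; exact Commute.one_left _)
  have hr : r ≠ 0 := by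
    rintro rfl
    rw [zpow_zero] at h1
    exact hxy (by rw [unit x p (isCoprime_zero_right.1 hpr) h1, _root_.map_one]; exact Commute.one_left _)
  obtain ⟨w₁, hw₁⟩ := hf.exists_eq_sub hp rfl hh hH (SU2.im_ne_zero_left hxy)
  refine IsPrincipal.of_sub (w := w₁) ?_
  obtain ⟨f₁, hf₁⟩ : ∃ f₁, f₁ = fun g => f g - (w₁ - Ad (ρ g) w₁) := ⟨_, rfl⟩
  have hc : IsCrossed ρ f₁ := hf₁ ▸ hf.sub_coboundary w₁
  have hx : f₁ x = 0 := by
    rw [hf₁]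
    exact sub_eq_zero.2 hw₁
  have hh₁ : f₁ (x ^ p) = 0 := by
    rw [hf₁]
    simp only [hh, SU2.Ad_of_im_eq_zero hH, sub_self]
  rw [← hf₁]
  -- With f₁(x) = 0, the value at xy is the rotated value at y. Both being coboundaries puts w into
  -- the plane of the two axes.
  obtain ⟨w, hw⟩ := hc.exists_eq_sub hr h1.symm hh₁ hH (SU2.im_ne_zero_right hxy)
  obtain ⟨w', hw'⟩ := hc.exists_eq_sub_of_eq_zero hs2 hρs hxy hq h2.symm hh₁ hH
  rw [hc x y, hx, zero_add, hw, map_mul] at hw'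
  obtain ⟨α, β, hαβ⟩ := SU2.exists_eq_smul_axis_add hxy hw'
  have hX := SU2.Ad_axis_of_commute (Commute.refl (ρ x))
  have hY := SU2.Ad_axis_of_commute (Commute.refl (ρ y))
  -- The coboundary of this multiple vanishes at x. At y it leaves the coboundary of a multiple of
  -- the axis of ρ(y), which is 0.
  refine IsPrincipal.of_sub (w := α • (ρ x).axis)
    ((hc.sub_coboundary _).isPrincipal_of_not_commute_of_eq_zero hs2 hρs hgen hux huy hxy ?_ ?_)
  · rw [hx, map_smul, hX, sub_self, sub_self]
  · rw [hw, hαβ, map_add, map_smul, map_smul, hY]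
    abel

/-- The case that the generators commute up to the centre, and that their common power is central. -/
theorem IsCrossed.isPrincipal_of_commute (hf : IsCrossed ρ f) (hpq : IsCoprime p q)
    (hqr : IsCoprime q r) (hpr : IsCoprime p r) (hs : ∀ g, Commute s g) (hs2 : s * s = 1)
    (hρs : (ρ s).im = 0) (hgen : Subgroup.closure {u, x, y, s} = ⊤) (hu : u * u = s)
    (h1 : x ^ p = y ^ r) (h2 : x ^ p = (s * (x * y)⁻¹) ^ q) (hH : (ρ (x ^ p)).im = 0)
    (hxy : Commute (ρ x) (ρ y)) : IsPrincipal ρ f := by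
  have hH2 := SU2.mul_self_of_im_eq_zero hH
  have hX : (ρ x * ρ x) ^ p = 1 := by
    rw [(Commute.refl (ρ x)).mul_zpow, ← _root_.map_zpow, hH2]
  have hY : (ρ y * ρ y) ^ r = 1 := by
    rw [(Commute.refl (ρ y)).mul_zpow, ← _root_.map_zpow, ← h1, hH2]
  have hXY : (ρ x * ρ x) ^ q * (ρ y * ρ y) ^ q = 1 := by
    have e1 : (s * (x * y)⁻¹) * (s * (x * y)⁻¹) = ((x * y) * (x * y))⁻¹ := by
      have key : ∀ g, (s * g) * (s * g) = g * g := by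
        intro g
        rw [mul_assoc, ← mul_assoc g, ← (hs g).eq, mul_assoc, ← mul_assoc, hs2, one_mul]
      rw [key, mul_inv_rev (x * y)]
    have e2 : ρ ((s * (x * y)⁻¹) * (s * (x * y)⁻¹)) ^ q = 1 := by
      rw [map_mul, (Commute.refl _).mul_zpow, ← _root_.map_zpow, ← h2, hH2]
    have e3 : ρ x * ρ y * (ρ x * ρ y) = ρ x * ρ x * (ρ y * ρ y) := by
      rw [mul_assoc, ← mul_assoc (ρ y), ← hxy.eq, mul_assoc, mul_assoc]
    rw [e1, _root_.map_inv, inv_zpow, inv_eq_one, map_mul, map_mul, e3, Commute.mul_zpow] at e2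
    · exact e2
    · exact (hxy.mul_left hxy).mul_right (hxy.mul_left hxy)
  -- The squares X, Y of ρ(x), ρ(y) satisfy X^p = Y^r = (XY)^q = 1, hence X^(qr) = 1, and p is
  -- coprime to qr.
  have hX1 : ρ x * ρ x = 1 := by
    refine eq_one_of_zpow (hpq.mul_right hpr) hX ?_
    rw [zpow_mul, eq_inv_of_mul_eq_one_left hXY, inv_zpow, ← zpow_mul, mul_comm, zpow_mul, hY]
    simp
  have hY1 : ρ y * ρ y = 1 := by
    refine eq_one_of_zpow (hpr.symm.mul_right hqr.symm) hY ?_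
    rw [mul_comm, zpow_mul, eq_inv_of_mul_eq_one_right hXY, hX1]
    simp
  have hxim := SU2.im_eq_zero_of_mul_self hX1
  have hyim := SU2.im_eq_zero_of_mul_self hY1
  obtain ⟨hx, hy⟩ := hf.eq_zero_of_mem_fixer hpq hqr hpr hs2 hρs h1 h2
    (SU2.Ad_of_im_eq_zero hxim _) (SU2.Ad_of_im_eq_zero hyim _) (SU2.Ad_of_im_eq_zero hxim _)
    (SU2.Ad_of_im_eq_zero hyim _)
  -- Here the passage to G_{m,𝐢} is used directly: u² = s and f(s) = 0 force ρ(u) to negate f(u), so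
  -- f(u) is the coboundary of its half.
  have hs0 := hf.map_eq_zero hs2 hρs
  have hu0 := hf u u
  rw [hu, hs0] at hu0
  have hAu : Ad (ρ u) (f u) = -f u := eq_neg_of_add_eq_zero_right hu0.symm
  refine IsPrincipal.of_sub (w := (1 / 2 : ℝ) • f u)
    ((hf.sub_coboundary _).isPrincipal_of_eq_zero hgen ?_ ?_ ?_ ?_)
  · rw [hs0, SU2.Ad_of_im_eq_zero hρs, sub_self, sub_self]
  · rw [hx, SU2.Ad_of_im_eq_zero hxim, sub_self, sub_self]
  · rw [hy, SU2.Ad_of_im_eq_zero hyim, sub_self, sub_self]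
  · rw [map_smul, hAu]
    module

/-- Crossed homomorphisms of a group of pretzel type are principal. -/
theorem IsCrossed.isPrincipal (hf : IsCrossed ρ f) (hpq : IsCoprime p q)
    (hqr : IsCoprime q r) (hpr : IsCoprime p r) (hs : ∀ g, Commute s g) (hs2 : s * s = 1)
    (hρs : (ρ s).im = 0) (hgen : Subgroup.closure {u, x, y, s} = ⊤) (hu : u * u = s)
    (hux : u * x * u⁻¹ = x⁻¹) (huy : u * y * u⁻¹ = y⁻¹)
    (h1 : x ^ p = y ^ r) (h2 : x ^ p = (s * (x * y)⁻¹) ^ q) : IsPrincipal ρ f := by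
  by_cases hH : (ρ (x ^ p)).im = 0
  · by_cases hxy : Commute (ρ x) (ρ y)
    · exact hf.isPrincipal_of_commute hpq hqr hpr hs hs2 hρs hgen hu h1 h2 hH hxy
    · exact hf.isPrincipal_of_not_commute hpq hqr hpr hs2 hρs hgen hux huy h1 h2 hH hxy
  · exact hf.isPrincipal_of_im_ne_zero hpq hqr hpr hs2 hρs hgen hux h1 h2 hH

end

end Pretzel

/-! ### From crossed homomorphisms to group cohomology -/

namespace Pretzel

theorem factorization_centralElt {G : Type} [Group G] {m : G} {ρ : G →* SU2} (hρ : ρ ∈ RepSpace m) :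
    factorization ρ hρ (centralElt m) = centralHom (-1) := by
  change ρ 1 * centralHom (-1) = _
  rw [map_one, one_mul]

theorem subsingleton_H1_of_isPrincipal {Γ : Type} [Group Γ] (ρ : Γ →* SU2)
    (h : ∀ f, IsCrossed ρ f → IsPrincipal ρ f) :
    Subsingleton (groupCohomology.H1 (Rep.of (Ad.comp ρ))) := by
  refine subsingleton_of_forall_eq 0 fun z => ?_
  refine groupCohomology.H1_induction_on z fun f => ?_
  rw [groupCohomology.H1π_eq_zero_iff]
  obtain ⟨w, hw⟩ := h (fun g => f g) (fun g h =>
    ((groupCohomology.mem_cocycles₁_iff _).1 f.2 g h).trans (add_comm _ _))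
  -- The coboundary of the complex is Ad v - v, opposite to the sign convention for principal
  -- crossed homomorphisms used here.
  refine ⟨-w, funext fun g => ?_⟩
  refine Eq.trans ?_ (hw g).symm
  change Ad (ρ g) (-w) - -w = _
  rw [map_neg]
  abel

end Pretzel

theorem theorem5 (p q r : ℤ) (hpq : IsCoprime p q) (hqr : IsCoprime q r) (hpr : IsCoprime p r)
    (y₀ : Pretzel.Complement p q r) (m : Pretzel.KnotGroup p q r y₀)
    (hm : Pretzel.IsMeridian p q r m)
    (ρ : Pretzel.KnotGroup p q r y₀ →* Pretzel.SU2) (hρ : ρ ∈ Pretzel.RepSpace m) :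
    Subsingleton (Pretzel.TwistedH1 ρ hρ) := by
  obtain ⟨u, x, y, hgen, hu, hux, huy, h1, h2⟩ :=
    Pretzel.exists_tracelessGroup_generators hpq hqr hpr hm
  refine Pretzel.subsingleton_H1_of_isPrincipal _ fun f hf =>
    hf.isPrincipal hpq hqr hpr Pretzel.commute_centralElt Pretzel.centralElt_mul_self ?_ hgen hu hux
      huy h1 h2
  rw [Pretzel.factorization_centralElt, Pretzel.SU2.im_centralHom_neg_one]
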